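/- Let $(\Omega,\mathcal F,\mathbb P)$ be a probability space, $\Theta\subset\mathbb R^p$ a convex set, $\theta_0\in\Theta$, and let $L(\theta)$, $\theta\in\Theta$, be a real random field such that $\mathbb E L(\theta)$ exists for every $\theta\in\Theta$. Write $L(\theta,\theta_0)=L(\theta)-L(\theta_0)$. Let $\mu$ be a real function on $\Theta$ and assume that $L(\cdot)$ (almost surely), $\mathbb E L(\cdot)$ and $\mu(\cdot)$ are differentiable at every point of $\Theta$. Put $$\zeta(\theta)=\mu(\theta)\{L(\theta,\theta_0)-\mathbb E L(\theta,\theta_0)\},\qquad V(\theta)=\mathbb E\,\nabla\zeta(\theta)[\nabla\zeta(\theta)]^\top,$$ $$H(\lambda,\gamma,\theta)=\log\mathbb E\exp\Bigl\{2\lambda\,\frac{\gamma^\top\nabla\zeta(\theta)}{\sqrt{\gamma^\top V(\theta)\gamma}}\Bigr\},\qquad \mathfrak M(\theta,\theta_0)=-\log\mathbb E\exp\{\mu(\theta)L(\theta,\theta_0)\},$$ and assume that $V(\theta)$ is positive definite for every $\theta\in\Theta$. Assume further: * (EG) for every $\theta\in\Theta$ the set $\Upsilon(\theta)$ of all $m>0$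 with $\mathbb E\exp\{mL(\theta,\theta_0)\}<\infty$ is non-empty, and $\mu(\theta)\in\Upsilon(\theta)$; * (ED) for some $\nu_0\ge 1$ and $\bar\lambda>0$, $H(\lambda,\gamma,\theta)\le 2\nu_0^2\lambda^2$ for all $\theta\in\Theta$, all unit vectors $\gamma\in\mathbb R^p$ and all $|\lambda|\le\bar\lambda$. Let $0\le\rho<1$, $0\le s<1$, let $\varepsilon>0$ satisfy $\varepsilon\rho/(1-\rho)\le\bar\lambda$, and let $\nu_1\ge1$. Put $B'(\varepsilon,\theta^\circ)=\{\theta\in\mathbb R^p:(\theta-\theta^\circ)^\top V(\theta^\circ)(\theta-\theta^\circ)\le\varepsilon^2\}$ and suppose that for every $\theta^\circ\in\Theta$ one has $B'(\varepsilon,\theta^\circ)\subseteq\Theta$ and $$\sup_{\theta,\theta'\in B'(\varepsilon,\theta^\circ)}\ \sup_{\|\gamma\|=1}\ \frac{\gamma^\top V(\theta)\gamma}{\gamma^\top V(\theta')\gamma}\le\nu_1 .$$ Let $\mathfrak S^2(\theta,\theta')=\sup_{t\in[0,1]}(\theta-\theta')^\top V((1-t)\theta'+t\theta)(\theta-\theta')$,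 $B(\varepsilon,\theta^\circ)=\{\theta\in\Theta:\mathfrak S(\theta,\theta^\circ)\le\varepsilon\}$, $\mathfrak M_\varepsilon(\theta^\circ,\theta_0)=\inf_{\theta\in B(\varepsilon,\theta^\circ)}\mathfrak M(\theta,\theta_0)$, and suppose that $$\mathfrak H_\varepsilon(\rho,s)=\log\Bigl(\omega_p^{-1}\varepsilon^{-p}\int_\Theta\sqrt{\det V(\theta)}\,\exp\{-\rho(1-s)\mathfrak M_\varepsilon(\theta,\theta_0)\}\,d\theta\Bigr)<\infty ,$$ where $\omega_p$ is the Lebesgue measure of the unit ball of $\mathbb R^p$ (the integrand being measurable). Let $\mathbb Q_p=\sum_{k\ge1}2^{-k}\log N(2^{-k})$, where $N(r)$ is the least number of closed Euclidean balls of radius $r$ that cover the closed unit ball of $\mathbb R^p$. Then $$\log\ \mathbb E\sup_{\theta\in\Theta}\exp\bigl\{\rho[\mu(\theta)L(\theta,\theta_0)+s\,\mathfrak M(\theta,\theta_0)]\bigr\}\ \le\ (1-\rho)\mathbb Q_p+\frac{2\nu_0^2\varepsilon^2\rho^2}{1-\rho}+2p\log\nu_1+\mathfrak H_\varepsilon(\rho,s).$$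 -/

import Mathlib

open MeasureTheory
open scoped ENNReal NNReal

noncomputable section

namespace MinContrast

/-- The parameter space `ℝ^p` with its Euclidean norm and Lebesgue measure. -/
abbrev Param (p : ℕ) : Type := EuclideanSpace ℝ (Fin p)

variable {p : ℕ} {Ω : Type*} [MeasurableSpace Ω]

/-- The random field increment `L(θ, θ') = L(θ) - L(θ')`. -/
def incr (L : Param p → Ω → ℝ) (θ θ' : Param p) (ω : Ω) : ℝ := L θ ω - L θ' ω

/-- The set `Υ(θ)` of all `m > 0` for which `E exp{m L(θ, θ₀)}` is finite. -/
def Upsilon (P : Measure Ω) (L : Param p → Ω → ℝ) (θ₀ θ : Param p) : Set ℝ :=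
  {m | 0 < m ∧ Integrable (fun ω => Real.exp (m * incr L θ θ₀ ω)) P}

/-- The global exponential moment condition (EG). -/
def CondEG (P : Measure Ω) (L : Param p → Ω → ℝ) (θ₀ : Param p) (Θ : Set (Param p)) : Prop :=
  ∀ θ ∈ Θ, (Upsilon P L θ₀ θ).Nonempty

/-- The rate function `M(θ, θ₀) = - log E exp{μ(θ) L(θ, θ₀)}`. -/
def rate (P : Measure Ω) (L : Param p → Ω → ℝ) (μ : Param p → ℝ) (θ₀ θ : Param p) : ℝ :=
  -Real.log (∫ ω, Real.exp (μ θ * incr L θ θ₀ ω) ∂P)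

/-- The centred process `ζ(θ) = μ(θ) {L(θ, θ₀) - E L(θ, θ₀)}`. -/
def zeta (P : Measure Ω) (L : Param p → Ω → ℝ) (μ : Param p → ℝ) (θ₀ θ : Param p) (ω : Ω) : ℝ :=
  μ θ * (incr L θ θ₀ ω - ∫ ω', incr L θ θ₀ ω' ∂P)

/-- The gradient `∇ζ(θ)` with respect to the parameter. -/
def gradZeta (P : Measure Ω) (L : Param p → Ω → ℝ) (μ : Param p → ℝ) (θ₀ θ : Param p) (ω : Ω) :
    Param p :=
  gradient (fun θ' => zeta P L μ θ₀ θ' ω) θ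

/-- The matrix `V(θ) = E ∇ζ(θ) [∇ζ(θ)]ᵀ`. -/
def covMat (P : Measure Ω) (L : Param p → Ω → ℝ) (μ : Param p → ℝ) (θ₀ θ : Param p) :
    Matrix (Fin p) (Fin p) ℝ :=
  Matrix.of fun i j => ∫ ω, gradZeta P L μ θ₀ θ ω i * gradZeta P L μ θ₀ θ ω j ∂P

/-- The quadratic form `uᵀ A u`. -/
def quad (A : Matrix (Fin p) (Fin p) ℝ) (u : Param p) : ℝ :=
  ∑ i, ∑ j, u i * A i j * u j

/-- `H(lam, γ, θ) = log E exp{2 lam γᵀ∇ζ(θ) / √(γᵀ V(θ) γ)}`, with values in `[-∞, ∞]`. -/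
def logMoment (P : Measure Ω) (L : Param p → Ω → ℝ) (μ : Param p → ℝ) (θ₀ : Param p)
    (lam : ℝ) (γ θ : Param p) : EReal :=
  ENNReal.log (∫⁻ ω, ENNReal.ofReal (Real.exp (2 * lam *
    (inner ℝ γ (gradZeta P L μ θ₀ θ ω) / √(quad (covMat P L μ θ₀ θ) γ)))) ∂P)

/-- The gradient exponential moment condition (ED) with the constants `ν₀ ≥ 1` and `lamBar > 0`,
written without the division by `lam ^ 2`: `H(lam, γ, θ) ≤ 2 ν₀² lam²`
for all `θ ∈ Θ`, all unit vectors `γ` and all `|lam| ≤ lamBar`. -/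
def CondED (P : Measure Ω) (L : Param p → Ω → ℝ) (μ : Param p → ℝ) (θ₀ : Param p)
    (Θ : Set (Param p)) (ν₀ lamBar : ℝ) : Prop :=
  1 ≤ ν₀ ∧ 0 < lamBar ∧ ∀ θ ∈ Θ, ∀ lam : ℝ, |lam| ≤ lamBar → ∀ γ : Param p, ‖γ‖ = 1 →
    logMoment P L μ θ₀ lam γ θ ≤ ((2 * ν₀ ^ 2 * lam ^ 2 : ℝ) : EReal)

/-- The square `S²(θ, θ')` of the metric, the supremum over `t ∈ [0,1]` of
`(θ - θ')ᵀ V((1 - t) θ' + t θ) (θ - θ')`, with values in `[0, ∞]`. -/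
def metricSq (P : Measure Ω) (L : Param p → Ω → ℝ) (μ : Param p → ℝ) (θ₀ θ θ' : Param p) : ℝ≥0∞ :=
  ⨆ t ∈ Set.Icc (0 : ℝ) 1,
    ENNReal.ofReal (quad (covMat P L μ θ₀ ((1 - t) • θ' + t • θ)) (θ - θ'))

/-- The local ball `B(ε, θ°) = {θ ∈ Θ : S(θ, θ°) ≤ ε}`. -/
def localBall (P : Measure Ω) (L : Param p → Ω → ℝ) (μ : Param p → ℝ) (θ₀ : Param p)
    (Θ : Set (Param p)) (ε : ℝ) (θc : Param p) : Set (Param p) :=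
  {θ | θ ∈ Θ ∧ metricSq P L μ θ₀ θ θc ≤ ENNReal.ofReal (ε ^ 2)}

/-- The ellipsoid `B'(ε, θ°) = {θ : (θ - θ°)ᵀ V(θ°) (θ - θ°) ≤ ε²}` in `ℝ^p`. -/
def ellipsoid (P : Measure Ω) (L : Param p → Ω → ℝ) (μ : Param p → ℝ) (θ₀ : Param p)
    (ε : ℝ) (θc : Param p) : Set (Param p) :=
  {θ | quad (covMat P L μ θ₀ θc) (θ - θc) ≤ ε ^ 2}

/-- The magnitude of `V` over the ellipsoid `B'(ε, θ°)`: the supremum of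
`γᵀ V(θ) γ / γᵀ V(θ') γ` over `θ, θ' ∈ B'(ε, θ°)` and unit vectors `γ`. -/
def magnitude (P : Measure Ω) (L : Param p → Ω → ℝ) (μ : Param p → ℝ) (θ₀ : Param p)
    (ε : ℝ) (θc : Param p) : ℝ≥0∞ :=
  ⨆ θ ∈ ellipsoid P L μ θ₀ ε θc, ⨆ θ' ∈ ellipsoid P L μ θ₀ ε θc,
    ⨆ γ ∈ Metric.sphere (0 : Param p) 1,
      ENNReal.ofReal (quad (covMat P L μ θ₀ θ) γ / quad (covMat P L μ θ₀ θ') γ)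

/-- `M_ε(θ°, θ₀)`, the infimum of `M(θ, θ₀)` over `θ ∈ B(ε, θ°)`, with values in `[-∞, ∞]`. -/
def rateInf (P : Measure Ω) (L : Param p → Ω → ℝ) (μ : Param p → ℝ) (θ₀ : Param p)
    (Θ : Set (Param p)) (ε : ℝ) (θc : Param p) : EReal :=
  ⨅ θ ∈ localBall P L μ θ₀ Θ ε θc, ((rate P L μ θ₀ θ : ℝ) : EReal)

/-- The integrand `√(det V(θ)) exp{-ρ (1 - s) M_ε(θ, θ₀)}`. -/
def integrand (P : Measure Ω) (L : Param p → Ω → ℝ) (μ : Param p → ℝ) (θ₀ : Param p)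
    (Θ : Set (Param p)) (ε ρ s : ℝ) (θ : Param p) : ℝ≥0∞ :=
  ENNReal.ofReal (√(covMat P L μ θ₀ θ).det) *
    EReal.exp (((-(ρ * (1 - s)) : ℝ) : EReal) * rateInf P L μ θ₀ Θ ε θ)

/-- `H_ε(ρ, s)`, the logarithm of `ω_p⁻¹ ε^{-p}` times the Lebesgue integral of the integrand
over `Θ`, where `ω_p` is the Lebesgue measure of the unit ball. -/
def logIntegral (P : Measure Ω) (L : Param p → Ω → ℝ) (μ : Param p → ℝ) (θ₀ : Param p)
    (Θ : Set (Param p)) (ε ρ s : ℝ) : EReal :=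
  ENNReal.log ((volume (Metric.closedBall (0 : Param p) 1))⁻¹ * ENNReal.ofReal ((ε ^ p)⁻¹) *
    ∫⁻ θ in Θ, integrand P L μ θ₀ Θ ε ρ s θ)

/-- `Ω(ρ, s)`, the expectation of the supremum over `θ ∈ Θ` of
`exp{ρ [μ(θ) L(θ, θ₀) + s M(θ, θ₀)]}`, with values in `[0, ∞]`. -/
def supMoment (P : Measure Ω) (L : Param p → Ω → ℝ) (μ : Param p → ℝ) (θ₀ : Param p)
    (Θ : Set (Param p)) (ρ s : ℝ) : ℝ≥0∞ :=
  ∫⁻ ω, ⨆ θ ∈ Θ, ENNReal.ofReal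
    (Real.exp (ρ * (μ θ * incr L θ θ₀ ω + s * rate P L μ θ₀ θ))) ∂P

/-- The least number of closed Euclidean balls of radius `r` needed to cover the closed unit ball
of `ℝ^p` (finite for `r > 0`). -/
def unitBallCovering (p : ℕ) (r : ℝ≥0) : ℕ :=
  (Metric.externalCoveringNumber r (Metric.closedBall (0 : Param p) 1)).toNat

/-- The entropy `Q_p = ∑_{k ≥ 1} 2^{-k} log N(2^{-k})` of the Euclidean unit ball of `ℝ^p`. -/
def unitBallEntropy (p : ℕ) : ℝ :=
  ∑' k : ℕ, (2 : ℝ)⁻¹ ^ (k + 1) * Real.log (unitBallCovering p ((2 : ℝ≥0)⁻¹ ^ (k + 1)))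

end MinContrast

end

/-! Write V(θ) = A(θ)ᵀA(θ), so that the local metric at θ is ‖A(θ)v‖, and put λ = ερ/(1-ρ), β =
2ν₀²λ², σ = √ν₁. With Λ(θ) = -M(θ,θ₀) - μ(θ) E L(θ,θ₀) one has E exp(ζ(θ) - Λ(θ)) = 1, and the
exponent to be bounded is ρ(ζ - Λ) - ρ(1-s)M. Condition (ED) and Jensen's inequality along segments
control the increments of ζ. No modulus of continuity of Λ or M is available, so chaining around a
fixed centre is not enough by itself.

The core is `ExpField.lintegral_sup_le`, for a finite family θ_i with penalties n_i: E max_i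
exp(ρ(ζ(θ_i) - Λ_i) - n_i) ≤ exp((1-ρ)(Q_p + β)) σ^p ∫ W. Here W is the `envelope`, the maximum of
e^{-n_i} times the uniform density k_i on the ellipsoid B_i of radius ε/σ² about θ_i. The small
radius makes the frames of meeting ellipsoids comparable, and puts θ_i into B(ε,x) for every x in
B_i. Hence, for n_i = ρ(1-s)M(θ_i,θ₀), W is at most σ^{3p} ω_p⁻¹ ε^{-p} times the integrand
(`ExpField.envelope_le`). The powers of σ combine to ν₁^{2p}, and (1-ρ)β is the quadratic term.

If 9(1-ρ) ≤ 1, overlaps decide. Split the mean of the maximum among the maximisers into masses m_i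
with sum S. By Cauchy-Schwarz, S² ≤ ∫ W · Σ m_i m_j ∫ k_i k_j / W. The double sum is symmetric, so
it can only grow when weighted by exp(ρ(Λ_i - Λ_j)), because 2 ≤ e^t + e^{-t}. These weights
exchange Λ_i for Λ_j, and Hölder's inequality then separates exp(ζ(θ_j) - Λ_j) from a supremum of
increments from θ_j (`sum_mass_le`, `ExpField.lintegral_weighted_le_one`). Chaining prices that
supremum by the distance from θ_j (`chain_bound`), while the pair integral decays with the distance
like the intersection of two unit balls. The ninth power of that intersection pays for the price
(`pow_nine_le_exp_class`).

If 9(1-ρ) ≥ 1, a Sobolev-type estimate suffices. Integration along rays bounds the value at θ_i by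
averages over B_i of exponentials of the field and of its gradient (`eexp_mul_volume_le`). Replaced
by integrals against W, these no longer depend on i, and Hölder's inequality with Tonelli's theorem
finishes. All gradient directions are reached through a 1/4-net of the unit ball.

Finally ζ is made jointly measurable off a null set, and finite maxima are extended to Θ through a
countable dense subset of the graph of the nonrandom part. -/

open scoped ENNReal NNReal

noncomputable section

namespace MinContrast

/-! ### Covering numbers and entropy of the Euclidean unit ball -/

section


variable {p : ℕ}

/-- Nearest-point projection onto the unit ball does not increase distances to its points. -/
theorem exists_norm_le_one_dist_le (c : Param p) :
    ∃ u : Param p, ‖u‖ ≤ 1 ∧ ∀ x : Param p, ‖x‖ ≤ 1 → dist x u ≤ dist x c := by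
  by_cases hc : ‖c‖ ≤ 1
  · exact ⟨c, hc, fun x _ => le_rfl⟩
  push Not at hc
  have hn : 0 < ‖c‖ := by linarith
  refine ⟨‖c‖⁻¹ • c, ?_, fun x hx => ?_⟩
  · rw [norm_smul, norm_inv, norm_norm, inv_mul_cancel₀ hn.ne']
  · rw [dist_eq_norm, dist_eq_norm]
    refine le_of_sq_le_sq ?_ (norm_nonneg _) 
    rw [norm_sub_sq_real, norm_sub_sq_real, norm_smul, norm_inv, norm_norm,
      inv_mul_cancel₀ hn.ne', inner_smul_right]
    have h1 : inner ℝ x c ≤ ‖c‖ := (real_inner_le_norm x c).trans (by nlinarith)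
    have h2 : inner ℝ x c * (1 - ‖c‖⁻¹) ≤ ‖c‖ * (1 - ‖c‖⁻¹) :=
      mul_le_mul_of_nonneg_right h1 (by simpa using inv_le_one_of_one_le₀ hc.le)
    have h3 : ‖c‖ * (1 - ‖c‖⁻¹) = ‖c‖ - 1 := by field_simp
    nlinarith [sq_nonneg (‖c‖ - 1)]

/-- Volume packing: the balls of radius r/2 about the points are disjoint and lie in the ball of
radius 1 + r/2. -/
theorem card_le_of_isSeparated_unitBall {r : ℝ≥0} (hr : 0 < r) (s : Finset (Param p))
    (hs : ∀ c ∈ s, ‖c‖ ≤ 1) (h : ∀ c ∈ s, ∀ d ∈ s, c ≠ d → r ≤ dist c d) :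
    (s.card : ℝ) ≤ (1 + 2 / r) ^ p := by
  set δ : ℝ := r / 2 with hδ
  have hδ0 : 0 < δ := by positivity
  have D : Set.Pairwise (s : Set (Param p)) (Function.onFun Disjoint fun c => Metric.ball c δ) := by
    rintro c hc d hd hcd
    apply Metric.ball_disjoint_ball
    have := h c hc d hd hcd
    rw [hδ]; linarith
  have A_subset : (⋃ c ∈ s, Metric.ball (c : Param p) δ) ⊆ Metric.ball 0 (1 + δ) := by
    refine Set.iUnion₂_subset fun x hx => Metric.ball_subset_ball' ?_
    rw [dist_zero_right]; linarith [hs x hx]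
  have I : (s.card : ℝ≥0∞) * ENNReal.ofReal (δ ^ p) * volume (Metric.ball (0 : Param p) 1) ≤
      ENNReal.ofReal ((1 + δ) ^ p) * volume (Metric.ball (0 : Param p) 1) := by
    have := measure_mono (μ := volume) A_subset
    rw [measure_biUnion_finset D fun c _ => Metric.isOpen_ball.measurableSet] at this
    simp only [Measure.addHaar_ball_of_pos _ _ hδ0, Finset.sum_const, nsmul_eq_mul,
      Measure.addHaar_ball_of_pos _ (0 : Param p) (show 0 < 1 + δ by positivity),
      finrank_euclideanSpace_fin] at this
    rwa [mul_assoc]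
  have J := (ENNReal.mul_le_mul_iff_left (Metric.measure_ball_pos volume (0 : Param p) zero_lt_one).ne'
    measure_ball_lt_top.ne).1 I
  have K := ENNReal.toReal_le_of_le_ofReal (by positivity) J
  rw [ENNReal.toReal_mul, ENNReal.toReal_ofReal (by positivity), ENNReal.toReal_natCast] at K
  have : (1 + 2 / (r : ℝ)) = (1 + δ) / δ := by
    rw [hδ]; field_simp; ring
  rw [this, div_pow, le_div_iff₀ (by positivity)]
  exact K

theorem externalCoveringNumber_unitBall_le {r : ℝ≥0} (hr : 0 < r) :
    Metric.externalCoveringNumber r (Metric.closedBall (0 : Param p) 1) ≤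
      (⌊(1 + 2 / (r : ℝ)) ^ p⌋₊ : ℕ∞) := by
  refine (Metric.externalCoveringNumber_le_coveringNumber _ _).trans
    ((Metric.coveringNumber_le_packingNumber _ _).trans ?_)
  refine iSup₂_le fun C hC => iSup_le fun hsep => ?_
  by_contra hlt
  push Not at hlt
  have h1 : ((⌊(1 + 2 / (r : ℝ)) ^ p⌋₊ + 1 : ℕ) : ℕ∞) ≤ C.encard := by
    push_cast; exact Order.add_one_le_of_lt hlt
  obtain ⟨t, htC, ht⟩ := Set.exists_subset_encard_eq h1
  have hfin : t.Finite := Set.finite_of_encard_eq_coe ht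
  have hcard : hfin.toFinset.card = ⌊(1 + 2 / (r : ℝ)) ^ p⌋₊ + 1 := by
    rw [hfin.encard_eq_coe_toFinset_card] at ht; exact_mod_cast ht
  have := card_le_of_isSeparated_unitBall hr hfin.toFinset
    (fun c hc => by simpa using hC (htC (by simpa using hc)))
    (fun c hc d hd hcd => by
      have h2 := hsep (htC (by simpa using hc)) (htC (by simpa using hd)) hcd
      replace h2 : (r : ℝ≥0∞) < edist c d := h2
      rw [edist_nndist] at h2
      have h3 : r < nndist c d := by exact_mod_cast h2
      rw [← coe_nndist]; exact_mod_cast h3.le)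
  rw [hcard] at this
  have h4 := Nat.lt_floor_add_one ((1 + 2 / (r : ℝ)) ^ p)
  push_cast at this
  linarith

/-- The packing bound makes the covering number finite, so the truncation `toNat` loses nothing. -/
theorem externalCoveringNumber_unitBall_eq {r : ℝ≥0} (hr : 0 < r) :
    Metric.externalCoveringNumber r (Metric.closedBall (0 : Param p) 1) =
      (unitBallCovering p r : ℕ∞) := by
  rw [unitBallCovering, ENat.natCast_toNat]
  exact ((externalCoveringNumber_unitBall_le hr).trans_lt (ENat.natCast_lt_top _)).ne

theorem unitBallCovering_le {r : ℝ≥0} (hr : 0 < r) :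
    (unitBallCovering p r : ℝ) ≤ (1 + 2 / r) ^ p := by
  have h := externalCoveringNumber_unitBall_le (p := p) hr
  rw [externalCoveringNumber_unitBall_eq hr] at h
  have h' : unitBallCovering p r ≤ ⌊(1 + 2 / (r : ℝ)) ^ p⌋₊ := by exact_mod_cast h
  exact (Nat.cast_le.2 h').trans (Nat.floor_le (by positivity))

/-- A finite net of the unit ball of minimal cardinality with points in the unit ball. -/
theorem exists_net {r : ℝ≥0} (hr : 0 < r) : ∃ T : Finset (Param p),
    T.card ≤ unitBallCovering p r ∧ (∀ y ∈ T, ‖y‖ ≤ 1) ∧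
      ∀ x : Param p, ‖x‖ ≤ 1 → ∃ y ∈ T, ‖x - y‖ ≤ r := by
  classical
  have hne : Nonempty {C : Set (Param p) // Metric.IsCover r (Metric.closedBall 0 1) C} :=
    ⟨⟨_, Metric.IsCover.rfl⟩⟩
  obtain ⟨⟨C, hC⟩, hC'⟩ := ENat.exists_eq_iInf
    (fun C : {C : Set (Param p) // Metric.IsCover r (Metric.closedBall 0 1) C} => C.1.encard)
  have hcard : C.encard = (unitBallCovering p r : ℕ∞) := by
    rw [← externalCoveringNumber_unitBall_eq hr, Metric.externalCoveringNumber, iInf_subtype']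
    exact hC'
  have hfin : C.Finite := Set.finite_of_encard_eq_coe hcard
  choose f hf1 hf2 using exists_norm_le_one_dist_le (p := p)
  refine ⟨hfin.toFinset.image f, ?_, ?_, fun x hx => ?_⟩
  · refine Finset.card_image_le.trans (le_of_eq ?_)
    rw [hfin.encard_eq_coe_toFinset_card] at hcard; exact_mod_cast hcard
  · intro y hy
    obtain ⟨c, -, rfl⟩ := Finset.mem_image.1 hy
    exact hf1 c
  · obtain ⟨c, hc, hxc⟩ := hC (show x ∈ Metric.closedBall 0 1 by simpa using hx)
    refine ⟨f c, Finset.mem_image_of_mem _ (by simpa using hc), ?_⟩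
    rw [← dist_eq_norm]
    refine (hf2 c x hx).trans ?_
    have : edist x c ≤ r := hxc
    rw [edist_nndist] at this
    rw [← coe_nndist]; exact_mod_cast this

theorem unitBallCovering_le_card {r : ℝ≥0} (hr : 0 < r) (T : Finset (Param p))
    (hT : ∀ x : Param p, ‖x‖ ≤ 1 → ∃ y ∈ T, ‖x - y‖ ≤ r) : unitBallCovering p r ≤ T.card := by
  have : Metric.IsCover r (Metric.closedBall (0 : Param p) 1) (T : Set (Param p)) := by
    intro x hx
    obtain ⟨y, hy, hxy⟩ := hT x (by simpa using hx)
    refine ⟨y, hy, ?_⟩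
    change edist x y ≤ r
    rw [edist_nndist]
    rw [← dist_eq_norm, ← coe_nndist] at hxy
    exact_mod_cast hxy
  have h := this.externalCoveringNumber_le_encard
  rw [externalCoveringNumber_unitBall_eq hr, Set.encard_coe_eq_coe_finsetCard] at h
  exact_mod_cast h

/-- Comparison of volumes: N balls of radius r cover at most N rᵖ times the volume of the unit ball.
-/
theorem one_le_unitBallCovering_mul_pow {r : ℝ≥0} (hr : 0 < r) :
    1 ≤ (unitBallCovering p r : ℝ) * (r : ℝ) ^ p := by
  obtain ⟨T, hT, -, hcov⟩ := exists_net (p := p) hr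
  have hsub : Metric.closedBall (0 : Param p) 1 ⊆ ⋃ y ∈ T, Metric.closedBall y r := by
    intro x hx
    obtain ⟨y, hy, hxy⟩ := hcov x (by simpa using hx)
    exact Set.mem_iUnion₂.2 ⟨y, hy, by rwa [Metric.mem_closedBall, dist_eq_norm]⟩
  have h := (measure_mono (μ := volume) hsub).trans (measure_biUnion_finset_le _ _)
  rw [Finset.sum_congr rfl fun y _ => Measure.addHaar_closedBall' volume y r.coe_nonneg,
    Finset.sum_const, nsmul_eq_mul, finrank_euclideanSpace_fin, ← mul_assoc] at h
  nth_rewrite 1 [← one_mul (volume (Metric.closedBall (0 : Param p) 1))] at h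
  have J := (ENNReal.mul_le_mul_iff_left
    (Metric.measure_closedBall_pos volume (0 : Param p) zero_lt_one).ne'
    measure_closedBall_lt_top.ne).1 h
  have K := ENNReal.toReal_mono (by finiteness) J
  rw [ENNReal.toReal_mul, ENNReal.toReal_ofReal (by positivity), ENNReal.toReal_natCast,
    ENNReal.toReal_one] at K
  exact K.trans (by gcongr)

/-- `log N(2^{-k})`. -/
def logCov (p k : ℕ) : ℝ := Real.log (unitBallCovering p ((2 : ℝ≥0)⁻¹ ^ k))

theorem two_inv_pow_pos (k : ℕ) : (0 : ℝ≥0) < (2 : ℝ≥0)⁻¹ ^ k := by positivity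

theorem unitBallCovering_pos {r : ℝ≥0} (hr : 0 < r) : 0 < unitBallCovering p r := by
  have := one_le_unitBallCovering_mul_pow (p := p) hr
  by_contra h
  have h0 : unitBallCovering p r = 0 := by omega
  rw [h0] at this; norm_num at this

theorem exp_logCov (k : ℕ) : Real.exp (logCov p k) = unitBallCovering p ((2 : ℝ≥0)⁻¹ ^ k) :=
  Real.exp_log (by exact_mod_cast unitBallCovering_pos (two_inv_pow_pos k))

theorem le_logCov (k : ℕ) : k * p * Real.log 2 ≤ logCov p k := by
  have h := one_le_unitBallCovering_mul_pow (p := p) (two_inv_pow_pos k)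
  have hN : (0 : ℝ) < unitBallCovering p ((2 : ℝ≥0)⁻¹ ^ k) := by
    exact_mod_cast unitBallCovering_pos (two_inv_pow_pos k)
  have h2 := Real.log_nonneg h
  rw [Real.log_mul hN.ne' (by positivity)] at h2
  push_cast at h2
  rw [Real.log_pow, Real.log_pow, Real.log_inv] at h2
  rw [logCov]; linarith

theorem logCov_le (k : ℕ) : logCov p k ≤ p * Real.log (1 + 2 ^ (k + 1)) := by
  have h := unitBallCovering_le (p := p) (two_inv_pow_pos k)
  have hN : (0 : ℝ) < unitBallCovering p ((2 : ℝ≥0)⁻¹ ^ k) := by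
    exact_mod_cast unitBallCovering_pos (two_inv_pow_pos k)
  have h2 := Real.log_le_log hN h
  rw [Real.log_pow] at h2
  refine h2.trans (le_of_eq ?_)
  push_cast
  rw [inv_pow, div_inv_eq_mul, pow_succ, mul_comm (2 : ℝ)]

theorem logCov_le' (k : ℕ) : logCov p k ≤ p * ((k + 1) * Real.log 2 + (2 : ℝ)⁻¹ ^ (k + 1)) := by
  refine (logCov_le k).trans (mul_le_mul_of_nonneg_left ?_ p.cast_nonneg)
  have : (1 + 2 ^ (k + 1) : ℝ) = 2 ^ (k + 1) * (1 + (2 : ℝ)⁻¹ ^ (k + 1)) := by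
    rw [mul_add, ← mul_pow]; norm_num; ring
  rw [this, Real.log_mul (by positivity) (by positivity), Real.log_pow]
  have := Real.log_le_sub_one_of_pos (show (0 : ℝ) < 1 + (2 : ℝ)⁻¹ ^ (k + 1) by positivity)
  push_cast; linarith

theorem logCov_nonneg (k : ℕ) : 0 ≤ logCov p k :=
  Real.log_natCast_nonneg _

/-- Submultiplicativity: placing a half-scaled copy of a 1/2-net at each of its own points gives a
1/4-net. -/
theorem logCov_two_le : logCov p 2 ≤ 2 * logCov p 1 := by
  classical
  obtain ⟨T, hT, hT1, hcov⟩ := exists_net (p := p) (two_inv_pow_pos 1)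
  have h : unitBallCovering p ((2 : ℝ≥0)⁻¹ ^ 2) ≤
      ((T ×ˢ T).image fun q => q.1 + (2 : ℝ)⁻¹ • q.2).card := by
    refine unitBallCovering_le_card (two_inv_pow_pos 2) _ fun x hx => ?_
    obtain ⟨y, hy, hxy⟩ := hcov x hx
    have hxy' : ‖x - y‖ ≤ 2⁻¹ := by simpa using hxy
    obtain ⟨z, hz, hz'⟩ := hcov ((2 : ℝ) • (x - y)) (by
      rw [norm_smul]; norm_num; linarith)
    have hz2 : ‖(2 : ℝ) • (x - y) - z‖ ≤ 2⁻¹ := by simpa using hz'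
    refine ⟨y + (2 : ℝ)⁻¹ • z, Finset.mem_image.2 ⟨(y, z), by simp [hy, hz], rfl⟩, ?_⟩
    have : x - (y + (2 : ℝ)⁻¹ • z) = (2 : ℝ)⁻¹ • ((2 : ℝ) • (x - y) - z) := by
      module
    rw [this, norm_smul]; push_cast; norm_num at hz2 ⊢; linarith
  have h2 : unitBallCovering p ((2 : ℝ≥0)⁻¹ ^ 2) ≤ unitBallCovering p ((2 : ℝ≥0)⁻¹ ^ 1) ^ 2 := by
    refine h.trans (Finset.card_image_le.trans ?_)
    rw [Finset.card_product, sq]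
    exact Nat.mul_le_mul hT hT
  have h3 := Real.log_le_log (by exact_mod_cast unitBallCovering_pos (two_inv_pow_pos 2))
    (show (unitBallCovering p ((2 : ℝ≥0)⁻¹ ^ 2) : ℝ) ≤ (unitBallCovering p ((2 : ℝ≥0)⁻¹ ^ 1) : ℝ) ^ 2
      by exact_mod_cast h2)
  rw [Real.log_pow] at h3
  exact_mod_cast h3

/-- Explicit bound for the tail of the entropy series after the index `j`, per dimension. -/
def entropyTail (j : ℕ) : ℝ := (j + 3) * (2 : ℝ)⁻¹ ^ j * Real.log 2 + (4 : ℝ)⁻¹ ^ j / 6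

theorem entropyTail_nonneg (j : ℕ) : 0 ≤ entropyTail j := by
  have := Real.log_nonneg one_le_two
  unfold entropyTail; positivity

/-- The recursion is exact: `entropyTail j` is the sum over k > j of 2⁻ᵏ((k+1) log 2 + 2⁻ᵏ⁻¹), since
Σ_{k>j} (k+1)2⁻ᵏ = (j+3)2⁻ʲ. -/
theorem entropyTail_succ (j : ℕ) : entropyTail j =
    (2 : ℝ)⁻¹ ^ (j + 1) * ((j + 2) * Real.log 2 + (2 : ℝ)⁻¹ ^ (j + 2)) + entropyTail (j + 1) := by
  have : (4 : ℝ)⁻¹ ^ j = (2 : ℝ)⁻¹ ^ j * (2 : ℝ)⁻¹ ^ j := by rw [← mul_pow]; norm_num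
  have h' : (4 : ℝ)⁻¹ ^ (j + 1) = (2 : ℝ)⁻¹ ^ j * (2 : ℝ)⁻¹ ^ j / 4 := by
    rw [pow_succ, this]; norm_num; ring
  simp only [entropyTail, this, h', pow_succ]
  push_cast
  ring

theorem sum_logCov_le_entropyTail (j K : ℕ) :
    ∑ k ∈ Finset.range K, (2 : ℝ)⁻¹ ^ (j + k + 1) * logCov p (j + k + 1) ≤ p * entropyTail j := by
  suffices h : ∑ k ∈ Finset.range K, (2 : ℝ)⁻¹ ^ (j + k + 1) * logCov p (j + k + 1) ≤
      p * (entropyTail j - entropyTail (j + K)) by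
    refine h.trans (mul_le_mul_of_nonneg_left ?_ p.cast_nonneg)
    linarith [entropyTail_nonneg (j + K)]
  induction K with
  | zero => simp
  | succ K ih =>
    rw [Finset.sum_range_succ]
    have h1 := logCov_le' (p := p) (j + K + 1)
    have h2 := entropyTail_succ (j + K)
    have h3 := mul_le_mul_of_nonneg_left h1 (show (0 : ℝ) ≤ (2 : ℝ)⁻¹ ^ (j + K + 1) by positivity)
    rw [← add_assoc]
    push_cast at h2 h3 ⊢
    rw [show (j + K + 1 + 1 : ℝ) = j + K + 2 by ring] at h3
    have h4 : (p : ℝ) * (entropyTail j - entropyTail (j + K + 1)) =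
      p * (entropyTail j - entropyTail (j + K)) + (2 : ℝ)⁻¹ ^ (j + K + 1) *
        (p * ((j + K + 2) * Real.log 2 + (2 : ℝ)⁻¹ ^ (j + K + 2))) := by rw [h2]; ring
    rw [h4]
    exact add_le_add ih h3

theorem summable_entropy : Summable fun k : ℕ => (2 : ℝ)⁻¹ ^ (k + 1) * logCov p (k + 1) := by
  refine summable_of_sum_range_le (c := p * entropyTail 0)
    (fun k => mul_nonneg (by positivity) (logCov_nonneg _)) fun K => ?_
  have := sum_logCov_le_entropyTail (p := p) 0 K
  simpa using this

theorem sum_logCov_le_unitBallEntropy (K : ℕ) :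
    ∑ k ∈ Finset.range K, (2 : ℝ)⁻¹ ^ (k + 1) * logCov p (k + 1) ≤ unitBallEntropy p :=
  summable_entropy.sum_le_tsum _ fun k _ => mul_nonneg (by positivity) (logCov_nonneg _)

/-- The tail is bounded below by the volume bound k p log 2 of `le_logCov`, and Σ_{k>m} k 2⁻ᵏ =
(m+2)2⁻ᵐ. -/
theorem unitBallEntropy_ge (m : ℕ) :
    ∑ k ∈ Finset.range m, (2 : ℝ)⁻¹ ^ (k + 1) * logCov p (k + 1) +
      p * Real.log 2 * ((m + 2) * (2 : ℝ)⁻¹ ^ m) ≤ unitBallEntropy p := by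
  have key : ∀ K : ℕ, ∑ k ∈ Finset.range m, (2 : ℝ)⁻¹ ^ (k + 1) * logCov p (k + 1) +
      p * Real.log 2 * ((m + 2) * (2 : ℝ)⁻¹ ^ m - (((m + K : ℕ) : ℝ) + 2) * (2 : ℝ)⁻¹ ^ (m + K)) ≤
      ∑ k ∈ Finset.range (m + K), (2 : ℝ)⁻¹ ^ (k + 1) * logCov p (k + 1) := by
    intro K
    induction K with
    | zero => simp
    | succ K ih =>
      rw [← add_assoc, Finset.sum_range_succ]
      have h1 := mul_le_mul_of_nonneg_left (le_logCov (p := p) (m + K + 1))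
        (show (0 : ℝ) ≤ (2 : ℝ)⁻¹ ^ (m + K + 1) by positivity)
      push_cast at h1 ih ⊢
      refine le_trans (le_of_eq ?_) (add_le_add ih h1)
      rw [pow_succ]; ring
  have hlim : Filter.Tendsto (fun K : ℕ => ∑ k ∈ Finset.range m, (2 : ℝ)⁻¹ ^ (k + 1) * logCov p (k + 1) +
      p * Real.log 2 * ((m + 2) * (2 : ℝ)⁻¹ ^ m - (((m + K : ℕ) : ℝ) + 2) * (2 : ℝ)⁻¹ ^ (m + K)))
      Filter.atTop (nhds (∑ k ∈ Finset.range m, (2 : ℝ)⁻¹ ^ (k + 1) * logCov p (k + 1) +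
      p * Real.log 2 * ((m + 2) * (2 : ℝ)⁻¹ ^ m - 0))) := by
    refine Filter.Tendsto.const_add _ (Filter.Tendsto.const_mul _ (Filter.Tendsto.const_sub _ ?_))
    have h0 : Filter.Tendsto (fun n : ℕ => ((n : ℝ) + 2) * (2 : ℝ)⁻¹ ^ n) Filter.atTop (nhds 0) := by
      have h1 := tendsto_self_mul_const_pow_of_lt_one (r := (2 : ℝ)⁻¹) (by norm_num) (by norm_num)
      have h2 := (tendsto_pow_atTop_nhds_zero_of_lt_one (r := (2 : ℝ)⁻¹) (by norm_num)
        (by norm_num)).const_mul 2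
      have := h1.add h2
      simp only [mul_zero, add_zero] at this
      refine this.congr fun n => by ring
    have h3 : Filter.Tendsto (fun K : ℕ => m + K) Filter.atTop Filter.atTop :=
      Filter.tendsto_atTop_mono (fun K => Nat.le_add_left K m) Filter.tendsto_id
    exact h0.comp h3
  have := le_of_tendsto hlim (Filter.Eventually.of_forall fun K =>
    (key K).trans (sum_logCov_le_unitBallEntropy _))
  simpa using this

end

/-! ### Hölder weights and chaining -/

section


variable {p : ℕ} {Ω : Type*} [MeasurableSpace Ω]

/-- The real exponential with values in `ℝ≥0∞`. -/
def eexp (x : ℝ) : ℝ≥0∞ := ENNReal.ofReal (Real.exp x)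

theorem eexp_zero : eexp 0 = 1 := by simp [eexp]

theorem eexp_add (x y : ℝ) : eexp (x + y) = eexp x * eexp y := by
  rw [eexp, Real.exp_add, ENNReal.ofReal_mul (Real.exp_pos x).le]; rfl

theorem eexp_ne_zero (x : ℝ) : eexp x ≠ 0 := by simp [eexp, Real.exp_pos]

theorem eexp_ne_top (x : ℝ) : eexp x ≠ ⊤ := ENNReal.ofReal_ne_top

theorem eexp_rpow (x t : ℝ) : eexp x ^ t = eexp (t * x) := by
  rw [eexp, ENNReal.ofReal_rpow_of_pos (Real.exp_pos x), ← Real.exp_mul, mul_comm]; rfl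

theorem eexp_le_eexp {x y : ℝ} : eexp x ≤ eexp y ↔ x ≤ y := by
  rw [eexp, eexp, ENNReal.ofReal_le_ofReal_iff (Real.exp_pos y).le, Real.exp_le_exp]

theorem eexp_neg_mul_self (x : ℝ) : eexp (-x) * eexp x = 1 := by
  rw [← eexp_add, neg_add_cancel, eexp_zero]

theorem log_eexp (x : ℝ) : ENNReal.log (eexp x) = (x : EReal) := by
  rw [eexp, ENNReal.log_ofReal_of_pos (Real.exp_pos x), Real.log_exp]

theorem measurable_eexp : Measurable eexp :=
  (Real.measurable_exp).ennreal_ofReal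

theorem eexp_toReal (x : ℝ) : (eexp x).toReal = Real.exp x :=
  ENNReal.toReal_ofReal (Real.exp_pos x).le

theorem natCast_le_eexp {n : ℕ} {x : ℝ} (h : (n : ℝ) ≤ Real.exp x) : (n : ℝ≥0∞) ≤ eexp x := by
  rw [eexp, ← ENNReal.ofReal_natCast]; exact ENNReal.ofReal_le_ofReal h

theorem aemeasurable_finsetSup {ι : Type*} {P : Measure Ω} (T : Finset ι) {g : ι → Ω → ℝ≥0∞}
    (hg : ∀ a ∈ T, AEMeasurable (g a) P) : AEMeasurable (fun ω => T.sup fun a => g a ω) P := by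
  classical
  induction T using Finset.induction_on with
  | empty => simp
  | insert a T ha ih =>
    simp only [Finset.sup_insert]
    exact (hg a (Finset.mem_insert_self _ _)).sup
      (ih fun b hb => hg b (Finset.mem_insert_of_mem hb))

/-- `f` has `L^{1/w}`-norm at most `exp C`. -/
structure HolderBound (P : Measure Ω) (f : Ω → ℝ≥0∞) (w C : ℝ) : Prop where
  pos : 0 < w
  aemeasurable : AEMeasurable f P
  lintegral_le : ∫⁻ ω, f ω ^ (1 / w) ∂P ≤ eexp (C / w)

namespace HolderBound

variable {P : Measure Ω} {f g : Ω → ℝ≥0∞} {w w' C C' : ℝ}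

/-- Hölder's inequality: reciprocals of exponents add. This is why the reciprocal w is recorded
instead of the exponent. -/
theorem mul (hf : HolderBound P f w C) (hg : HolderBound P g w' C') :
    HolderBound P (fun ω => f ω * g ω) (w + w') (C + C') where
  pos := add_pos hf.pos hg.pos
  aemeasurable := hf.aemeasurable.mul hg.aemeasurable
  lintegral_le := by
    have h1 := hf.pos
    have h2 := hg.pos
    have h := ENNReal.lintegral_mul_norm_pow_le (hf.aemeasurable.pow_const (1 / w))
      (hg.aemeasurable.pow_const (1 / w')) (p := w / (w + w')) (q := w' / (w + w'))
      (by positivity) (by positivity) (by field_simp)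
    refine le_trans (le_of_eq (lintegral_congr fun ω => ?_)) (h.trans ((mul_le_mul'
      (ENNReal.rpow_le_rpow hf.lintegral_le (by positivity))
      (ENNReal.rpow_le_rpow hg.lintegral_le (by positivity))).trans (le_of_eq ?_)))
    · rw [← ENNReal.rpow_mul, ← ENNReal.rpow_mul, ENNReal.mul_rpow_of_nonneg _ _ (by positivity)]
      congr 2 <;> field_simp
    · rw [eexp_rpow, eexp_rpow, ← eexp_add]
      congr 1; field_simp

theorem mono (hf : HolderBound P f w C) (hg : AEMeasurable g P) (h : ∀ ω, g ω ≤ f ω) :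
    HolderBound P g w C where
  pos := hf.pos
  aemeasurable := hg
  lintegral_le := (lintegral_mono fun ω => ENNReal.rpow_le_rpow (h ω)
    (by have := hf.pos; positivity)).trans hf.lintegral_le

theorem lintegral_le_of_le_one [IsProbabilityMeasure P] (hf : HolderBound P f w C) (hw : w ≤ 1) :
    ∫⁻ ω, f ω ∂P ≤ eexp C := by
  rcases hw.eq_or_lt with rfl | hw
  · simpa using hf.lintegral_le
  · have h1 : HolderBound P (fun _ => (1 : ℝ≥0∞)) (1 - w) 0 :=
      ⟨by linarith, aemeasurable_const, by simp [eexp_zero]⟩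
    simpa using (hf.mul h1).lintegral_le

/-- Union bound: a power of a maximum is at most the sum of the powers. The logarithmic cardinality
ℓ is paid only with the factor w. -/
theorem sup {ι : Type*} {T : Finset ι} {g : ι → Ω → ℝ≥0∞} {b ℓ : ℝ} (hw : 0 < w)
    (hT : (T.card : ℝ) ≤ Real.exp ℓ) (hg : ∀ a ∈ T, AEMeasurable (g a) P)
    (hb : ∀ a ∈ T, ∫⁻ ω, g a ω ^ (1 / w) ∂P ≤ eexp b) :
    HolderBound P (fun ω => T.sup fun a => g a ω) w (w * (ℓ + b)) where
  pos := hw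
  aemeasurable := aemeasurable_finsetSup T hg
  lintegral_le := by
    have hpos : 0 ≤ 1 / w := by positivity
    calc ∫⁻ ω, (T.sup fun a => g a ω) ^ (1 / w) ∂P
        ≤ ∫⁻ ω, ∑ a ∈ T, g a ω ^ (1 / w) ∂P := by
          refine lintegral_mono fun ω => ?_
          rcases T.eq_empty_or_nonempty with rfl | hne
          · simp [hw]
          · obtain ⟨a, ha, hsup⟩ := Finset.exists_mem_eq_sup T hne fun a => g a ω
            rw [hsup]
            exact Finset.single_le_sum (f := fun a => g a ω ^ (1 / w)) (fun _ _ => zero_le) ha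
      _ = ∑ a ∈ T, ∫⁻ ω, g a ω ^ (1 / w) ∂P :=
          lintegral_finsetSum' _ fun a ha => (hg a ha).pow_const _
      _ ≤ ∑ a ∈ T, eexp b := Finset.sum_le_sum hb
      _ ≤ eexp (w * (ℓ + b) / w) := by
          rw [Finset.sum_const, nsmul_eq_mul, mul_div_cancel_left₀ _ hw.ne', eexp_add]
          gcongr
          exact natCast_le_eexp hT

end HolderBound

/-- Each link of the chain has its own Hölder weight: r/2 for the first one, from 0 to the net of
level j, and r 2⁻ᵏ for the link into level k. With these weights exponent times length is at most 2,
the limit allowed by `hY`. All weights together sum to r(1/2 + 2⁻ʲ), which `hrj` keeps at most one,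
so the product is bounded in L¹. -/
theorem chain_bound {P : Measure Ω} [IsProbabilityMeasure P] {Y : Param p → Ω → ℝ} {β r η C : ℝ}
    (hYm : ∀ y, ‖y‖ ≤ 2 → Measurable (Y y)) (hβ : 0 ≤ β)
    (hY : ∀ y y', ‖y‖ ≤ 2 → ‖y'‖ ≤ 2 → ∀ t, 0 ≤ t → t * ‖y - y'‖ ≤ 2 →
      ∫⁻ ω, eexp (t * (Y y ω - Y y' ω)) ∂P ≤ eexp β)
    (hr0 : 0 < r) (hr2 : r ≤ 2) (j : ℕ) (hrj : r * (1 / 2 + (2 : ℝ)⁻¹ ^ j) ≤ 1)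
    (hC : ∀ K, r * (1 / 2 * logCov p j +
      ∑ k ∈ Finset.range K, (2 : ℝ)⁻¹ ^ (j + k + 1) * logCov p (j + k + 1)) ≤ C)
    (F : Finset (Param p)) (hF : ∀ y ∈ F, ‖y‖ ≤ r) (hη : 0 < η) :
    ∫⁻ ω, (F.sup fun y => eexp (Y y ω - Y 0 ω)) ∂P ≤ eexp (C + β + η) := by
  choose T hTc hT1 hTn using fun k : ℕ => exists_net (p := p) (two_inv_pow_pos k)
  have hTcard : ∀ k, ((T k).card : ℝ) ≤ Real.exp (logCov p k) := fun k => by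
    rw [exp_logCov]; exact_mod_cast hTc k
  choose! π hπT hπ using fun (k : ℕ) (x : Param p) (hx : ‖x‖ ≤ 1) => hTn k x hx
  have hnode : ∀ z : Param p, ‖z‖ ≤ 1 → ‖r • z‖ ≤ 2 := fun z hz => by
    rw [norm_smul, Real.norm_of_nonneg hr0.le]; nlinarith
  have hmeas : ∀ y y', ‖y‖ ≤ 2 → ‖y'‖ ≤ 2 →
      AEMeasurable (fun ω => eexp (Y y ω - Y y' ω)) P := fun y y' hy hy' =>
    (measurable_eexp.comp ((hYm y hy).sub (hYm y' hy'))).aemeasurable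
  have h02 : ‖(0 : Param p)‖ ≤ 2 := by simp
  have hchain : ∀ K : ℕ, HolderBound P
      (fun ω => (T (j + K)).sup fun z => eexp (Y (r • z) ω - Y 0 ω))
      (r * (1 / 2 + ((2 : ℝ)⁻¹ ^ j - (2 : ℝ)⁻¹ ^ (j + K))))
      (r * (1 / 2 * (logCov p j + β) + ∑ k ∈ Finset.range K,
        (2 : ℝ)⁻¹ ^ (j + k + 1) * (logCov p (j + k + 1) + β))) := by
    intro K
    induction K with
    | zero =>
      have := HolderBound.sup (P := P) (w := r * (1 / 2)) (by positivity) (hTcard j)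
        (g := fun z ω => eexp (Y (r • z) ω - Y 0 ω)) (b := β)
        (fun z hz => hmeas _ _ (hnode z (hT1 j z hz)) h02) (fun z hz => by
          simp_rw [eexp_rpow]
          refine hY _ _ (hnode z (hT1 j z hz)) h02 _ (by positivity) ?_
          rw [sub_zero, norm_smul, Real.norm_of_nonneg hr0.le]
          have := hT1 j z hz
          field_simp; linarith)
      simpa [mul_assoc] using this
    | succ K ih =>
      have hw : 0 < r * (2 : ℝ)⁻¹ ^ (j + K + 1) := by positivity
      have hlink := HolderBound.sup (P := P) hw (hTcard (j + K + 1))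
        (g := fun z ω => eexp (Y (r • z) ω - Y (r • π (j + K) z) ω)) (b := β)
        (fun z hz => hmeas _ _ (hnode z (hT1 _ z hz))
          (hnode _ (hT1 _ _ (hπT _ _ (hT1 _ z hz))))) (fun z hz => by
          simp_rw [eexp_rpow]
          refine hY _ _ (hnode z (hT1 _ z hz)) (hnode _ (hT1 _ _ (hπT _ _ (hT1 _ z hz)))) _
            (by positivity) ?_
          have h1 := hπ (j + K) z (hT1 _ z hz)
          rw [← smul_sub, norm_smul, Real.norm_of_nonneg hr0.le]
          push_cast at h1
          rw [pow_succ]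
          have h2 : (0 : ℝ) < (2 : ℝ)⁻¹ ^ (j + K) := by positivity
          rw [one_div, mul_inv, mul_inv, inv_inv]
          calc r⁻¹ * (((2 : ℝ)⁻¹ ^ (j + K))⁻¹ * 2) * (r * ‖z - π (j + K) z‖)
              = ((2 : ℝ)⁻¹ ^ (j + K))⁻¹ * 2 * ‖z - π (j + K) z‖ := by field_simp
            _ ≤ ((2 : ℝ)⁻¹ ^ (j + K))⁻¹ * 2 * (2 : ℝ)⁻¹ ^ (j + K) := by gcongr
            _ = 2 := by field_simp)
      have hmul := ih.mul hlink
      have hmono := hmul.mono (g := fun ω => (T (j + (K + 1))).sup fun z => eexp (Y (r • z) ω - Y 0 ω))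
        (aemeasurable_finsetSup _ fun z hz => hmeas _ _ (hnode z (hT1 _ z hz)) h02)
        (fun ω => Finset.sup_le fun z hz => by
          rw [show Y (r • z) ω - Y 0 ω = (Y (r • π (j + K) z) ω - Y 0 ω) +
            (Y (r • z) ω - Y (r • π (j + K) z) ω) by ring, eexp_add]
          exact mul_le_mul'
            (Finset.le_sup (f := fun z => eexp (Y (r • z) ω - Y 0 ω)) (hπT _ _ (hT1 _ z hz)))
            (Finset.le_sup (f := fun z => eexp (Y (r • z) ω - Y (r • π (j + K) z) ω)) hz))
      convert hmono using 1
      · rw [← add_assoc, pow_succ]; ring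
      · rw [Finset.sum_range_succ]; ring
  -- The last link joins `F` to the net of level j+K. Its weight r 2⁻⁽ʲ⁺ᴷ⁾ makes the union over `F`
  -- cost at most η once K is large.
  obtain ⟨K, hK⟩ : ∃ K : ℕ, (2 : ℝ)⁻¹ ^ (j + K) * (r * Real.log (max 1 F.card)) ≤ η := by
    have h1 : Filter.Tendsto (fun K : ℕ => (2 : ℝ)⁻¹ ^ (j + K) * (r * Real.log (max 1 F.card)))
        Filter.atTop (nhds (0 * (r * Real.log (max 1 F.card)))) := by
      refine Filter.Tendsto.mul_const _ ?_
      exact (tendsto_pow_atTop_nhds_zero_of_lt_one (by norm_num) (by norm_num)).comp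
        (Filter.tendsto_atTop_mono (fun K => Nat.le_add_left K j) Filter.tendsto_id)
    rw [zero_mul] at h1
    exact (h1.eventually (ge_mem_nhds hη)).exists
  have hw : 0 < r * (2 : ℝ)⁻¹ ^ (j + K) := by positivity
  have hy1 : ∀ y ∈ F, ‖r⁻¹ • y‖ ≤ 1 := fun y hy => by
    rw [norm_smul, norm_inv, Real.norm_of_nonneg hr0.le, inv_mul_le_one₀ hr0]; exact hF y hy
  have hy2 : ∀ y ∈ F, ‖y‖ ≤ 2 := fun y hy => (hF y hy).trans hr2
  have hlast := HolderBound.sup (P := P) hw (T := F) (ℓ := Real.log (max 1 F.card))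
    (by rw [Real.exp_log (by positivity)]; exact le_max_right _ _)
    (g := fun y ω => eexp (Y y ω - Y (r • π (j + K) (r⁻¹ • y)) ω)) (b := β)
    (fun y hy => hmeas _ _ (hy2 y hy) (hnode _ (hT1 _ _ (hπT _ _ (hy1 y hy)))))
    (fun y hy => by
      simp_rw [eexp_rpow]
      refine hY _ _ (hy2 y hy) (hnode _ (hT1 _ _ (hπT _ _ (hy1 y hy)))) _ (by positivity) ?_
      have h1 := hπ (j + K) _ (hy1 y hy)
      push_cast at h1
      have h3 : y - r • π (j + K) (r⁻¹ • y) = r • (r⁻¹ • y - π (j + K) (r⁻¹ • y)) := by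
        rw [smul_sub, smul_inv_smul₀ hr0.ne']
      rw [h3, norm_smul, Real.norm_of_nonneg hr0.le]
      calc 1 / (r * (2 : ℝ)⁻¹ ^ (j + K)) * (r * ‖r⁻¹ • y - π (j + K) (r⁻¹ • y)‖)
          ≤ 1 / (r * (2 : ℝ)⁻¹ ^ (j + K)) * (r * (2 : ℝ)⁻¹ ^ (j + K)) := by gcongr
        _ = 1 := by field_simp
        _ ≤ 2 := by norm_num)
  have hmul := (hchain K).mul hlast
  have hwt : r * (1 / 2 + ((2 : ℝ)⁻¹ ^ j - (2 : ℝ)⁻¹ ^ (j + K))) + r * (2 : ℝ)⁻¹ ^ (j + K) =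
      r * (1 / 2 + (2 : ℝ)⁻¹ ^ j) := by ring
  refine (lintegral_mono fun ω => ?_).trans
    ((hmul.lintegral_le_of_le_one (hwt.le.trans hrj)).trans (eexp_le_eexp.2 ?_))
  · refine Finset.sup_le fun y hy => ?_
    rw [show Y y ω - Y 0 ω = (Y (r • π (j + K) (r⁻¹ • y)) ω - Y 0 ω) +
      (Y y ω - Y (r • π (j + K) (r⁻¹ • y)) ω) by ring, eexp_add]
    exact mul_le_mul'
      (Finset.le_sup (f := fun z => eexp (Y (r • z) ω - Y 0 ω)) (hπT _ _ (hy1 y hy)))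
      (Finset.le_sup (f := fun y => eexp (Y y ω - Y (r • π (j + K) (r⁻¹ • y)) ω)) hy)
  · have hsum : ∀ K : ℕ, ∑ k ∈ Finset.range K, (2 : ℝ)⁻¹ ^ (j + k + 1) * (logCov p (j + k + 1) + β) =
        ∑ k ∈ Finset.range K, (2 : ℝ)⁻¹ ^ (j + k + 1) * logCov p (j + k + 1) +
          ((2 : ℝ)⁻¹ ^ j - (2 : ℝ)⁻¹ ^ (j + K)) * β := by
      intro K
      induction K with
      | zero => simp
      | succ K ih => rw [Finset.sum_range_succ, Finset.sum_range_succ, ih, ← add_assoc j K 1,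
          pow_succ _ (j + K)]; ring
    rw [hsum K]
    have h1 := hC K
    have h2 : r * (1 / 2 + (2 : ℝ)⁻¹ ^ j) * β ≤ β := mul_le_of_le_one_left hβ hrj
    nlinarith

end

/-! ### Inequalities along segments and fields with exponential gradient moments -/

section


variable {p : ℕ} {Ω : Type*} [MeasurableSpace Ω]

/-- Tangent line of the logarithm at K: log(tⁿG) ≤ tⁿG/K - 1 + log K, while the correction -n log t
integrates to n over [0,1]. Since K is free and the bound is linear in J, it can later be averaged
over many rays with one common K. Only an integrable upper bound on the derivative is needed. -/
theorem sub_le_of_deriv_le_log {f f' G : ℝ → ℝ} {κ K J : ℝ} (n : ℕ)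
    (hf : ∀ t ∈ Set.Icc (0 : ℝ) 1, HasDerivAt f (f' t) t) (hκ : 0 ≤ κ) (hK : 0 < K)
    (hG : ∀ t, 0 < G t) (hGm : Measurable G) (hf' : ∀ t ∈ Set.Ioo (0 : ℝ) 1, f' t ≤ κ * Real.log (G t))
    (hJ0 : 0 ≤ J)
    (hJ : ∫⁻ t in Set.Icc (0 : ℝ) 1, ENNReal.ofReal (t ^ n * G t) ≤ ENNReal.ofReal J) :
    f 1 - f 0 ≤ κ * (J / K - 1 + Real.log K + n) := by
  have hnn : ∀ᵐ t ∂volume.restrict (Set.Icc (0 : ℝ) 1), 0 ≤ t ^ n * G t := by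
    filter_upwards [ae_restrict_mem measurableSet_Icc] with t ht
    exact mul_nonneg (pow_nonneg ht.1 _) (hG t).le
  have hm : Measurable fun t => t ^ n * G t := (measurable_id.pow_const n).mul hGm
  have hint : IntegrableOn (fun t => t ^ n * G t) (Set.Icc 0 1) := by
    refine (lintegral_ofReal_ne_top_iff_integrable hm.aestronglyMeasurable hnn).1 ?_
    exact (hJ.trans_lt ENNReal.ofReal_lt_top).ne
  have hle : ∫ t in Set.Icc (0 : ℝ) 1, t ^ n * G t ≤ J := by
    rw [integral_eq_lintegral_of_nonneg_ae hnn hm.aestronglyMeasurable]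
    exact ENNReal.toReal_le_of_le_ofReal hJ0 hJ
  have hlog : IntervalIntegrable Real.log volume 0 1 := intervalIntegral.intervalIntegrable_log'
  have hlog' : IntegrableOn Real.log (Set.Icc 0 1) := by
    rwa [intervalIntegrable_iff_integrableOn_Icc_of_le zero_le_one] at hlog
  set φ : ℝ → ℝ := fun t => κ * ((t ^ n * G t) / K + (-1 + Real.log K) - n * Real.log t) with hφ
  have hφi : IntegrableOn φ (Set.Icc 0 1) :=
    (((hint.div_const K).add (integrableOn_const (by simp))).sub (hlog'.const_mul n)).const_mul κ
  have h := intervalIntegral.sub_le_integral_of_hasDeriv_right_of_le (g := f) (g' := f') (φ := φ)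
    zero_le_one (fun t ht => (hf t ht).continuousAt.continuousWithinAt)
    (fun t ht => (hf t ⟨ht.1.le, ht.2.le⟩).hasDerivWithinAt) hφi (fun t ht => by
      refine (hf' t ht).trans (mul_le_mul_of_nonneg_left ?_ hκ)
      have h0 : 0 < t ^ n * G t / K := div_pos (mul_pos (pow_pos ht.1 _) (hG t)) hK
      have h1 := Real.log_le_sub_one_of_pos h0
      rw [Real.log_div (mul_pos (pow_pos ht.1 _) (hG t)).ne' hK.ne',
        Real.log_mul (pow_pos ht.1 _).ne' (hG t).ne', Real.log_pow] at h1
      linarith)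
  refine h.trans ?_
  have hint' : IntervalIntegrable (fun t => t ^ n * G t) volume 0 1 := by
    rwa [intervalIntegrable_iff_integrableOn_Icc_of_le zero_le_one]
  rw [hφ, intervalIntegral.integral_const_mul]
  refine mul_le_mul_of_nonneg_left ?_ hκ
  rw [intervalIntegral.integral_sub ((hint'.div_const K).add (by simp)) (hlog.const_mul _),
    intervalIntegral.integral_add (hint'.div_const K) (by simp),
    intervalIntegral.integral_div, intervalIntegral.integral_const_mul, integral_log]
  have h2 : ∫ t in (0 : ℝ)..1, t ^ n * G t ≤ J := by
    rw [intervalIntegral.integral_of_le zero_le_one, ← integral_Icc_eq_integral_Ioc]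
    exact hle
  have h3 := div_le_div_of_nonneg_right h2 hK.le
  simp only [intervalIntegral.integral_const, smul_eq_mul, Real.log_one]
  linarith

/-- Jensen's inequality without integrability of f': the previous bound with n = 0 and K = J equal
to the integral of exp f'. -/
theorem eexp_sub_le_lintegral {f f' : ℝ → ℝ} (hf : ∀ t ∈ Set.Icc (0 : ℝ) 1, HasDerivAt f (f' t) t)
    (hm : Measurable f') : eexp (f 1 - f 0) ≤ ∫⁻ t in Set.Icc (0 : ℝ) 1, eexp (f' t) := by
  set I := ∫⁻ t in Set.Icc (0 : ℝ) 1, eexp (f' t) with hI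
  rcases eq_or_ne I ⊤ with h | h
  · rw [h]; exact le_top
  have hpos : 0 < I.toReal := by
    refine ENNReal.toReal_pos ?_ h
    rw [hI, Ne, lintegral_eq_zero_iff (show Measurable fun t => eexp (f' t) from measurable_eexp.comp hm)]
    intro h0
    have : ∀ᵐ t ∂volume.restrict (Set.Icc (0 : ℝ) 1), False := by
      filter_upwards [h0] with t ht using eexp_ne_zero _ ht
    rw [ae_iff] at this
    simp at this
  have := sub_le_of_deriv_le_log (f := f) (f' := f') (G := fun t => Real.exp (f' t)) (κ := 1)
    (K := I.toReal) (J := I.toReal) 0 hf zero_le_one hpos (fun t => Real.exp_pos _)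
    (Real.measurable_exp.comp hm) (fun t _ => by simp) hpos.le
    (by rw [ENNReal.ofReal_toReal h]; simp [hI, eexp])
  rw [div_self hpos.ne'] at this
  norm_num at this
  calc eexp (f 1 - f 0) ≤ eexp (Real.log I.toReal) := eexp_le_eexp.2 (by linarith)
    _ = I := by rw [eexp, Real.exp_log hpos, ENNReal.ofReal_toReal h]

/-- A jointly measurable, everywhere differentiable field `ζ` on a convex open set `Θ`, whose
gradient has bounded exponential moments with respect to a local metric `v ↦ ‖A θ v‖`, the metric
being equivalent up to the factor `σ` over the ellipsoids of radius `ε`. -/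
structure ExpField (P : Measure Ω) (Θ : Set (Param p)) (A : Param p → Param p ≃L[ℝ] Param p)
    (ζ : Param p → Ω → ℝ) (lam ε σ β : ℝ) : Prop where
  convex : Convex ℝ Θ
  isOpen : IsOpen Θ
  measurable : Measurable fun q : Param p × Ω => ζ q.1 q.2
  diff : ∀ ω, ∀ θ ∈ Θ, DifferentiableAt ℝ (fun z => ζ z ω) θ
  moment : ∀ θ ∈ Θ, ∀ v, ‖A θ v‖ ≤ 2 * lam →
    ∫⁻ ω, eexp (fderiv ℝ (fun z => ζ z ω) θ v) ∂P ≤ eexp β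
  mem : ∀ θ ∈ Θ, ∀ x, ‖A θ (x - θ)‖ ≤ ε → x ∈ Θ
  comparable : ∀ θ ∈ Θ, ∀ x y, ‖A θ (x - θ)‖ ≤ ε → ‖A θ (y - θ)‖ ≤ ε → ∀ v, ‖A x v‖ ≤ σ * ‖A y v‖
  one_le : 1 ≤ σ
  eps_pos : 0 < ε
  lam_nonneg : 0 ≤ lam
  beta_nonneg : 0 ≤ β

namespace ExpField

variable {P : Measure Ω} {Θ : Set (Param p)} {A : Param p → Param p ≃L[ℝ] Param p}
    {ζ : Param p → Ω → ℝ} {lam ε σ β : ℝ}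

theorem measurable_apply (h : ExpField P Θ A ζ lam ε σ β) (z : Param p) : Measurable (ζ z) :=
  h.measurable.comp (measurable_const.prodMk measurable_id)

/-- The directional derivative is a limit of jointly measurable difference quotients of step
1/(n+1). The indicator discards the points where the limit may fail to exist. -/
theorem measurable_fderiv (h : ExpField P Θ A ζ lam ε σ β) (u : Param p) :
    Measurable fun q : Param p × Ω =>
      Θ.indicator (fun z => fderiv ℝ (fun z => ζ z q.2) z u) q.1 := by
  have hΘ : MeasurableSet ((Prod.fst : Param p × Ω → Param p) ⁻¹' Θ) :=
    measurable_fst h.isOpen.measurableSet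
  refine measurable_of_tendsto_metrizable (f := fun (n : ℕ) (q : Param p × Ω) =>
    (Prod.fst ⁻¹' Θ).indicator (fun q : Param p × Ω => ((n : ℝ) + 1) *
      (ζ (q.1 + ((n : ℝ) + 1)⁻¹ • u) q.2 - ζ q.1 q.2)) q) (fun n => ?_) ?_
  · refine Measurable.indicator ?_ hΘ
    refine measurable_const.mul (Measurable.sub ?_ h.measurable)
    exact h.measurable.comp ((measurable_fst.add_const _).prodMk measurable_snd)
  · refine tendsto_pi_nhds.2 fun q => ?_
    by_cases hq : q.1 ∈ Θ
    · rw [Set.indicator_of_mem hq]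
      have hq' : q ∈ Prod.fst ⁻¹' Θ := hq
      simp only [Set.indicator_of_mem hq']
      have hd := (h.diff q.2 q.1 hq).hasFDerivAt
      have hc : Filter.Tendsto (fun n : ℕ => ‖(n : ℝ) + 1‖) Filter.atTop Filter.atTop := by
        refine Filter.tendsto_atTop_mono (fun n => ?_) tendsto_natCast_atTop_atTop
        rw [Real.norm_of_nonneg (by positivity)]
        linarith
      simpa using hd.lim u hc
    · rw [Set.indicator_of_notMem hq]
      have hq' : q ∉ Prod.fst ⁻¹' Θ := hq
      simp only [Set.indicator_of_notMem hq']
      exact tendsto_const_nhds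

theorem measurable_fderiv_comp (h : ExpField P Θ A ζ lam ε σ β) (u v : Param p) :
    Measurable fun q : ℝ × Ω =>
      Θ.indicator (fun z => fderiv ℝ (fun z => ζ z q.2) z u) (v + q.1 • u) := by
  have : Measurable fun q : ℝ × Ω => ((v + q.1 • u, q.2) : Param p × Ω) :=
    (measurable_const.add (measurable_fst.smul_const u)).prodMk measurable_snd
  exact (h.measurable_fderiv u).comp this

theorem hasDerivAt_segment (h : ExpField P Θ A ζ lam ε σ β) {v w : Param p} (ω : Ω) {t : ℝ}
    (ht : v + t • w ∈ Θ) :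
    HasDerivAt (fun t : ℝ => ζ (v + t • w) ω) (fderiv ℝ (fun z => ζ z ω) (v + t • w) w) t := by
  have h1 := (h.diff ω _ ht).hasFDerivAt
  have h2 : HasDerivAt (fun t : ℝ => v + t • w) w t := by
    simpa using ((hasDerivAt_id t).smul_const w).const_add v
  exact h1.comp_hasDerivAt t h2

theorem segment_mem (h : ExpField P Θ A ζ lam ε σ β) {u v : Param p} (hu : u ∈ Θ) (hv : v ∈ Θ)
    {t : ℝ} (ht : t ∈ Set.Icc (0 : ℝ) 1) : v + t • (u - v) ∈ Θ :=
  h.convex.add_smul_sub_mem hv hu ht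

/-- Jensen's inequality along the segment and Tonelli's theorem reduce the increment to the gradient
moments at the points of the segment. -/
theorem lintegral_increment_le [SFinite P] (h : ExpField P Θ A ζ lam ε σ β) {u v : Param p} (hu : u ∈ Θ)
    (hv : v ∈ Θ) {t : ℝ} (ht : 0 ≤ t)
    (hseg : ∀ s ∈ Set.Icc (0 : ℝ) 1, t * ‖A (v + s • (u - v)) (u - v)‖ ≤ 2 * lam) :
    ∫⁻ ω, eexp (t * (ζ u ω - ζ v ω)) ∂P ≤ eexp β := by
  set D : ℝ × Ω → ℝ := fun q =>
      t * Θ.indicator (fun z => fderiv ℝ (fun z => ζ z q.2) z (u - v)) (v + q.1 • (u - v)) with hD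
  have hDm : Measurable D := (h.measurable_fderiv_comp (u - v) v).const_mul t
  have hpt : ∀ ω, eexp (t * (ζ u ω - ζ v ω)) ≤ ∫⁻ s in Set.Icc (0 : ℝ) 1, eexp (D (s, ω)) := by
    intro ω
    have := eexp_sub_le_lintegral (f := fun s => t * ζ (v + s • (u - v)) ω)
      (f' := fun s => D (s, ω)) (fun s hs => by
        have hm := h.segment_mem hu hv hs
        have h1 := (h.hasDerivAt_segment ω hm).const_mul t
        simpa only [hD, Set.indicator_of_mem hm] using h1)
      (hDm.comp (measurable_id.prodMk measurable_const))
    simpa [mul_sub] using this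
  refine (lintegral_mono hpt).trans ?_
  rw [lintegral_lintegral_swap (f := fun ω s => eexp (D (s, ω)))
    ((measurable_eexp.comp (hDm.comp measurable_swap)).aemeasurable)]
  calc ∫⁻ s in Set.Icc (0 : ℝ) 1, ∫⁻ ω, eexp (D (s, ω)) ∂P
      ≤ ∫⁻ s in Set.Icc (0 : ℝ) 1, eexp β := by
        refine setLIntegral_mono' measurableSet_Icc fun s hs => ?_
        have hm := h.segment_mem hu hv hs
        have h1 := h.moment _ hm (t • (u - v)) (by
          rw [map_smul, norm_smul, Real.norm_of_nonneg ht]; exact hseg s hs)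
        simpa only [hD, Set.indicator_of_mem hm, map_smul, smul_eq_mul] using h1
    _ = eexp β := by simp

end ExpField

end

/-! ### A mass bound for overlapping densities and the intersection of two unit balls -/

section


variable {p : ℕ} {Ω : Type*} [MeasurableSpace Ω]

theorem two_le_eexp_add (t : ℝ) : 2 ≤ eexp t + eexp (-t) := by
  rw [eexp, eexp, ← ENNReal.ofReal_add (Real.exp_pos _).le (Real.exp_pos _).le,
    show (2 : ℝ≥0∞) = ENNReal.ofReal 2 by simp]
  refine ENNReal.ofReal_le_ofReal ?_
  have h1 := Real.add_one_le_exp t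
  have h2 := Real.add_one_le_exp (-t)
  linarith

/-- Symmetrised weights `exp(ℓ i - ℓ j)` only increase a symmetric double sum. -/
theorem sum_sum_le_sum_sum_mul_eexp {ι : Type*} [Fintype ι] (c : ι → ι → ℝ≥0∞)
    (hc : ∀ i j, c i j = c j i) (ℓ : ι → ℝ) :
    ∑ i, ∑ j, c i j ≤ ∑ i, ∑ j, c i j * eexp (ℓ i - ℓ j) := by
  have h1 : ∑ i, ∑ j, c i j * eexp (ℓ i - ℓ j) = ∑ i, ∑ j, c i j * eexp (-(ℓ i - ℓ j)) := by
    rw [Finset.sum_comm]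
    refine Finset.sum_congr rfl fun i _ => Finset.sum_congr rfl fun j _ => ?_
    rw [hc j i, neg_sub]
  have h2 : 2 * ∑ i, ∑ j, c i j ≤ 2 * ∑ i, ∑ j, c i j * eexp (ℓ i - ℓ j) := by
    rw [two_mul (∑ i, ∑ j, c i j * eexp (ℓ i - ℓ j))]
    nth_rewrite 2 [h1]
    simp only [← Finset.sum_add_distrib, Finset.mul_sum, ← mul_add]
    refine Finset.sum_le_sum fun i _ => Finset.sum_le_sum fun j _ => ?_
    rw [mul_comm]
    gcongr
    exact two_le_eexp_add _
  exact (ENNReal.mul_le_mul_iff_right two_ne_zero ENNReal.ofNat_ne_top).1 h2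

/-- A mass bound by two applications of the Cauchy–Schwarz inequality: if the probability densities
`k i` overlap little relative to the envelope `W`, then the total mass is at most `C * ∫ W`. -/
theorem sum_mass_le {ι X : Type*} [Fintype ι] [MeasurableSpace X] {τ : Measure X}
    {k : ι → X → ℝ≥0∞} {W : X → ℝ≥0∞} {m : ι → ℝ≥0∞} {ℓ : ι → ℝ} {a : ι → ι → ℝ≥0∞} {C : ℝ≥0∞}
    (hk : ∀ i, Measurable (k i)) (hk1 : ∀ i, ∫⁻ x, k i x ∂τ = 1) (hW : Measurable W)
    (hWtop : ∀ x, W x ≠ ⊤) (hWk : ∀ i x, W x = 0 → k i x = 0) (hm : ∀ i, m i ≠ ⊤)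
    (ha : ∀ j, ∑ i, m i * a i j ≤ 1)
    (hT : ∀ i j, ∫⁻ x, k i x * k j x / W x ∂τ ≤ C * (a i j * eexp (ℓ j - ℓ i))) :
    ∑ i, m i ≤ C * ∫⁻ x, W x ∂τ := by
  set S := ∑ i, m i with hS
  set M := ∫⁻ x, W x ∂τ with hM
  have hStop : S ≠ ⊤ := by rw [hS]; exact ENNReal.sum_ne_top.2 fun i _ => hm i
  rcases eq_or_ne S 0 with h0 | h0
  · rw [h0]; exact zero_le
  set g : X → ℝ≥0∞ := fun x => ∑ i, m i * k i x with hg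
  have hgm : Measurable g := Finset.measurable_fun_sum _ fun i _ => (hk i).const_mul _
  have hgS : ∫⁻ x, g x ∂τ = S := by
    rw [hg, lintegral_finsetSum _ fun i _ => (hk i).const_mul _]
    refine Finset.sum_congr rfl fun i _ => ?_
    rw [lintegral_const_mul _ (hk i), hk1, mul_one]
  -- Cauchy-Schwarz for g = (g²/W)^{1/2} W^{1/2}; where W vanishes, so does g.
  have hcs : S ≤ (∫⁻ x, g x * g x / W x ∂τ) ^ (1 / 2 : ℝ) * M ^ (1 / 2 : ℝ) := by
    rw [← hgS]
    refine le_trans (le_of_eq (lintegral_congr fun x => ?_)) (ENNReal.lintegral_mul_norm_pow_le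
      (f := fun x => g x * g x / W x) (g := W) ((hgm.mul hgm).div hW).aemeasurable
      hW.aemeasurable (p := 1 / 2) (q := 1 / 2) (by norm_num) (by norm_num) (by norm_num))
    rcases eq_or_ne (W x) 0 with hx | hx
    · have : g x = 0 := Finset.sum_eq_zero fun i _ => by rw [hWk i x hx, mul_zero]
      simp [this, hx]
    · rw [← ENNReal.mul_rpow_of_nonneg _ _ (by norm_num), ENNReal.div_mul_cancel hx (hWtop x),
        ← sq, ← ENNReal.rpow_natCast, ← ENNReal.rpow_mul]
      norm_num
  have hsq : S * S ≤ (∫⁻ x, g x * g x / W x ∂τ) * M := by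
    have := ENNReal.rpow_le_rpow hcs (show (0 : ℝ) ≤ 2 by norm_num)
    rw [ENNReal.mul_rpow_of_nonneg _ _ (by norm_num), ← ENNReal.rpow_mul, ← ENNReal.rpow_mul] at this
    norm_num at this
    rwa [sq] at this
  have hexp : ∫⁻ x, g x * g x / W x ∂τ = ∑ i, ∑ j, m i * m j * ∫⁻ x, k i x * k j x / W x ∂τ := by
    have hpt : ∀ x, g x * g x / W x = ∑ i, ∑ j, m i * m j * (k i x * k j x / W x) := by
      intro x
      simp only [hg, div_eq_mul_inv]
      rw [Finset.sum_mul_sum, Finset.sum_mul]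
      refine Finset.sum_congr rfl fun i _ => ?_
      rw [Finset.sum_mul]
      refine Finset.sum_congr rfl fun j _ => ?_
      ring
    have hmij : ∀ i j, Measurable fun x => k i x * k j x / W x := fun i j =>
      ((hk i).mul (hk j)).div hW
    rw [lintegral_congr hpt, lintegral_finsetSum _ fun i _ =>
      Finset.measurable_fun_sum _ fun j _ => (hmij i j).const_mul _]
    refine Finset.sum_congr rfl fun i _ => ?_
    rw [lintegral_finsetSum _ fun j _ => (hmij i j).const_mul _]
    exact Finset.sum_congr rfl fun j _ => lintegral_const_mul _ (hmij i j)
  have hbound : ∫⁻ x, g x * g x / W x ∂τ ≤ C * S := by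
    rw [hexp]
    -- By symmetry the weights e^{ℓ i - ℓ j} may be inserted; they cancel the factor e^{ℓ j - ℓ i}
    -- in `hT`.
    refine (sum_sum_le_sum_sum_mul_eexp _ (fun i j => ?_) ℓ).trans ?_
    · rw [mul_comm (m i), lintegral_congr fun x => by rw [mul_comm (k i x)]]
    calc ∑ i, ∑ j, m i * m j * (∫⁻ x, k i x * k j x / W x ∂τ) * eexp (ℓ i - ℓ j)
        ≤ ∑ i, ∑ j, C * (m j * (m i * a i j)) := by
          refine Finset.sum_le_sum fun i _ => Finset.sum_le_sum fun j _ => ?_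
          calc m i * m j * (∫⁻ x, k i x * k j x / W x ∂τ) * eexp (ℓ i - ℓ j)
              ≤ m i * m j * (C * (a i j * eexp (ℓ j - ℓ i))) * eexp (ℓ i - ℓ j) := by
                gcongr; exact hT i j
            _ = C * (m j * (m i * a i j)) * (eexp (-(ℓ i - ℓ j)) * eexp (ℓ i - ℓ j)) := by
                rw [neg_sub]; ring
            _ = C * (m j * (m i * a i j)) := by rw [eexp_neg_mul_self, mul_one]
      _ = C * ∑ j, m j * ∑ i, m i * a i j := by
          rw [Finset.sum_comm]
          simp only [Finset.mul_sum]
      _ ≤ C * ∑ j, m j * 1 := by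
          gcongr with j
          exact ha j
      _ = C * S := by simp [hS]
  have hfin : S * S ≤ S * (C * M) := hsq.trans ((mul_le_mul' hbound le_rfl).trans
    (le_of_eq (by ring)))
  exact (ENNReal.mul_le_mul_iff_right h0 hStop).1 hfin

/-- The intersection of the unit ball and its translate by `y`. -/
def lens (y : Param p) : Set (Param p) := Metric.closedBall 0 1 ∩ Metric.closedBall y 1

theorem volume_lens_le (y : Param p) : volume (lens y) ≤ volume (Metric.closedBall (0 : Param p) 1) :=
  measure_mono Set.inter_subset_left

theorem volume_unitBall_ne_top : volume (Metric.closedBall (0 : Param p) 1) ≠ ⊤ :=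
  measure_closedBall_lt_top.ne

theorem volume_unitBall_ne_zero : volume (Metric.closedBall (0 : Param p) 1) ≠ 0 :=
  (Metric.measure_closedBall_pos volume _ one_pos).ne'

/-- If `k` translations by `y` leave the unit ball, then the lens misses a fraction `1 / k`. -/
theorem mul_volume_lens_le {y : Param p} {k : ℕ} (hk : 2 < k * ‖y‖) :
    k * volume (lens y) ≤ (k - 1 : ℕ) * volume (Metric.closedBall (0 : Param p) 1) := by
  classical
  set B := Metric.closedBall (0 : Param p) 1 with hB
  have hk0 : k ≠ 0 := by rintro rfl; norm_num at hk
  -- Along x, x - y, x - 2y, … the ball has been left after k steps, by `hk`. The last point before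
  -- the first exit lies in the ball but outside the lens.
  have hsub : B ⊆ ⋃ m ∈ Finset.range k, (fun x => x - (m : ℝ) • y) ⁻¹' (B \ lens y) := by
    intro x hx
    have hx1 : ‖x‖ ≤ 1 := by simpa [hB] using hx
    have hex : ∃ m : ℕ, x - (m : ℝ) • y ∉ B := ⟨k, fun h => by
      have h1 : ‖x - (k : ℝ) • y‖ ≤ 1 := by simpa [hB] using h
      have h2 : ‖(k : ℝ) • y‖ ≤ ‖x‖ + ‖x - (k : ℝ) • y‖ := by
        have := norm_sub_le x (x - (k : ℝ) • y); simpa using this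
      rw [norm_smul, Real.norm_natCast] at h2
      linarith⟩
    have hspec := Nat.find_spec hex
    have hmin := fun m => Nat.find_min hex (m := m)
    have hle : Nat.find hex ≤ k := by
      by_contra hlt
      push Not at hlt
      have h := hmin k hlt
      have h1 : ‖x - (k : ℝ) • y‖ ≤ 1 := by simpa [hB] using h
      have h2 : ‖(k : ℝ) • y‖ ≤ ‖x‖ + ‖x - (k : ℝ) • y‖ := by
        have := norm_sub_le x (x - (k : ℝ) • y); simpa using this
      rw [norm_smul, Real.norm_natCast] at h2
      linarith
    obtain ⟨n, hn⟩ : ∃ n, Nat.find hex = n + 1 := by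
      refine Nat.exists_eq_succ_of_ne_zero fun h0 => ?_
      rw [h0] at hspec
      exact hspec (by simpa using hx)
    refine Set.mem_iUnion₂.2 ⟨n, Finset.mem_range.2 (by omega), ?_, fun hl => ?_⟩
    · simpa using hmin n (by omega)
    · rw [hn] at hspec
      apply hspec
      have h3 := hl.2
      rw [Metric.mem_closedBall, dist_eq_norm] at h3
      rw [hB, mem_closedBall_zero_iff]
      have e : x - ((n + 1 : ℕ) : ℝ) • y = x - (n : ℝ) • y - y := by push_cast; module
      rwa [e]
  have hml : MeasurableSet (lens y) := Metric.isClosed_closedBall.measurableSet.inter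
    Metric.isClosed_closedBall.measurableSet
  have hvol : volume B ≤ k * (volume B - volume (lens y)) := by
    refine (measure_mono hsub).trans ((measure_biUnion_finset_le _ _).trans (le_of_eq ?_))
    have : ∀ m ∈ Finset.range k, volume ((fun x => x - (m : ℝ) • y) ⁻¹' (B \ lens y)) =
        volume B - volume (lens y) := by
      intro m _
      simp only [sub_eq_add_neg _ ((m : ℝ) • y)]
      rw [measure_preimage_add_right, measure_sdiff (show lens y ⊆ B from Set.inter_subset_left) hml.nullMeasurableSet
        ((volume_lens_le y).trans_lt measure_closedBall_lt_top).ne]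
    rw [Finset.sum_congr rfl this, Finset.sum_const, nsmul_eq_mul, Finset.card_range]
  have hBt : volume B ≠ ⊤ := volume_unitBall_ne_top
  have hlt : volume (lens y) ≠ ⊤ := ((volume_lens_le y).trans_lt measure_closedBall_lt_top).ne
  have hle : (volume (lens y)).toReal ≤ (volume B).toReal := ENNReal.toReal_mono hBt (volume_lens_le y)
  have h1 := ENNReal.toReal_mono (by finiteness) hvol
  rw [ENNReal.toReal_mul, ENNReal.toReal_sub_of_le (volume_lens_le y) hBt, ENNReal.toReal_natCast] at h1
  rw [← ENNReal.toReal_le_toReal (by finiteness) (by finiteness), ENNReal.toReal_mul,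
    ENNReal.toReal_mul, ENNReal.toReal_natCast, ENNReal.toReal_natCast,
    Nat.cast_sub (Nat.one_le_iff_ne_zero.2 hk0)]
  push_cast
  linarith

/-- By the parallelogram law the lens lies in the ball of radius √(1 - ‖y‖²/4) about y/2. -/
theorem volume_lens_le_pow {y : Param p} (hy : ‖y‖ ≤ 2) :
    volume (lens y) ≤ ENNReal.ofReal (√(1 - ‖y‖ ^ 2 / 4) ^ p) *
      volume (Metric.closedBall (0 : Param p) 1) := by
  have hnn : 0 ≤ 1 - ‖y‖ ^ 2 / 4 := by nlinarith [norm_nonneg y]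
  have hsub : lens y ⊆ Metric.closedBall ((2 : ℝ)⁻¹ • y) (√(1 - ‖y‖ ^ 2 / 4)) := by
    intro x hx
    have h1 : ‖x‖ ≤ 1 := by simpa using hx.1
    have h2 : ‖x - y‖ ≤ 1 := by simpa [dist_eq_norm] using hx.2
    rw [Metric.mem_closedBall, dist_eq_norm]
    refine Real.le_sqrt_of_sq_le ?_
    have h3 := parallelogram_law_with_norm ℝ (x - (2 : ℝ)⁻¹ • y) ((2 : ℝ)⁻¹ • y)
    have e1 : x - (2 : ℝ)⁻¹ • y + (2 : ℝ)⁻¹ • y = x := by module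
    have e2 : x - (2 : ℝ)⁻¹ • y - (2 : ℝ)⁻¹ • y = x - y := by module
    rw [e1, e2, norm_smul] at h3
    norm_num at h3
    nlinarith [norm_nonneg x, norm_nonneg (x - y)]
  refine (measure_mono hsub).trans (le_of_eq ?_)
  rw [Measure.addHaar_closedBall' _ _ (Real.sqrt_nonneg _), finrank_euclideanSpace_fin]

end

/-! ### Distance classes: price of chaining against decay of the overlap -/

section


variable {p : ℕ}

/-- The radii of the distance classes; the class `n` is chained from the level `max 1 n`. -/
def classRadius : ℕ → ℝ
  | 0 => 1 / 2
  | k + 1 => 2 / (1 + (2 : ℝ)⁻¹ ^ k)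

/-- The price of the chaining bound over a distance class. -/
def classCost (p : ℕ) : ℕ → ℝ
  | 0 => unitBallEntropy p / 2
  | 1 => unitBallEntropy p
  | 2 => 4 / 3 * unitBallEntropy p
  | n + 3 => classRadius (n + 3) *
      (p * (1 / 2 * ((n + 4) * Real.log 2 + (2 : ℝ)⁻¹ ^ (n + 4)) + entropyTail (n + 3)))

/-- The price of the union over the distance classes. -/
def classGain (p : ℕ) : ℕ → ℝ
  | 0 => unitBallEntropy p / 2
  | 1 => 9 * Real.log (4 / 3)
  | 2 => 3 * Real.log 2
  | n + 3 => (n + 3) * Real.log 2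

theorem classRadius_pos (n : ℕ) : 0 < classRadius n := by
  cases n <;> simp only [classRadius] <;> positivity

theorem classRadius_le_two (n : ℕ) : classRadius n ≤ 2 := by
  cases n with
  | zero => simp only [classRadius]; norm_num
  | succ k =>
    simp only [classRadius]
    exact div_le_self (by norm_num) (by linarith [show (0 : ℝ) < (2 : ℝ)⁻¹ ^ k by positivity])

/-- This is the weight condition of `chain_bound`. For n ≥ 1 it holds with equality, so the radius
is the largest one that can be chained from level n; the radii tend to 2. -/
theorem classRadius_mul_le (n : ℕ) : classRadius n * (1 / 2 + (2 : ℝ)⁻¹ ^ (max 1 n)) ≤ 1 := by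
  cases n with
  | zero => simp only [classRadius]; norm_num
  | succ k =>
    simp only [classRadius]
    rw [max_eq_right (Nat.le_add_left 1 k), pow_succ]
    have : (0 : ℝ) < (2 : ℝ)⁻¹ ^ k := by positivity
    rw [div_mul_eq_mul_div, div_le_one (by positivity)]
    linarith

theorem sum_logCov_one_le (K : ℕ) : 1 / 2 * logCov p 1 +
    ∑ k ∈ Finset.range K, (2 : ℝ)⁻¹ ^ (1 + k + 1) * logCov p (1 + k + 1) ≤ unitBallEntropy p := by
  refine le_trans (le_of_eq ?_) (sum_logCov_le_unitBallEntropy (K + 1))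
  rw [Finset.sum_range_succ']
  norm_num
  rw [add_comm]
  congr 1
  refine Finset.sum_congr rfl fun k _ => ?_
  rw [show k + 1 + 1 = 1 + k + 1 by ring]

/-- By `logCov_two_le`, starting the chain at level 2 costs no more than starting it at level 1. -/
theorem sum_logCov_two_le (K : ℕ) : 1 / 2 * logCov p 2 +
    ∑ k ∈ Finset.range K, (2 : ℝ)⁻¹ ^ (2 + k + 1) * logCov p (2 + k + 1) ≤ unitBallEntropy p := by
  have h1 := sum_logCov_one_le (p := p) (K + 1)
  rw [Finset.sum_range_succ'] at h1
  have h2 := logCov_two_le (p := p)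
  have h3 : ∑ k ∈ Finset.range K, (2 : ℝ)⁻¹ ^ (1 + (k + 1) + 1) * logCov p (1 + (k + 1) + 1) =
      ∑ k ∈ Finset.range K, (2 : ℝ)⁻¹ ^ (2 + k + 1) * logCov p (2 + k + 1) :=
    Finset.sum_congr rfl fun k _ => by rw [show 1 + (k + 1) + 1 = 2 + k + 1 by ring]
  rw [h3] at h1
  norm_num at h1 h2 ⊢
  linarith

theorem classCost_ge (n K : ℕ) : classRadius n * (1 / 2 * logCov p (max 1 n) +
    ∑ k ∈ Finset.range K, (2 : ℝ)⁻¹ ^ (max 1 n + k + 1) * logCov p (max 1 n + k + 1)) ≤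
      classCost p n := by
  match n with
  | 0 =>
    have := sum_logCov_one_le (p := p) K
    simp only [classRadius, classCost, max_eq_left (Nat.zero_le 1)]
    linarith
  | 1 =>
    have := sum_logCov_one_le (p := p) K
    simp only [classRadius, classCost, max_self, pow_zero]
    linarith
  | 2 =>
    have := sum_logCov_two_le (p := p) K
    simp only [classRadius, classCost, show max 1 2 = 2 from rfl, pow_one]
    norm_num at this ⊢
    linarith
  | n + 3 =>
    rw [max_eq_right (by omega : 1 ≤ n + 3)]
    simp only [classCost]
    refine mul_le_mul_of_nonneg_left ?_ (classRadius_pos _).le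
    have h1 := logCov_le' (p := p) (n + 3)
    have h2 := sum_logCov_le_entropyTail (p := p) (n + 3) K
    push_cast at h1
    rw [show (n + 3 + 1 : ℝ) = n + 4 by ring] at h1
    have h4 : (p : ℝ) * (1 / 2 * ((n + 4) * Real.log 2 + (2 : ℝ)⁻¹ ^ (n + 4)) + entropyTail (n + 3)) =
      1 / 2 * (p * ((n + 4) * Real.log 2 + (2 : ℝ)⁻¹ ^ (n + 4))) + p * entropyTail (n + 3) := by ring
    rw [h4]
    exact add_le_add (mul_le_mul_of_nonneg_left h1 (by norm_num)) h2

theorem two_mul_log_two_le_unitBallEntropy : 2 * (p * Real.log 2) ≤ unitBallEntropy p := by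
  have := unitBallEntropy_ge (p := p) 0
  norm_num at this
  linarith

theorem unitBallEntropy_le : unitBallEntropy p ≤ p * (3 * Real.log 2 + 1 / 6) := by
  refine summable_entropy.tsum_le_of_sum_range_le fun K => ?_
  have := sum_logCov_le_entropyTail (p := p) 0 K
  simpa [entropyTail] using this

theorem exp_neg_nat_mul_log_two (k : ℕ) : Real.exp (-(k * Real.log 2)) = (2 : ℝ)⁻¹ ^ k := by
  rw [Real.exp_neg, mul_comm, Real.exp_mul, Real.exp_log two_pos, Real.rpow_natCast, inv_pow]

/-- The classes 0, 1, 2 and all later ones contribute at most 1/2, 0.08, 1/8 and 1/4. The first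
bound rests on Q_p ≥ 2p log 2 with p ≥ 1. -/
theorem sum_exp_neg_classGain_le (hp : 1 ≤ p) (N : ℕ) :
    ∑ n ∈ Finset.range N, Real.exp (-classGain p n) ≤ 1 := by
  have hmono : ∑ n ∈ Finset.range N, Real.exp (-classGain p n) ≤
      ∑ n ∈ Finset.range (N + 3), Real.exp (-classGain p n) :=
    Finset.sum_le_sum_of_subset_of_nonneg (Finset.range_mono (by omega))
      fun _ _ _ => (Real.exp_pos _).le
  refine hmono.trans ?_
  rw [Finset.sum_range_succ', Finset.sum_range_succ', Finset.sum_range_succ']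
  have h0 : Real.exp (-classGain p 0) ≤ 1 / 2 := by
    have h1 := two_mul_log_two_le_unitBallEntropy (p := p)
    have hp' : (1 : ℝ) ≤ p := by exact_mod_cast hp
    have h2 := Real.log_pos one_lt_two
    have h3 := exp_neg_nat_mul_log_two 1
    calc Real.exp (-classGain p 0) ≤ Real.exp (-((1 : ℕ) * Real.log 2)) := by
          rw [Real.exp_le_exp]; simp only [classGain]; push_cast; nlinarith
      _ = 1 / 2 := by rw [h3]; norm_num
  have h1 : Real.exp (-classGain p 1) ≤ 0.08 := by
    have : Real.exp (-classGain p 1) = (3 / 4) ^ 9 := by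
      simp only [classGain]
      rw [show -(9 * Real.log (4 / 3)) = Real.log ((3 / 4) ^ 9) by
        rw [Real.log_pow, show (3 / 4 : ℝ) = (4 / 3)⁻¹ by norm_num, Real.log_inv]; push_cast; ring,
        Real.exp_log (by positivity)]
    rw [this]; norm_num
  have h2 : Real.exp (-classGain p 2) = 1 / 8 := by
    have := exp_neg_nat_mul_log_two 3
    simp only [classGain]; push_cast at this; rw [this]; norm_num
  have h3 : ∑ k ∈ Finset.range N, Real.exp (-classGain p (k + 1 + 1 + 1)) ≤ 1 / 4 := by
    have e : ∀ k, Real.exp (-classGain p (k + 1 + 1 + 1)) = (2 : ℝ)⁻¹ ^ (k + 3) := fun k => by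
      rw [← exp_neg_nat_mul_log_two]; simp only [classGain]; push_cast; rfl
    simp only [e]
    have : ∀ N : ℕ, ∑ k ∈ Finset.range N, (2 : ℝ)⁻¹ ^ (k + 3) = 1 / 4 - (2 : ℝ)⁻¹ ^ (N + 2) := by
      intro N
      induction N with
      | zero => norm_num
      | succ N ih => rw [Finset.sum_range_succ, ih]; ring
    rw [this]
    have : (0 : ℝ) < (2 : ℝ)⁻¹ ^ (N + 2) := by positivity
    linarith
  norm_num at h0 h1 h2 h3 ⊢
  linarith

theorem mul_log_two_le_mul_log {a b : ℕ} {x : ℝ} (h : (2 : ℝ) ^ a ≤ x ^ b) :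
    a * Real.log 2 ≤ b * Real.log x := by
  have := Real.log_le_log (by positivity) h
  rwa [Real.log_pow, Real.log_pow] at this

/-- The price of the class `n + 3` is paid by the small overlap of distant unit balls. -/
theorem classCost_numeric (n : ℕ) :
    classRadius (n + 3) * (1 / 2 * ((n + 4) * Real.log 2 + (2 : ℝ)⁻¹ ^ (n + 4)) + entropyTail (n + 3)) +
      n * Real.log 2 - 2 * Real.log 2 ≤ 3 * -Real.log (1 - classRadius (n + 2) ^ 2 / 4) := by
  have hl1 := Real.log_two_gt_d9
  have hl2 := Real.log_two_lt_d9
  match n with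
  | 0 =>
    -- Comparisons of integer powers, here 2⁵ ≤ (9/5)⁶, bound the logarithms below in units of log
    -- 2.
    have h := mul_log_two_le_mul_log (a := 5) (b := 6) (x := 9 / 5) (by norm_num)
    have e : 1 - classRadius (0 + 2) ^ 2 / 4 = (9 / 5 : ℝ)⁻¹ := by
      simp only [classRadius]; norm_num
    rw [e, Real.log_inv]
    simp only [classRadius, entropyTail]
    norm_num at h ⊢
    linarith
  | 1 =>
    have h := mul_log_two_le_mul_log (a := 10) (b := 7) (x := 25 / 9) (by norm_num)
    have e : 1 - classRadius (1 + 2) ^ 2 / 4 = (25 / 9 : ℝ)⁻¹ := by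
      simp only [classRadius]; norm_num
    rw [e, Real.log_inv]
    simp only [classRadius, entropyTail]
    norm_num at h ⊢
    linarith
  | 2 =>
    have h := mul_log_two_le_mul_log (a := 9) (b := 4) (x := 81 / 17) (by norm_num)
    have e : 1 - classRadius (2 + 2) ^ 2 / 4 = (81 / 17 : ℝ)⁻¹ := by
      simp only [classRadius]; norm_num
    rw [e, Real.log_inv]
    simp only [classRadius, entropyTail]
    norm_num at h ⊢
    linarith
  | m + 3 =>
    set y : ℝ := (2 : ℝ)⁻¹ ^ (m + 4) with hy
    have hy0 : 0 < y := by positivity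
    have e : 1 - classRadius (m + 3 + 2) ^ 2 / 4 = ((1 + y) ^ 2 / (y * (2 + y)))⁻¹ := by
      simp only [classRadius]
      rw [← hy]
      field_simp
      ring
    -- With y = 2⁻⁽ᵐ⁺⁴⁾ the quantity 1 - R²/4 equals y(2+y)/(1+y)², so its logarithm falls by about
    -- log 2 per class, and three times that outweighs the growth of the price.
    have hlog : (m + 3) * Real.log 2 ≤ -Real.log (1 - classRadius (m + 3 + 2) ^ 2 / 4) := by
      rw [e, Real.log_inv, neg_neg]
      have h1 : (2 : ℝ) ^ (m + 3) ≤ (1 + y) ^ 2 / (y * (2 + y)) := by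
        have h2 : (2 : ℝ) ^ (m + 3) * y = 1 / 2 := by
          rw [hy, pow_succ (2 : ℝ)⁻¹ (m + 3), ← mul_assoc, ← mul_pow]; norm_num
        rw [le_div_iff₀ (by positivity), ← mul_assoc, h2]
        nlinarith
      have := Real.log_le_log (by positivity) h1
      rw [Real.log_pow] at this
      exact_mod_cast this
    have hm1 : ((m : ℝ) + 9) * (2 : ℝ)⁻¹ ^ (m + 6) ≤ 9 / 64 := by
      have : ∀ m : ℕ, ((m : ℝ) + 9) ≤ 9 * 2 ^ m := by
        intro m
        induction m with
        | zero => norm_num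
        | succ m ih =>
          have := one_le_pow₀ (one_le_two (α := ℝ)) (n := m)
          push_cast; rw [pow_succ]; linarith
      rw [pow_add, inv_pow, ← mul_assoc, ← div_eq_mul_inv]
      have h5 := (div_le_iff₀ (show (0 : ℝ) < 2 ^ m by positivity)).2 (this m)
      norm_num at h5 ⊢
      linarith
    have hm2 : (2 : ℝ)⁻¹ ^ (m + 3 + 4) ≤ 1 / 128 := by
      have := pow_le_one₀ (show (0 : ℝ) ≤ (2 : ℝ)⁻¹ by norm_num) (by norm_num : (2 : ℝ)⁻¹ ≤ 1) (n := m)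
      rw [add_assoc, pow_add]; norm_num at this ⊢; linarith
    have hm3 : (4 : ℝ)⁻¹ ^ (m + 3 + 3) ≤ 1 / 4096 := by
      have := pow_le_one₀ (show (0 : ℝ) ≤ (4 : ℝ)⁻¹ by norm_num) (by norm_num : (4 : ℝ)⁻¹ ≤ 1) (n := m)
      rw [add_assoc, pow_add]; norm_num at this ⊢; linarith
    have ht : entropyTail (m + 3 + 3) ≤ 9 / 64 * Real.log 2 + 1 / 4096 / 6 := by
      unfold entropyTail
      push_cast
      rw [show (m + 3 + 3 + 3 : ℝ) = m + 9 by ring, show m + 3 + 3 = m + 6 from rfl]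
      gcongr
    have hX : 1 / 2 * (((m + 3 : ℕ) + 4) * Real.log 2 + (2 : ℝ)⁻¹ ^ (m + 3 + 4)) + entropyTail (m + 3 + 3)
        ≤ 1 / 2 * ((m + 7) * Real.log 2 + 1 / 128) + (9 / 64 * Real.log 2 + 1 / 4096 / 6) := by
      push_cast
      rw [show (m + 3 + 4 : ℝ) = m + 7 by ring]
      gcongr
    have hX0 : 0 ≤ 1 / 2 * (((m + 3 : ℕ) + 4) * Real.log 2 + (2 : ℝ)⁻¹ ^ (m + 3 + 4)) +
        entropyTail (m + 3 + 3) := by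
      have := entropyTail_nonneg (m + 3 + 3)
      have := Real.log_pos one_lt_two
      positivity
    have hR := mul_le_mul_of_nonneg_right (classRadius_le_two (m + 3 + 3)) hX0
    push_cast at hX hX0 hR ⊢
    have hm0 : (0 : ℝ) ≤ m * Real.log 2 := mul_nonneg m.cast_nonneg (by linarith)
    linarith

/-- In class 0 price and gain add up to Q_p, so o ≤ 1 suffices; in class 1 the bound o ≤ 3/4 pays
exactly the gain. Further out, three of the nine factors use o ≤ 1/2, and the other six use o² ≤ (1
- r²/4)ᵖ, whose dependence on p matches that of the entropy. -/
theorem pow_nine_le_exp_class (hp : 1 ≤ p) {o r : ℝ} (ho0 : 0 ≤ o) (ho1 : o ≤ 1)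
    (h34 : 1 / 2 < r → o ≤ 3 / 4) (h12 : 1 < r → o ≤ 1 / 2) (hr2 : r ≤ 2)
    (hsq : o ^ 2 ≤ (1 - r ^ 2 / 4) ^ p) (n : ℕ) (hn : ∀ k, n = k + 1 → classRadius k < r) :
    o ^ 9 ≤ Real.exp (unitBallEntropy p - classCost p n - classGain p n) := by
  have hp' : (1 : ℝ) ≤ p := by exact_mod_cast hp
  have hQ := unitBallEntropy_le (p := p)
  have hQ2 := two_mul_log_two_le_unitBallEntropy (p := p)
  have hl1 := Real.log_two_gt_d9
  have hl2 := Real.log_two_lt_d9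
  rcases ho0.eq_or_lt with h0 | hopos
  · rw [← h0, zero_pow (by norm_num)]; exact (Real.exp_pos _).le
  suffices h : 9 * Real.log o ≤ unitBallEntropy p - classCost p n - classGain p n by
    calc o ^ 9 = Real.exp (9 * Real.log o) := by
          rw [mul_comm, Real.exp_mul, Real.exp_log hopos]; norm_cast
      _ ≤ _ := Real.exp_le_exp.2 h
  have hfar : ∀ k, 1 ≤ k → classRadius k < r → 9 * Real.log o ≤
      -(3 * Real.log 2) + 3 * (p * Real.log (1 - classRadius k ^ 2 / 4)) := by
    intro k hk hkr
    have hk1 : 1 ≤ classRadius k := by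
      obtain ⟨k, rfl⟩ := Nat.exists_eq_add_of_le' hk
      simp only [classRadius]
      have := pow_le_one₀ (show (0 : ℝ) ≤ (2 : ℝ)⁻¹ by norm_num) (by norm_num : (2 : ℝ)⁻¹ ≤ 1) (n := k)
      rw [le_div_iff₀ (by positivity)]; linarith
    have h1 : Real.log o ≤ -Real.log 2 := by
      rw [← Real.log_inv]
      exact Real.log_le_log hopos (by rw [← one_div]; exact h12 (by linarith))
    have hb : 0 ≤ 1 - r ^ 2 / 4 := by nlinarith
    have h2 : o ^ 2 ≤ (1 - classRadius k ^ 2 / 4) ^ p := hsq.trans (by gcongr)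
    have h3 := Real.log_le_log (by positivity) h2
    rw [Real.log_pow, Real.log_pow] at h3
    push_cast at h3
    linarith
  match n with
  | 0 =>
    have := Real.log_nonpos ho0 ho1
    simp only [classCost, classGain]
    linarith
  | 1 =>
    have h1 := Real.log_le_log hopos (h34 (by have := hn 0 rfl; simpa [classRadius] using this))
    have h2 : Real.log (3 / 4) = -Real.log (4 / 3) := by
      rw [← Real.log_inv]; norm_num
    simp only [classCost, classGain]
    linarith
  | 2 =>
    have h1 := hfar 1 le_rfl (hn 1 rfl)
    have e : 1 - classRadius 1 ^ 2 / 4 = (4 / 3 : ℝ)⁻¹ := by simp only [classRadius]; norm_num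
    rw [e, Real.log_inv] at h1
    -- Since Q_p ≤ p(3 log 2 + 1/6), this class needs log 2 + 1/18 ≤ 3 log(4/3), which follows from
    -- 2² ≤ (4/3)⁵.
    have h2 := mul_log_two_le_mul_log (a := 2) (b := 5) (x := 4 / 3) (by norm_num)
    simp only [classCost, classGain]
    norm_num at h2
    have h3 : (p : ℝ) * (Real.log 2 + 1 / 18) ≤ p * (3 * Real.log (4 / 3)) := by
      gcongr
      linarith
    linarith
  | n + 3 =>
    have h1 := hfar (n + 2) (by omega) (hn (n + 2) rfl)
    have h2 := mul_le_mul_of_nonneg_left (classCost_numeric n) (show (0 : ℝ) ≤ p by linarith)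
    simp only [classCost, classGain]
    have h3 : (n : ℝ) * Real.log 2 ≤ p * (n * Real.log 2) :=
      le_mul_of_one_le_left (by positivity) hp'
    have h4 : classRadius (n + 3) *
      (p * (1 / 2 * ((n + 4) * Real.log 2 + (2 : ℝ)⁻¹ ^ (n + 4)) + entropyTail (n + 3))) =
      p * (classRadius (n + 3) *
      (1 / 2 * ((n + 4) * Real.log 2 + (2 : ℝ)⁻¹ ^ (n + 4)) + entropyTail (n + 3))) := by ring
    rw [h4]
    linarith

/-- The index of the distance class of `r`. -/
def classIndex (r : ℝ) : ℕ := sInf {n | r ≤ classRadius n}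

theorem le_classRadius_classIndex {r : ℝ} (hr : r < 2) : r ≤ classRadius (classIndex r) := by
  refine Nat.sInf_mem (s := {n | r ≤ classRadius n}) ?_
  have h : Filter.Tendsto (fun k : ℕ => 2 / (1 + (2 : ℝ)⁻¹ ^ k)) Filter.atTop (nhds (2 / (1 + 0))) :=
    Filter.Tendsto.div tendsto_const_nhds ((tendsto_pow_atTop_nhds_zero_of_lt_one (by norm_num)
      (by norm_num)).const_add 1) (by norm_num)
  obtain ⟨k, hk⟩ := (h.eventually_const_le (show r < 2 / (1 + 0) by simpa using hr)).exists
  exact ⟨k + 1, hk⟩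

theorem classRadius_lt_of_classIndex {r : ℝ} {k : ℕ} (h : classIndex r = k + 1) :
    classRadius k < r := by
  by_contra hle
  push Not at hle
  have := Nat.sInf_le (s := {n | r ≤ classRadius n}) hle
  rw [classIndex] at h
  omega

end

/-! ### Geometry of the local ellipsoids and suprema of increments from one centre -/

section


variable {p : ℕ} {Ω : Type*} [MeasurableSpace Ω]

/-- The ellipsoid `{x : ‖B (x - θ)‖ ≤ r}`. -/
def frameBall (B : Param p ≃L[ℝ] Param p) (θ : Param p) (r : ℝ) : Set (Param p) :=
  {x | ‖B (x - θ)‖ ≤ r}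

theorem isClosed_frameBall (B : Param p ≃L[ℝ] Param p) (θ : Param p) (r : ℝ) :
    IsClosed (frameBall B θ r) :=
  isClosed_le (by fun_prop) continuous_const

/-- The Jacobian factor of the map `x ↦ B (x - θ)`. -/
def frameJac (B : Param p ≃L[ℝ] Param p) : ℝ≥0∞ :=
  ENNReal.ofReal |LinearMap.det (B.symm : Param p →ₗ[ℝ] Param p)|

theorem frameJac_ne_top (B : Param p ≃L[ℝ] Param p) : frameJac B ≠ ⊤ := ENNReal.ofReal_ne_top

theorem frameJac_ne_zero (B : Param p ≃L[ℝ] Param p) : frameJac B ≠ 0 := by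
  have : LinearMap.det (B.symm : Param p →ₗ[ℝ] Param p) ≠ 0 :=
    (LinearEquiv.isUnit_det' B.symm.toLinearEquiv).ne_zero
  simpa [frameJac] using this

theorem volume_frame_preimage (B : Param p ≃L[ℝ] Param p) (θ : Param p) (U : Set (Param p)) :
    volume {x | B (x - θ) ∈ U} = frameJac B * volume U := by
  have h1 : {x | B (x - θ) ∈ U} = (fun x => x + -θ) ⁻¹' (B ⁻¹' U) := by
    ext x; simp [sub_eq_add_neg]
  rw [h1, measure_preimage_add_right, Measure.addHaar_preimage_continuousLinearEquiv]
  rfl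

theorem volume_frameBall (B : Param p ≃L[ℝ] Param p) (θ : Param p) {r : ℝ} (hr : 0 ≤ r) :
    volume (frameBall B θ r) =
      frameJac B * (ENNReal.ofReal (r ^ p) * volume (Metric.closedBall (0 : Param p) 1)) := by
  have : frameBall B θ r = {x | B (x - θ) ∈ Metric.closedBall 0 r} := by
    ext x; simp [frameBall]
  rw [this, volume_frame_preimage, Measure.addHaar_closedBall' _ _ hr, finrank_euclideanSpace_fin]

theorem volume_frameBall_ne_top (B : Param p ≃L[ℝ] Param p) (θ : Param p) {r : ℝ} (hr : 0 ≤ r) :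
    volume (frameBall B θ r) ≠ ⊤ := by
  rw [volume_frameBall B θ hr]
  exact ENNReal.mul_ne_top (frameJac_ne_top B)
    (ENNReal.mul_ne_top ENNReal.ofReal_ne_top volume_unitBall_ne_top)

theorem volume_frameBall_ne_zero (B : Param p ≃L[ℝ] Param p) (θ : Param p) {r : ℝ} (hr : 0 < r) :
    volume (frameBall B θ r) ≠ 0 := by
  rw [volume_frameBall B θ hr.le]
  refine mul_ne_zero (frameJac_ne_zero B) (mul_ne_zero ?_ volume_unitBall_ne_zero)
  simp [hr]

namespace ExpField

variable {P : Measure Ω} {Θ : Set (Param p)} {A : Param p → Param p ≃L[ℝ] Param p}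
    {ζ : Param p → Ω → ℝ} {lam ε σ β : ℝ}

theorem comparable_center (h : ExpField P Θ A ζ lam ε σ β) {θ x : Param p} (hθ : θ ∈ Θ)
    (hx : ‖A θ (x - θ)‖ ≤ ε) :
    x ∈ Θ ∧ (∀ v, ‖A x v‖ ≤ σ * ‖A θ v‖) ∧ ∀ v, ‖A θ v‖ ≤ σ * ‖A x v‖ := by
  have h0 : ‖A θ (θ - θ)‖ ≤ ε := by simp [h.eps_pos.le]
  exact ⟨h.mem θ hθ x hx, h.comparable θ hθ x θ hx h0, h.comparable θ hθ θ x h0 hx⟩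

/-- Both ends are compared through the midpoint: each is within ε of it in its own frame, at the
cost of one factor σ. This reaches distance 2 in units of ε/σ, exactly the range in which unit
lenses can have positive volume. -/
theorem comparable_double (h : ExpField P Θ A ζ lam ε σ β) {θ x : Param p} (hθ : θ ∈ Θ)
    (hx : ‖A θ (x - θ)‖ ≤ 2 * ε / σ) : x ∈ Θ ∧ ∀ v, ‖A x v‖ ≤ σ * ‖A θ v‖ := by
  have hσ : 0 < σ := by linarith [h.one_le]
  set m : Param p := θ + (2 : ℝ)⁻¹ • (x - θ) with hm
  have e1 : m - θ = (2 : ℝ)⁻¹ • (x - θ) := by rw [hm]; module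
  have e2 : x - m = (2 : ℝ)⁻¹ • (x - θ) := by rw [hm]; module
  have e3 : θ - m = -((2 : ℝ)⁻¹ • (x - θ)) := by rw [hm]; module
  have hmθ : ‖A θ ((2 : ℝ)⁻¹ • (x - θ))‖ ≤ ε / σ := by
    rw [map_smul, norm_smul, Real.norm_of_nonneg (by norm_num)]
    calc 2⁻¹ * ‖A θ (x - θ)‖ ≤ 2⁻¹ * (2 * ε / σ) := by gcongr
      _ = ε / σ := by ring
  have hmε : ‖A θ (m - θ)‖ ≤ ε := by
    rw [e1]; exact hmθ.trans (div_le_self h.eps_pos.le h.one_le)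
  obtain ⟨hmΘ, hc, -⟩ := h.comparable_center hθ hmε
  have hs : ‖A m ((2 : ℝ)⁻¹ • (x - θ))‖ ≤ ε := (hc _).trans (by
    calc σ * ‖A θ ((2 : ℝ)⁻¹ • (x - θ))‖ ≤ σ * (ε / σ) := by gcongr
      _ = ε := by field_simp)
  have hxm : ‖A m (x - m)‖ ≤ ε := by rwa [e2]
  have hθm : ‖A m (θ - m)‖ ≤ ε := by rwa [e3, map_neg, norm_neg]
  exact ⟨h.mem m hmΘ x hxm, h.comparable m hmΘ x θ hxm hθm⟩

/-- Two points whose small ellipsoids meet have comparable frames. -/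
theorem comparable_of_mem_inter (h : ExpField P Θ A ζ lam ε σ β) {θ θ' x : Param p} (hθ : θ ∈ Θ)
    (hθ' : θ' ∈ Θ) (hx : x ∈ frameBall (A θ) θ (ε / σ ^ 2))
    (hx' : x ∈ frameBall (A θ') θ' (ε / σ ^ 2)) (v : Param p) : ‖A θ' v‖ ≤ σ * ‖A θ v‖ := by
  have hσ : 0 < σ := by linarith [h.one_le]
  have hle : ε / σ ^ 2 ≤ ε := div_le_self h.eps_pos.le (one_le_pow₀ h.one_le)
  have key : ∀ θ ∈ Θ, x ∈ frameBall (A θ) θ (ε / σ ^ 2) → x ∈ Θ ∧ ‖A x (θ - x)‖ ≤ ε := by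
    intro θ hθ hx
    obtain ⟨hxΘ, hc, -⟩ := h.comparable_center hθ (hx.trans hle)
    refine ⟨hxΘ, ?_⟩
    rw [← neg_sub, map_neg, norm_neg]
    calc ‖A x (x - θ)‖ ≤ σ * ‖A θ (x - θ)‖ := hc _
      _ ≤ σ * (ε / σ ^ 2) := by gcongr; exact hx
      _ = ε / σ := by field_simp
      _ ≤ ε := div_le_self h.eps_pos.le h.one_le
  exact h.comparable x (key θ hθ hx).1 θ' θ (key θ' hθ' hx').2 (key θ hθ hx).2 v

open scoped Pointwise in
/-- The overlap of two small ellipsoids is controlled by a lens in the frame of one of them. -/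
theorem volume_inter_le (h : ExpField P Θ A ζ lam ε σ β) {θ θ' : Param p} (hθ : θ ∈ Θ)
    (hθ' : θ' ∈ Θ) :
    volume (Metric.closedBall (0 : Param p) 1) *
        volume (frameBall (A θ) θ (ε / σ ^ 2) ∩ frameBall (A θ') θ' (ε / σ ^ 2)) ≤
      ENNReal.ofReal (σ ^ p) * volume (lens ((σ / ε) • A θ' (θ - θ'))) *
        volume (frameBall (A θ') θ' (ε / σ ^ 2)) := by
  have hσ : 0 < σ := by linarith [h.one_le]
  have hε := h.eps_pos
  have hsub : frameBall (A θ) θ (ε / σ ^ 2) ∩ frameBall (A θ') θ' (ε / σ ^ 2) ⊆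
      {x | A θ' (x - θ') ∈ (ε / σ) • lens ((σ / ε) • A θ' (θ - θ'))} := by
    rintro x ⟨hx, hx'⟩
    have hne : ε / σ ≠ 0 := by positivity
    rw [Set.mem_ofPred_eq, Set.mem_smul_set_iff_inv_smul_mem₀ hne, inv_div]
    constructor
    · rw [mem_closedBall_zero_iff, norm_smul, Real.norm_of_nonneg (by positivity)]
      calc σ / ε * ‖A θ' (x - θ')‖ ≤ σ / ε * (ε / σ ^ 2) := by gcongr; exact hx'
        _ = 1 / σ := by field_simp
        _ ≤ 1 := by rw [div_le_one hσ]; exact h.one_le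
    · rw [Metric.mem_closedBall, dist_eq_norm, ← smul_sub, ← map_sub, sub_sub_sub_cancel_right,
        norm_smul, Real.norm_of_nonneg (by positivity)]
      calc σ / ε * ‖A θ' (x - θ)‖ ≤ σ / ε * (σ * ‖A θ (x - θ)‖) := by
            gcongr; exact h.comparable_of_mem_inter hθ hθ' hx hx' _
        _ ≤ σ / ε * (σ * (ε / σ ^ 2)) := by gcongr; exact hx
        _ = 1 := by field_simp
  have h1 := measure_mono (μ := volume) hsub
  rw [volume_frame_preimage, Measure.addHaar_smul, finrank_euclideanSpace_fin,
    abs_of_nonneg (by positivity)] at h1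
  rw [volume_frameBall _ _ (by positivity)]
  calc _ ≤ volume (Metric.closedBall (0 : Param p) 1) * (frameJac (A θ') *
        (ENNReal.ofReal ((ε / σ) ^ p) * volume (lens ((σ / ε) • A θ' (θ - θ'))))) := by gcongr
    _ = ENNReal.ofReal (σ ^ p * (ε / σ ^ 2) ^ p) * (volume (lens ((σ / ε) • A θ' (θ - θ'))) *
        (frameJac (A θ') * volume (Metric.closedBall (0 : Param p) 1))) := by
        rw [← mul_pow, show σ * (ε / σ ^ 2) = ε / σ by field_simp]; ring
    _ = _ := by
        rw [ENNReal.ofReal_mul (by positivity)]; ring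

/-- The field read in the frame at `θ` has increments of bounded exponential moments. -/
theorem lintegral_center_increment_le [SFinite P] (h : ExpField P Θ A ζ lam ε σ β) {θ : Param p}
    (hθ : θ ∈ Θ) {c : ℝ} (hc : 0 ≤ c) (hcε : c * ε ≤ lam) {y y' : Param p} (hy : ‖y‖ ≤ 2)
    (hy' : ‖y'‖ ≤ 2) {t : ℝ} (ht : 0 ≤ t) (hty : t * ‖y - y'‖ ≤ 2) :
    ∫⁻ ω, eexp (t * (c * ζ (θ + (ε / σ) • (A θ).symm y) ω -
      c * ζ (θ + (ε / σ) • (A θ).symm y') ω)) ∂P ≤ eexp β := by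
  have hσ : 0 < σ := by linarith [h.one_le]
  have hε := h.eps_pos
  have hmem : ∀ y : Param p, ‖y‖ ≤ 2 → ‖A θ (θ + (ε / σ) • (A θ).symm y - θ)‖ ≤ 2 * ε / σ := by
    intro y hy
    rw [add_sub_cancel_left, map_smul, ContinuousLinearEquiv.apply_symm_apply, norm_smul,
      Real.norm_of_nonneg (by positivity)]
    calc ε / σ * ‖y‖ ≤ ε / σ * 2 := by gcongr
      _ = 2 * ε / σ := by ring
  have heq : ∀ ω, t * (c * ζ (θ + (ε / σ) • (A θ).symm y) ω - c * ζ (θ + (ε / σ) • (A θ).symm y') ω) =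
      (t * c) * (ζ (θ + (ε / σ) • (A θ).symm y) ω - ζ (θ + (ε / σ) • (A θ).symm y') ω) := fun ω => by
    ring
  simp only [heq]
  refine h.lintegral_increment_le (h.comparable_double hθ (hmem y hy)).1
    (h.comparable_double hθ (hmem y' hy')).1 (mul_nonneg ht hc) fun s hs => ?_
  have e1 : θ + (ε / σ) • (A θ).symm y - (θ + (ε / σ) • (A θ).symm y') =
      (ε / σ) • (A θ).symm (y - y') := by rw [map_sub]; module
  have e2 : θ + (ε / σ) • (A θ).symm y' + s • ((ε / σ) • (A θ).symm (y - y')) =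
      θ + (ε / σ) • (A θ).symm ((1 - s) • y' + s • y) := by
    simp only [map_sub, map_add, map_smul]; module
  have hz : ‖(1 - s) • y' + s • y‖ ≤ 2 := by
    have := convex_closedBall (0 : Param p) 2 (by simpa using hy') (by simpa using hy)
      (sub_nonneg.2 hs.2) hs.1 (by ring)
    simpa using this
  rw [e1, e2]
  have h2 := (h.comparable_double hθ (hmem _ hz)).2 ((ε / σ) • (A θ).symm (y - y'))
  rw [map_smul (A θ), ContinuousLinearEquiv.apply_symm_apply, norm_smul (ε / σ),
    Real.norm_of_nonneg (by positivity : 0 ≤ ε / σ)] at h2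
  calc t * c * ‖A (θ + (ε / σ) • (A θ).symm ((1 - s) • y' + s • y)) ((ε / σ) • (A θ).symm (y - y'))‖
      ≤ t * c * (σ * (ε / σ * ‖y - y'‖)) := by gcongr
    _ = (c * ε) * (t * ‖y - y'‖) := by field_simp
    _ ≤ lam * 2 := by
        have := h.lam_nonneg
        gcongr
    _ = 2 * lam := by ring

/-- The penalised supremum of the increments from `θ`: the price depends on the distance class. -/
theorem lintegral_center_sup_le [IsProbabilityMeasure P] (h : ExpField P Θ A ζ lam ε σ β)
    {θ : Param p} (hθ : θ ∈ Θ) {c : ℝ} (hc : 0 ≤ c) (hcε : c * ε ≤ lam) (hp : 1 ≤ p) {η : ℝ}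
    (hη : 0 < η) (F : Finset (Param p)) (hF : ∀ y ∈ F, ‖y‖ < 2) :
    ∫⁻ ω, (F.sup fun y => eexp (c * (ζ (θ + (ε / σ) • (A θ).symm y) ω - ζ θ ω) -
      (classCost p (classIndex ‖y‖) + classGain p (classIndex ‖y‖) + β + η))) ∂P ≤ 1 := by
  classical
  set Y : Param p → Ω → ℝ := fun y ω => c * ζ (θ + (ε / σ) • (A θ).symm y) ω with hY
  have hYm : ∀ y, Measurable (Y y) := fun y => (h.measurable_apply _).const_mul c
  have hY0 : ∀ ω, Y 0 ω = c * ζ θ ω := fun ω => by simp [hY]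
  set Fn : ℕ → Finset (Param p) := fun n => F.filter fun y => classIndex ‖y‖ = n with hFn
  obtain ⟨N, hN⟩ : ∃ N, ∀ y ∈ F, classIndex ‖y‖ < N :=
    ⟨F.sup (fun y => classIndex ‖y‖) + 1, fun y hy =>
      Nat.lt_succ_of_le (Finset.le_sup (f := fun y => classIndex ‖y‖) hy)⟩
  have hclass : ∀ n, ∫⁻ ω, ((Fn n).sup fun y => eexp (Y y ω - Y 0 ω)) ∂P ≤
      eexp (classCost p n + β + η) := fun n =>
    chain_bound (fun y _ => hYm y) h.beta_nonneg
      (fun y y' hy hy' t ht hty => h.lintegral_center_increment_le hθ hc hcε hy hy' ht hty)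
      (classRadius_pos n) (classRadius_le_two n) (max 1 n) (classRadius_mul_le n)
      (fun K => classCost_ge n K) (Fn n) (fun y hy => by
        obtain ⟨hy1, hy2⟩ := Finset.mem_filter.1 hy
        rw [← hy2]; exact le_classRadius_classIndex (hF y hy1)) hη
  -- Union over the classes: each y is charged to its own class, and the remaining weights e^{-gain}
  -- sum to at most one.
  have hpt : ∀ ω, (F.sup fun y => eexp (c * (ζ (θ + (ε / σ) • (A θ).symm y) ω - ζ θ ω) -
      (classCost p (classIndex ‖y‖) + classGain p (classIndex ‖y‖) + β + η))) ≤
      ∑ n ∈ Finset.range N, eexp (-(classCost p n + classGain p n + β + η)) *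
        (Fn n).sup fun y => eexp (Y y ω - Y 0 ω) := by
    intro ω
    refine Finset.sup_le fun y hy => ?_
    have hmem : y ∈ Fn (classIndex ‖y‖) := Finset.mem_filter.2 ⟨hy, rfl⟩
    refine le_trans ?_ (Finset.single_le_sum (f := fun n =>
      eexp (-(classCost p n + classGain p n + β + η)) * (Fn n).sup fun y => eexp (Y y ω - Y 0 ω))
      (fun _ _ => zero_le) (Finset.mem_range.2 (hN y hy)))
    rw [sub_eq_neg_add, eexp_add]
    gcongr
    refine le_trans (le_of_eq ?_) (Finset.le_sup (f := fun y => eexp (Y y ω - Y 0 ω)) hmem)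
    rw [hY0]; simp only [hY]; rw [mul_sub]
  have hm : ∀ n, AEMeasurable (fun ω => (Fn n).sup fun y => eexp (Y y ω - Y 0 ω)) P := fun n =>
    aemeasurable_finsetSup _ fun y _ =>
      (measurable_eexp.comp ((hYm y).sub (hYm 0))).aemeasurable
  calc _ ≤ ∫⁻ ω, ∑ n ∈ Finset.range N, eexp (-(classCost p n + classGain p n + β + η)) *
        (Fn n).sup (fun y => eexp (Y y ω - Y 0 ω)) ∂P := lintegral_mono hpt
    _ = ∑ n ∈ Finset.range N, eexp (-(classCost p n + classGain p n + β + η)) *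
        ∫⁻ ω, ((Fn n).sup fun y => eexp (Y y ω - Y 0 ω)) ∂P := by
        rw [lintegral_finsetSum' _ fun n _ => (hm n).const_mul _]
        exact Finset.sum_congr rfl fun n _ => lintegral_const_mul'' _ (hm n)
    _ ≤ ∑ n ∈ Finset.range N, eexp (-classGain p n) := by
        refine Finset.sum_le_sum fun n _ => ?_
        refine (mul_le_mul' le_rfl (hclass n)).trans (le_of_eq ?_)
        rw [← eexp_add]; congr 1; ring
    _ ≤ 1 := by
        simp only [eexp]
        rw [← ENNReal.ofReal_sum_of_nonneg fun _ _ => (Real.exp_pos _).le]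
        exact ENNReal.ofReal_le_one.2 (sum_exp_neg_classGain_le hp N)

end ExpField

/-- A measurable partition of unity carried by the maximisers of a finite family. -/
theorem exists_argmax_partition {ι : Type*} [Fintype ι] [Nonempty ι] {f : ι → Ω → ℝ≥0∞}
    (hf : ∀ i, Measurable (f i)) : ∃ φ : ι → Ω → ℝ≥0∞, (∀ i, Measurable (φ i)) ∧
      (∀ ω, ∑ i, φ i ω = 1) ∧ ∀ ω, Finset.univ.sup (fun i => f i ω) = ∑ i, φ i ω * f i ω := by
  classical
  set S : ι → Set Ω := fun i => {ω | ∀ k, f k ω ≤ f i ω} with hS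
  have hSm : ∀ i, MeasurableSet (S i) := fun i => by
    rw [hS]; simp only [Set.ofPred_forall]
    exact MeasurableSet.iInter fun k => measurableSet_le (hf k) (hf i)
  set g : ι → Ω → ℝ≥0∞ := fun i => (S i).indicator 1 with hg
  have hgm : ∀ i, Measurable (g i) := fun i => measurable_one.indicator (hSm i)
  set N : Ω → ℝ≥0∞ := fun ω => ∑ i, g i ω with hN
  have hNm : Measurable N := Finset.measurable_fun_sum _ fun i _ => hgm i
  have hN0 : ∀ ω, N ω ≠ 0 := by
    intro ω
    obtain ⟨i, -, hi⟩ := Finset.exists_max_image Finset.univ (fun i => f i ω) Finset.univ_nonempty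
    have : ω ∈ S i := fun k => hi k (Finset.mem_univ k)
    intro h0
    have := (Finset.sum_eq_zero_iff.1 h0) i (Finset.mem_univ i)
    simp [*] at this
  have hNt : ∀ ω, N ω ≠ ⊤ := fun ω => ENNReal.sum_ne_top.2 fun i _ => by
    simp only [hg, Set.indicator]; split_ifs <;> simp
  -- Ties are shared equally among the maximisers.
  refine ⟨fun i ω => g i ω / N ω, fun i => (hgm i).div hNm, fun ω => ?_, fun ω => ?_⟩
  · simp only [div_eq_mul_inv]
    rw [← Finset.sum_mul]
    exact ENNReal.mul_inv_cancel (hN0 ω) (hNt ω)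
  · have hterm : ∀ i, g i ω / N ω * f i ω = g i ω / N ω * Finset.univ.sup fun i => f i ω := by
      intro i
      by_cases hi : ω ∈ S i
      · congr 1
        exact le_antisymm (Finset.le_sup (f := fun i => f i ω) (Finset.mem_univ i))
          (Finset.sup_le fun k _ => hi k)
      · simp [hg, hi]
    rw [Finset.sum_congr rfl fun i _ => hterm i, ← Finset.sum_mul]
    simp only [div_eq_mul_inv]
    rw [← Finset.sum_mul, ENNReal.mul_inv_cancel (hN0 ω) (hNt ω), one_mul]

end

/-! ### Finite suprema for ρ close to one -/

section


variable {p : ℕ} {Ω : Type*} [MeasurableSpace Ω]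

/-- The largest of the uniform densities on the small ellipsoids, weighted by `exp (-n i)`. -/
def envelope {ι : Type*} [Fintype ι] (A : Param p → Param p ≃L[ℝ] Param p) (r : ℝ)
    (θ : ι → Param p) (n : ι → ℝ) (x : Param p) : ℝ≥0∞ :=
  Finset.univ.sup fun i => (frameBall (A (θ i)) (θ i) r).indicator
    (fun _ => eexp (-n i) / volume (frameBall (A (θ i)) (θ i) r)) x

theorem measurable_finsetSup {ι X : Type*} [MeasurableSpace X] (T : Finset ι) {g : ι → X → ℝ≥0∞}
    (hg : ∀ a ∈ T, Measurable (g a)) : Measurable (fun x => T.sup fun a => g a x) := by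
  classical
  induction T using Finset.induction_on with
  | empty => simp
  | insert a T ha ih =>
    simp only [Finset.sup_insert]
    exact (hg a (Finset.mem_insert_self _ _)).sup
      (ih fun b hb => hg b (Finset.mem_insert_of_mem hb))

theorem measurable_envelope {ι : Type*} [Fintype ι] (A : Param p → Param p ≃L[ℝ] Param p) (r : ℝ)
    (θ : ι → Param p) (n : ι → ℝ) : Measurable (envelope A r θ n) := by
  unfold envelope
  exact measurable_finsetSup _ fun i _ =>
    measurable_const.indicator (isClosed_frameBall _ _ _).measurableSet

theorem le_envelope {ι : Type*} [Fintype ι] {A : Param p → Param p ≃L[ℝ] Param p} {r : ℝ}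
    {θ : ι → Param p} {n : ι → ℝ} {x : Param p} {i : ι} (hx : x ∈ frameBall (A (θ i)) (θ i) r) :
    eexp (-n i) / volume (frameBall (A (θ i)) (θ i) r) ≤ envelope A r θ n x := by
  refine le_trans (le_of_eq ?_) (Finset.le_sup (Finset.mem_univ i))
  rw [Set.indicator_of_mem hx]

theorem envelope_ne_top {ι : Type*} [Fintype ι] {A : Param p → Param p ≃L[ℝ] Param p} {r : ℝ}
    (hr : 0 < r) {θ : ι → Param p} {n : ι → ℝ} {x : Param p} : envelope A r θ n x ≠ ⊤ := by
  refine ((Finset.sup_lt_iff ENNReal.zero_lt_top).2 fun i _ => ?_).ne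
  rw [Set.indicator]
  split_ifs
  · exact (ENNReal.div_lt_top (eexp_ne_top _) (volume_frameBall_ne_zero _ _ hr))
  · exact ENNReal.zero_lt_top

/-- The fraction of the unit ball occupied by the lens is small for distant centres. -/
theorem volume_lens_div_le_eexp (hp : 1 ≤ p) {ρ : ℝ} (hρ : ρ < 1) (h9 : 9 * (1 - ρ) ≤ 1)
    {y : Param p} (hy : ‖y‖ < 2) :
    volume (lens y) / volume (Metric.closedBall (0 : Param p) 1) ≤
      eexp ((1 - ρ) * (unitBallEntropy p - classCost p (classIndex ‖y‖) -
        classGain p (classIndex ‖y‖))) := by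
  set ω := volume (Metric.closedBall (0 : Param p) 1) with hω
  have hω0 : ω ≠ 0 := volume_unitBall_ne_zero
  have hωt : ω ≠ ⊤ := volume_unitBall_ne_top
  have hωr : 0 < ω.toReal := ENNReal.toReal_pos hω0 hωt
  have hlt : volume (lens y) ≠ ⊤ := ((volume_lens_le y).trans_lt measure_closedBall_lt_top).ne
  have hdt : volume (lens y) / ω ≠ ⊤ := ENNReal.div_ne_top hlt hω0
  set o : ℝ := (volume (lens y) / ω).toReal with ho
  have ho' : o = (volume (lens y)).toReal / ω.toReal := ENNReal.toReal_div _ _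
  have ho0 : 0 ≤ o := ENNReal.toReal_nonneg
  have ho1 : o ≤ 1 := by
    rw [ho', div_le_one hωr]; exact ENNReal.toReal_mono hωt (volume_lens_le y)
  have hfrac : ∀ k : ℕ, 1 ≤ k → 2 < k * ‖y‖ → k * o ≤ k - 1 := by
    intro k hk hky
    have h := ENNReal.toReal_mono (by finiteness) (mul_volume_lens_le hky)
    rw [ENNReal.toReal_mul, ENNReal.toReal_mul, ENNReal.toReal_natCast, ENNReal.toReal_natCast,
      Nat.cast_sub hk] at h
    push_cast at h
    rw [ho', ← mul_div_assoc, div_le_iff₀ hωr]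
    exact h
  have hsq : o ^ 2 ≤ (1 - ‖y‖ ^ 2 / 4) ^ p := by
    have hnn : 0 ≤ 1 - ‖y‖ ^ 2 / 4 := by nlinarith [norm_nonneg y]
    have h := ENNReal.toReal_mono (by finiteness) (volume_lens_le_pow hy.le)
    rw [ENNReal.toReal_mul, ENNReal.toReal_ofReal (by positivity)] at h
    have h1 : o ≤ √(1 - ‖y‖ ^ 2 / 4) ^ p := by rw [ho', div_le_iff₀ hωr]; exact h
    calc o ^ 2 ≤ (√(1 - ‖y‖ ^ 2 / 4) ^ p) ^ 2 := by gcongr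
      _ = (1 - ‖y‖ ^ 2 / 4) ^ p := by rw [← pow_mul, mul_comm, pow_mul, Real.sq_sqrt hnn]
  -- Four translations leave the ball if ‖y‖ > 1/2 and two do if ‖y‖ > 1; hence the fractions 3/4
  -- and 1/2.
  have key := pow_nine_le_exp_class hp ho0 ho1 (r := ‖y‖)
    (fun h => by have := hfrac 4 (by norm_num) (by push_cast; linarith); push_cast at this; linarith)
    (fun h => by have := hfrac 2 (by norm_num) (by push_cast; linarith); push_cast at this; linarith)
    hy.le hsq (classIndex ‖y‖) (fun k hk => classRadius_lt_of_classIndex hk)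
  rw [← ENNReal.ofReal_toReal hdt]
  refine ENNReal.ofReal_le_ofReal ?_
  rw [← ho]
  rcases ho0.eq_or_lt with h0 | hpos
  · rw [← h0]; exact (Real.exp_pos _).le
  have h1 := Real.log_le_log (by positivity) key
  rw [Real.log_exp, Real.log_pow] at h1
  push_cast at h1
  -- As log o ≤ 0, the condition 9(1-ρ) ≤ 1 gives log o ≤ 9(1-ρ) log o. This is where ρ has to be
  -- close to one.
  have h2 := Real.log_nonpos ho0 ho1
  rw [← Real.log_le_iff_le_exp hpos]
  nlinarith

theorem volume_lens_eq_zero (hp : 1 ≤ p) {y : Param p} (hy : 2 ≤ ‖y‖) : volume (lens y) = 0 := by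
  rcases hy.eq_or_lt with h | h
  · have := volume_lens_le_pow h.ge
    rw [← h] at this
    norm_num [zero_pow (by omega : p ≠ 0)] at this
    exact this
  · have := mul_volume_lens_le (y := y) (k := 1) (by simpa using h)
    simpa using this

namespace ExpField

variable {P : Measure Ω} {Θ : Set (Param p)} {A : Param p → Param p ≃L[ℝ] Param p}
    {ζ : Param p → Ω → ℝ} {lam ε σ β : ℝ}

/-- On the ellipsoid of index i the envelope is at least e^{-n i} times the uniform density there.
This cancels that density and leaves the fraction of the ellipsoid of index j that is overlapped. -/
theorem lintegral_density_le (h : ExpField P Θ A ζ lam ε σ β) {ι : Type*} [Fintype ι]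
    {θ : ι → Param p} (hθ : ∀ i, θ i ∈ Θ) (n : ι → ℝ) (i j : ι) :
    ∫⁻ x, (frameBall (A (θ i)) (θ i) (ε / σ ^ 2)).indicator
        (fun _ => (volume (frameBall (A (θ i)) (θ i) (ε / σ ^ 2)))⁻¹) x *
      (frameBall (A (θ j)) (θ j) (ε / σ ^ 2)).indicator
        (fun _ => (volume (frameBall (A (θ j)) (θ j) (ε / σ ^ 2)))⁻¹) x /
        envelope A (ε / σ ^ 2) θ n x ≤
      eexp (n i) * ENNReal.ofReal (σ ^ p) *
        (volume (lens ((σ / ε) • A (θ j) (θ i - θ j))) /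
          volume (Metric.closedBall (0 : Param p) 1)) := by
  have hσ : 0 < σ := by linarith [h.one_le]
  have hr : 0 < ε / σ ^ 2 := div_pos h.eps_pos (by positivity)
  set B : ι → Set (Param p) := fun i => frameBall (A (θ i)) (θ i) (ε / σ ^ 2) with hB
  have hB0 : ∀ i, volume (B i) ≠ 0 := fun i => volume_frameBall_ne_zero _ _ hr
  have hBt : ∀ i, volume (B i) ≠ ⊤ := fun i => volume_frameBall_ne_top _ _ hr.le
  have hBm : ∀ i, MeasurableSet (B i) := fun i => (isClosed_frameBall _ _ _).measurableSet
  have hpt : ∀ x, (B i).indicator (fun _ => (volume (B i))⁻¹) x *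
      (B j).indicator (fun _ => (volume (B j))⁻¹) x / envelope A (ε / σ ^ 2) θ n x ≤
      (B i ∩ B j).indicator (fun _ => eexp (n i) * (volume (B j))⁻¹) x := by
    intro x
    by_cases hi : x ∈ B i
    · by_cases hj : x ∈ B j
      · rw [Set.indicator_of_mem hi, Set.indicator_of_mem hj, Set.indicator_of_mem (show x ∈ B i ∩ B j from ⟨hi, hj⟩)]
        have hW : eexp (-n i) * (volume (B i))⁻¹ ≤ envelope A (ε / σ ^ 2) θ n x := le_envelope hi
        refine ENNReal.div_le_of_le_mul ?_
        calc (volume (B i))⁻¹ * (volume (B j))⁻¹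
            = (eexp (-n i) * eexp (n i)) * ((volume (B i))⁻¹ * (volume (B j))⁻¹) := by
              rw [eexp_neg_mul_self, one_mul]
          _ = eexp (n i) * (volume (B j))⁻¹ * (eexp (-n i) * (volume (B i))⁻¹) := by ring
          _ ≤ _ := by gcongr
      · simp [hj]
    · simp [hi]
  refine (lintegral_mono hpt).trans ?_
  rw [lintegral_indicator ((hBm i).inter (hBm j)), setLIntegral_const]
  have hv := h.volume_inter_le (hθ i) (hθ j)
  have hv' : volume (B i ∩ B j) ≤ ENNReal.ofReal (σ ^ p) *
      (volume (lens ((σ / ε) • A (θ j) (θ i - θ j))) / volume (Metric.closedBall (0 : Param p) 1)) *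
        volume (B j) := by
    rw [← ENNReal.mul_le_mul_iff_right volume_unitBall_ne_zero volume_unitBall_ne_top]
    refine hv.trans (le_of_eq ?_)
    rw [show ∀ a b c d : ℝ≥0∞, a * (b * (c / a) * d) = b * (c / a * a) * d from
      fun a b c d => by ring, ENNReal.div_mul_cancel volume_unitBall_ne_zero volume_unitBall_ne_top]
  calc eexp (n i) * (volume (B j))⁻¹ * volume (B i ∩ B j)
      ≤ eexp (n i) * (volume (B j))⁻¹ * (ENNReal.ofReal (σ ^ p) *
      (volume (lens ((σ / ε) • A (θ j) (θ i - θ j))) / volume (Metric.closedBall (0 : Param p) 1)) *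
        volume (B j)) := by gcongr
    _ = eexp (n i) * ENNReal.ofReal (σ ^ p) * (volume (lens ((σ / ε) • A (θ j) (θ i - θ j))) /
          volume (Metric.closedBall (0 : Param p) 1)) * ((volume (B j))⁻¹ * volume (B j)) := by ring
    _ = _ := by rw [ENNReal.inv_mul_cancel (hB0 j) (hBt j), mul_one]

/-- The factor e^{ρ(Λ i - Λ j)} exchanges Λ i for Λ j. Hölder's inequality with weights ρ and 1-ρ
then separates the exponential at θ j, whose mean is at most one by `hΛ`, from the penalised
supremum of the increments from θ j. -/
theorem lintegral_weighted_le_one [IsProbabilityMeasure P] (h : ExpField P Θ A ζ lam ε σ β)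
    (hp : 1 ≤ p) {ρ : ℝ} (hρ0 : 0 ≤ ρ) (hρ1 : ρ < 1) (hlam : ρ / (1 - ρ) * ε ≤ lam)
    {ι : Type*} [Fintype ι] {θ : ι → Param p} (hθ : ∀ i, θ i ∈ Θ) {Λ n : ι → ℝ}
    (hΛ : ∀ i, ∫⁻ ω, eexp (ζ (θ i) ω - Λ i) ∂P ≤ 1) {η : ℝ} (hη : 0 < η)
    {φ : ι → Ω → ℝ≥0∞} (hφ1 : ∀ ω, ∑ i, φ i ω = 1) (j : ι) :
    ∫⁻ ω, ∑ i, φ i ω * eexp (ρ * (ζ (θ i) ω - Λ i) - n i) *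
      (if ‖(σ / ε) • A (θ j) (θ i - θ j)‖ < 2 then eexp (n i + ρ * (Λ i - Λ j) - (1 - ρ) *
        (classCost p (classIndex ‖(σ / ε) • A (θ j) (θ i - θ j)‖) +
          classGain p (classIndex ‖(σ / ε) • A (θ j) (θ i - θ j)‖) + β + η)) else 0) ∂P ≤ 1 := by
  classical
  have hσ : 0 < σ := by linarith [h.one_le]
  have hε := h.eps_pos
  set y : ι → Param p := fun i => (σ / ε) • A (θ j) (θ i - θ j) with hy
  set D : Param p → ℝ := fun y => classCost p (classIndex ‖y‖) + classGain p (classIndex ‖y‖) + β + η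
    with hD
  set F : Finset (Param p) := (Finset.univ.filter fun i => ‖y i‖ < 2).image y with hF
  set G : Ω → ℝ≥0∞ := fun ω => F.sup fun y => eexp (ρ / (1 - ρ) *
    (ζ (θ j + (ε / σ) • (A (θ j)).symm y) ω - ζ (θ j) ω) - D y) with hG
  have hc : 0 ≤ ρ / (1 - ρ) := div_nonneg hρ0 (by linarith)
  have hG1 : ∫⁻ ω, G ω ∂P ≤ 1 := h.lintegral_center_sup_le (hθ j) hc hlam hp hη F (fun z hz => by
    obtain ⟨i, hi, rfl⟩ := Finset.mem_image.1 hz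
    exact (Finset.mem_filter.1 hi).2)
  have hyi : ∀ i, θ j + (ε / σ) • (A (θ j)).symm (y i) = θ i := fun i => by
    simp only [hy]
    rw [map_smul, ContinuousLinearEquiv.symm_apply_apply, smul_smul,
      show ε / σ * (σ / ε) = 1 by field_simp, one_smul, add_sub_cancel]
  have hpt : ∀ ω, ∑ i, φ i ω * eexp (ρ * (ζ (θ i) ω - Λ i) - n i) *
      (if ‖y i‖ < 2 then eexp (n i + ρ * (Λ i - Λ j) - (1 - ρ) * D (y i)) else 0) ≤
      eexp (ζ (θ j) ω - Λ j) ^ ρ * G ω ^ (1 - ρ) := by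
    intro ω
    calc _ ≤ ∑ i, φ i ω * (eexp (ζ (θ j) ω - Λ j) ^ ρ * G ω ^ (1 - ρ)) := by
          refine Finset.sum_le_sum fun i _ => ?_
          rw [mul_assoc]
          refine mul_le_mul' le_rfl ?_
          split_ifs with hi
          · have hle : eexp (ρ / (1 - ρ) * (ζ (θ i) ω - ζ (θ j) ω) - D (y i)) ≤ G ω := by
              refine le_trans (le_of_eq ?_) (Finset.le_sup (Finset.mem_image_of_mem y
                (Finset.mem_filter.2 ⟨Finset.mem_univ i, hi⟩)))
              rw [hyi]
            refine le_trans (le_of_eq ?_)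
              (mul_le_mul' le_rfl (ENNReal.rpow_le_rpow hle (by linarith : 0 ≤ 1 - ρ)))
            rw [eexp_rpow, eexp_rpow, ← eexp_add, ← eexp_add]
            congr 1
            have : 1 - ρ ≠ 0 := by linarith
            field_simp
            ring
          · rw [mul_zero]; exact zero_le
      _ = _ := by rw [← Finset.sum_mul, hφ1, one_mul]
  refine (lintegral_mono hpt).trans ?_
  have hGm : AEMeasurable G P := aemeasurable_finsetSup _ fun z _ =>
    (measurable_eexp.comp ((((h.measurable_apply _).sub (h.measurable_apply _)).const_mul _).sub_const
      _)).aemeasurable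
  have hZm : AEMeasurable (fun ω => eexp (ζ (θ j) ω - Λ j)) P :=
    (measurable_eexp.comp ((h.measurable_apply _).sub_const _)).aemeasurable
  refine (ENNReal.lintegral_mul_norm_pow_le hZm hGm hρ0 (by linarith) (by ring)).trans ?_
  calc _ ≤ (1 : ℝ≥0∞) ^ ρ * 1 ^ (1 - ρ) := by
        gcongr
        exact hΛ j
    _ = 1 := by simp

/-- The masses carried by the maximisers are fed into `sum_mass_le` with ℓ = ρΛ. The factor e^{ρ(Λ i
- Λ j)} in `a` then disappears from the pair bound, and the chaining slack η tends to zero at the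
end. -/
theorem lintegral_sup_le_of_large [IsProbabilityMeasure P] (h : ExpField P Θ A ζ lam ε σ β)
    (hp : 1 ≤ p) {ρ : ℝ} (hρ0 : 0 ≤ ρ) (hρ1 : ρ < 1) (h9 : 9 * (1 - ρ) ≤ 1)
    (hlam : ρ / (1 - ρ) * ε ≤ lam) {ι : Type*} [Fintype ι] {θ : ι → Param p} (hθ : ∀ i, θ i ∈ Θ)
    {Λ : ι → ℝ} (n : ι → ℝ) (hΛ : ∀ i, ∫⁻ ω, eexp (ζ (θ i) ω - Λ i) ∂P ≤ 1) :
    ∫⁻ ω, Finset.univ.sup (fun i => eexp (ρ * (ζ (θ i) ω - Λ i) - n i)) ∂P ≤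
      eexp ((1 - ρ) * (unitBallEntropy p + β)) * ENNReal.ofReal (σ ^ p) *
        ∫⁻ x, envelope A (ε / σ ^ 2) θ n x := by
  classical
  rcases isEmpty_or_nonempty ι with hι | hι
  · simp
  have hσ : 0 < σ := by linarith [h.one_le]
  have hr : 0 < ε / σ ^ 2 := div_pos h.eps_pos (by positivity)
  have hfm : ∀ i, Measurable fun ω => eexp (ρ * (ζ (θ i) ω - Λ i) - n i) := fun i =>
    measurable_eexp.comp ((((h.measurable_apply _).sub_const _).const_mul _).sub_const _)
  obtain ⟨φ, hφm, hφ1, hφ⟩ := exists_argmax_partition hfm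
  have hterm : ∀ i, Measurable fun ω => φ i ω * eexp (ρ * (ζ (θ i) ω - Λ i) - n i) := fun i =>
    (hφm i).mul (hfm i)
  set m : ι → ℝ≥0∞ := fun i => ∫⁻ ω, φ i ω * eexp (ρ * (ζ (θ i) ω - Λ i) - n i) ∂P with hm
  have hmsum : ∫⁻ ω, Finset.univ.sup (fun i => eexp (ρ * (ζ (θ i) ω - Λ i) - n i)) ∂P = ∑ i, m i := by
    rw [lintegral_congr hφ, lintegral_finsetSum _ fun i _ => hterm i]
  -- Finite masses permit the division by their sum in `sum_mass_le`.
  have hmt : ∀ i, m i ≠ ⊤ := by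
    intro i
    have hφle : ∀ ω, φ i ω ≤ 1 := fun ω => by
      rw [← hφ1 ω]
      exact Finset.single_le_sum (f := fun i => φ i ω) (fun _ _ => zero_le) (Finset.mem_univ i)
    have h1 : m i ≤ ∫⁻ ω, eexp (-n i) * (eexp (ζ (θ i) ω - Λ i) ^ ρ * (1 : ℝ≥0∞) ^ (1 - ρ)) ∂P := by
      refine lintegral_mono fun ω => ?_
      refine (mul_le_mul' (hφle ω) le_rfl).trans (le_of_eq ?_)
      rw [one_mul, ENNReal.one_rpow, mul_one, eexp_rpow, ← eexp_add, sub_eq_neg_add]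
    have hZm : AEMeasurable (fun ω => eexp (ζ (θ i) ω - Λ i)) P :=
      (measurable_eexp.comp ((h.measurable_apply _).sub_const _)).aemeasurable
    rw [lintegral_const_mul' _ _ (eexp_ne_top _)] at h1
    refine (h1.trans_lt (ENNReal.mul_lt_top (eexp_ne_top _).lt_top ?_)).ne
    refine (ENNReal.lintegral_mul_norm_pow_le hZm aemeasurable_const hρ0 (by linarith)
      (by ring)).trans_lt ?_
    refine ENNReal.mul_lt_top (ENNReal.rpow_lt_top_of_nonneg hρ0
      ((hΛ i).trans_lt ENNReal.one_lt_top).ne) ?_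
    simp
  have hη : ∀ η : ℝ, 0 < η → ∑ i, m i ≤ eexp ((1 - ρ) * (unitBallEntropy p + β + η)) *
      ENNReal.ofReal (σ ^ p) * ∫⁻ x, envelope A (ε / σ ^ 2) θ n x := by
    intro η hη
    refine sum_mass_le (τ := volume) (k := fun i => (frameBall (A (θ i)) (θ i) (ε / σ ^ 2)).indicator
        fun _ => (volume (frameBall (A (θ i)) (θ i) (ε / σ ^ 2)))⁻¹)
      (W := envelope A (ε / σ ^ 2) θ n) (ℓ := fun i => ρ * Λ i)
      (a := fun i j => if ‖(σ / ε) • A (θ j) (θ i - θ j)‖ < 2 then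
        eexp (n i + ρ * (Λ i - Λ j) - (1 - ρ) *
        (classCost p (classIndex ‖(σ / ε) • A (θ j) (θ i - θ j)‖) +
          classGain p (classIndex ‖(σ / ε) • A (θ j) (θ i - θ j)‖) + β + η)) else 0)
      (fun i => measurable_const.indicator (isClosed_frameBall _ _ _).measurableSet) (fun i => ?_)
      (measurable_envelope _ _ _ _) (fun x => envelope_ne_top hr) (fun i x hx => ?_) hmt
      (fun j => ?_) (fun i j => ?_)
    · rw [lintegral_indicator (isClosed_frameBall _ _ _).measurableSet, setLIntegral_const]
      exact ENNReal.inv_mul_cancel (volume_frameBall_ne_zero _ _ hr) (volume_frameBall_ne_top _ _ hr.le)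
    · refine Set.indicator_of_notMem (fun hxi => ?_) _
      have := le_envelope (n := n) hxi
      rw [hx] at this
      refine ENNReal.div_ne_zero.2 ⟨eexp_ne_zero _, volume_frameBall_ne_top _ _ hr.le⟩
        (le_antisymm this zero_le)
    · refine le_trans (le_of_eq ?_) (h.lintegral_weighted_le_one hp hρ0 hρ1 hlam hθ hΛ hη hφ1 j
        (n := n))
      rw [lintegral_finsetSum _ fun i _ => (hterm i).mul_const _]
      exact Finset.sum_congr rfl fun i _ => (lintegral_mul_const _ (hterm i)).symm
    · refine (h.lintegral_density_le hθ n i j).trans ?_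
      split_ifs with hij
      · refine (mul_le_mul' le_rfl (volume_lens_div_le_eexp hp hρ1 h9 hij)).trans (le_of_eq ?_)
        rw [mul_right_comm, mul_right_comm _ (ENNReal.ofReal (σ ^ p)), ← eexp_add, ← eexp_add,
          ← eexp_add]
        congr 2
        ring
      -- Centres at rescaled distance at least 2 have a null overlap, so the weight 0 in `a` is
      -- enough.
      · rw [volume_lens_eq_zero hp (not_lt.1 hij)]
        simp
  rw [hmsum]
  have hlim : Filter.Tendsto (fun η : ℝ => eexp ((1 - ρ) * (unitBallEntropy p + β + η)) *
      ENNReal.ofReal (σ ^ p) * ∫⁻ x, envelope A (ε / σ ^ 2) θ n x) (nhdsWithin 0 (Set.Ioi 0))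
      (nhds (eexp ((1 - ρ) * (unitBallEntropy p + β + 0)) *
      ENNReal.ofReal (σ ^ p) * ∫⁻ x, envelope A (ε / σ ^ 2) θ n x)) := by
    have hcont : Continuous fun η : ℝ => eexp ((1 - ρ) * (unitBallEntropy p + β + η)) := by
      unfold eexp
      exact ENNReal.continuous_ofReal.comp (by fun_prop)
    have h1 := hcont.continuousAt (x := 0) |>.tendsto.mono_left (nhdsWithin_le_nhds (s := Set.Ioi 0))
    have hσp : ENNReal.ofReal (σ ^ p) ≠ 0 := by simp [hσ]
    exact ENNReal.Tendsto.mul_const (ENNReal.Tendsto.mul_const h1 (Or.inl (eexp_ne_zero _)))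
      (Or.inl (mul_ne_zero (eexp_ne_zero _) hσp))
  rw [add_zero] at hlim
  exact ge_of_tendsto hlim (by filter_upwards [self_mem_nhdsWithin] with η h using hη η h)

end ExpField

end

/-! ### A Sobolev-type estimate at the centre of an ellipsoid -/

section


variable {p : ℕ} {Ω : Type*} [MeasurableSpace Ω]

theorem lintegral_comp_homothety {F : Param p → ℝ≥0∞} (hF : Measurable F) (θ : Param p) {t : ℝ}
    (ht : 0 < t) : ENNReal.ofReal (t ^ p) * ∫⁻ x, F (θ + t • (x - θ)) = ∫⁻ x, F x := by
  have h1 : ∀ x, F (θ + t • (x - θ)) = (fun z => F ((θ - t • θ) + z)) (t • x) := fun x => by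
    simp only; congr 1; module
  have hm : Measurable fun z => F ((θ - t • θ) + z) := hF.comp (measurable_const_add _)
  rw [lintegral_congr h1, ← lintegral_map hm (measurable_const_smul t),
    Measure.map_addHaar_smul _ ht.ne', lintegral_smul_measure, smul_eq_mul,
    lintegral_add_left_eq_self, ← mul_assoc, finrank_euclideanSpace_fin,
    ← ENNReal.ofReal_mul (by positivity), abs_of_pos (by positivity),
    mul_inv_cancel₀ (by positivity), ENNReal.ofReal_one, one_mul]

theorem add_smul_sub_mem_frameBall {B : Param p ≃L[ℝ] Param p} {θ x : Param p} {r t : ℝ}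
    (ht : t ∈ Set.Icc (0 : ℝ) 1) (hx : x ∈ frameBall B θ r) : θ + t • (x - θ) ∈ frameBall B θ r := by
  change ‖B (θ + t • (x - θ) - θ)‖ ≤ r
  rw [add_sub_cancel_left, map_smul, norm_smul, Real.norm_of_nonneg ht.1]
  exact (mul_le_of_le_one_left (norm_nonneg _) ht.2).trans hx

/-- The average over the ellipsoid of the means of `G` along the rays from the centre. -/
theorem setLIntegral_ray_le {B : Param p ≃L[ℝ] Param p} {θ : Param p} {r : ℝ}
    {G : Param p → ℝ≥0∞} (hG : Measurable G) :
    ∫⁻ x in frameBall B θ r, ∫⁻ t in Set.Icc (0 : ℝ) 1,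
      ENNReal.ofReal (t ^ p) * G (θ + t • (x - θ)) ≤ ∫⁻ x in frameBall B θ r, G x := by
  set S := frameBall B θ r with hS
  have hSm : MeasurableSet S := (isClosed_frameBall _ _ _).measurableSet
  have hm : Measurable fun q : Param p × ℝ => ENNReal.ofReal (q.2 ^ p) * G (θ + q.2 • (q.1 - θ)) :=
    ((measurable_snd.pow_const p).ennreal_ofReal).mul
      (hG.comp (measurable_const.add (measurable_snd.smul (measurable_fst.sub_const θ))))
  rw [lintegral_lintegral_swap hm.aemeasurable]
  calc ∫⁻ t in Set.Icc (0 : ℝ) 1, ∫⁻ x in S, ENNReal.ofReal (t ^ p) * G (θ + t • (x - θ))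
      ≤ ∫⁻ t in Set.Icc (0 : ℝ) 1, ∫⁻ x in S, G x := by
        -- For t > 0 the homothety of ratio t about θ has Jacobian tᵖ and maps the ellipsoid into
        -- itself.
        have hae : ∀ᵐ t ∂(volume.restrict (Set.Icc (0 : ℝ) 1)), t ≠ 0 :=
          Measure.ae_ne _ 0
        refine lintegral_mono_ae ?_
        filter_upwards [hae, ae_restrict_mem measurableSet_Icc] with t ht0 ht
        have htpos : 0 < t := lt_of_le_of_ne ht.1 (Ne.symm ht0)
        rw [lintegral_const_mul' _ _ ENNReal.ofReal_ne_top]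
        calc ENNReal.ofReal (t ^ p) * ∫⁻ x in S, G (θ + t • (x - θ))
            ≤ ENNReal.ofReal (t ^ p) * ∫⁻ x, S.indicator G (θ + t • (x - θ)) := by
              refine mul_le_mul' le_rfl ?_
              rw [← lintegral_indicator hSm]
              refine lintegral_mono fun x => ?_
              by_cases hx : x ∈ S
              · rw [Set.indicator_of_mem hx,
                  Set.indicator_of_mem (add_smul_sub_mem_frameBall ht hx)]
              · rw [Set.indicator_of_notMem hx]; exact zero_le
          _ = ∫⁻ x in S, G x := by
              rw [lintegral_comp_homothety (hG.indicator hSm) θ htpos, lintegral_indicator hSm]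
    _ = ∫⁻ x in S, G x := by simp

/-- A value at the centre of an ellipsoid is controlled by an average over the ellipsoid, if the
logarithm of `G` dominates the radial derivatives. -/
theorem eexp_mul_volume_le {B : Param p ≃L[ℝ] Param p} {θ : Param p} {r α : ℝ} (hr : 0 < r)
    (hα0 : 0 < α) (hα1 : α < 1) {g : Param p → ℝ} (hg : Measurable g)
    (hd : ∀ z ∈ frameBall B θ r, DifferentiableAt ℝ g z) {G : Param p → ℝ≥0∞} (hG : Measurable G)
    (hG0 : ∀ z ∈ frameBall B θ r, G z ≠ 0) (hGt : ∀ z ∈ frameBall B θ r, G z ≠ ⊤)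
    (hder : ∀ z ∈ frameBall B θ r, ∀ x ∈ frameBall B θ r,
      fderiv ℝ g z (θ - x) ≤ (1 - α) * Real.log (G z).toReal) :
    eexp (g θ / α) * volume (frameBall B θ r) ≤ eexp ((1 - α) / α * p) *
      ((∫⁻ x in frameBall B θ r, G x) / volume (frameBall B θ r)) ^ ((1 - α) / α) *
        ∫⁻ x in frameBall B θ r, eexp (g x / α) := by
  set S := frameBall B θ r with hS
  have hSm : MeasurableSet S := (isClosed_frameBall _ _ _).measurableSet
  set v := volume S with hv
  have hv0 : v ≠ 0 := volume_frameBall_ne_zero _ _ hr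
  have hvt : v ≠ ⊤ := volume_frameBall_ne_top _ _ hr.le
  set κ := (1 - α) / α with hκ
  have hκ0 : 0 < κ := div_pos (by linarith) hα0
  set I := ∫⁻ x in S, G x with hI
  have hint0 : ∀ {F : Param p → ℝ≥0∞}, Measurable F → (∀ z ∈ S, F z ≠ 0) → ∫⁻ x in S, F x ≠ 0 := by
    intro F hF hF0 h0
    rw [lintegral_eq_zero_iff hF] at h0
    have h1 : ∀ᵐ x ∂volume.restrict S, False := by
      filter_upwards [h0, ae_restrict_mem hSm] with x hx hxS using hF0 x hxS hx
    rw [ae_iff] at h1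
    simp only [not_false_eq_true, Set.ofPred_true, Measure.restrict_apply_univ] at h1
    exact hv0 h1
  have hI0 : I ≠ 0 := hint0 hG hG0
  have hem : Measurable fun x => eexp (g x / α) := measurable_eexp.comp (hg.div_const α)
  rcases eq_or_ne I ⊤ with hIt | hIt
  · rw [hIt, ENNReal.top_div_of_ne_top hvt, ENNReal.top_rpow_of_pos hκ0,
      ENNReal.mul_top (eexp_ne_zero _), ENNReal.top_mul (hint0 hem fun _ _ => eexp_ne_zero _)]
    exact le_top
  set K := (I / v).toReal with hK
  have hIv0 : I / v ≠ 0 := (ENNReal.div_pos hI0 hvt).ne'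
  have hIvt : I / v ≠ ⊤ := ENNReal.div_ne_top hIt hv0
  have hKpos : 0 < K := ENNReal.toReal_pos hIv0 hIvt
  have hKe : ENNReal.ofReal K = I / v := ENNReal.ofReal_toReal hIvt
  set J : Param p → ℝ≥0∞ := fun x => ∫⁻ t in Set.Icc (0 : ℝ) 1,
      ENNReal.ofReal (t ^ p) * G (θ + t • (x - θ)) with hJ
  have hJI : ∫⁻ x in S, J x ≤ I := setLIntegral_ray_le hG
  set b : ℝ := κ * (Real.log K + p) with hb
  -- The tangent bound along the ray from θ to x, exponentiated by 1 + u ≤ eᵘ. It is linear in J x,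
  -- so after integration over x only the mean of J matters, which is at most K; the terms with κ
  -- then cancel.
  have hpt : ∀ x ∈ S, ENNReal.ofReal (1 + κ) ≤
      eexp (b - g θ / α) * eexp (g x / α) + ENNReal.ofReal (κ / K) * J x := by
    intro x hx
    rcases eq_or_ne (J x) ⊤ with hJt | hJt
    · rw [hJt, ENNReal.mul_top (by simp [hκ0, hKpos]), add_top]
      exact le_top
    have hz : ∀ t ∈ Set.Icc (0 : ℝ) 1, θ + t • (x - θ) ∈ S := fun t ht =>
      add_smul_sub_mem_frameBall ht hx
    have hmz : Measurable fun t : ℝ => θ + t • (x - θ) :=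
      measurable_const.add (measurable_id.smul_const _)
    have hmain := sub_le_of_deriv_le_log (f := fun t => -g (θ + t • (x - θ)))
      (f' := fun t => fderiv ℝ g (θ + t • (x - θ)) (θ - x))
      -- Positivity is required for every t, so the value 1 is substituted where G gives none; on
      -- [0,1] this never happens.
      (G := fun t => if 0 < (G (θ + t • (x - θ))).toReal then (G (θ + t • (x - θ))).toReal else 1)
      (κ := 1 - α) (K := K) (J := (J x).toReal) p (fun t ht => by
        have h1 := (hd _ (hz t ht)).hasFDerivAt
        have h2 : HasDerivAt (fun t : ℝ => θ + t • (x - θ)) (x - θ) t := by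
          simpa using ((hasDerivAt_id t).smul_const (x - θ)).const_add θ
        have h3 := (h1.comp_hasDerivAt t h2).neg
        rw [← map_neg, neg_sub] at h3
        exact h3) (by linarith) hKpos (fun t => by split_ifs with h <;> [exact h; exact one_pos])
      (Measurable.ite (measurableSet_lt measurable_const (hG.comp hmz).ennreal_toReal)
        (hG.comp hmz).ennreal_toReal measurable_const)
      (fun t ht => by
        have hm := hz t ⟨ht.1.le, ht.2.le⟩
        rw [if_pos (ENNReal.toReal_pos (hG0 _ hm) (hGt _ hm))]
        exact hder _ hm x hx) ENNReal.toReal_nonneg (by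
        rw [ENNReal.ofReal_toReal hJt]
        refine le_of_eq (setLIntegral_congr_fun measurableSet_Icc fun t ht => ?_)
        have hm := hz t ht
        rw [if_pos (ENNReal.toReal_pos (hG0 _ hm) (hGt _ hm)),
          ENNReal.ofReal_mul (pow_nonneg ht.1 _), ENNReal.ofReal_toReal (hGt _ hm)])
    simp only [one_smul, add_sub_cancel, zero_smul, add_zero] at hmain
    have h4 : -(κ * ((J x).toReal / K - 1)) ≤ b - g θ / α + g x / α := by
      have h5 := div_le_div_of_nonneg_right hmain hα0.le
      have h6 : (1 - α) * ((J x).toReal / K - 1 + Real.log K + p) / α =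
          κ * ((J x).toReal / K - 1) + b := by rw [hb, hκ]; ring
      rw [h6, sub_neg_eq_add, neg_add_eq_sub, sub_div] at h5
      linarith
    rw [← eexp_add, ← ENNReal.ofReal_toReal hJt, ← ENNReal.ofReal_mul (by positivity), eexp,
      ← ENNReal.ofReal_add (Real.exp_pos _).le (by positivity)]
    refine ENNReal.ofReal_le_ofReal ?_
    have h7 := Real.add_one_le_exp (b - g θ / α + g x / α)
    have h8 : κ / K * (J x).toReal = κ * ((J x).toReal / K) := by ring
    rw [h8]
    linarith
  have hsum : ENNReal.ofReal (1 + κ) * v ≤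
      eexp (b - g θ / α) * (∫⁻ x in S, eexp (g x / α)) + ENNReal.ofReal κ * v := by
    have h1 : ENNReal.ofReal (1 + κ) * v ≤ ∫⁻ x in S, (eexp (b - g θ / α) * eexp (g x / α) +
        ENNReal.ofReal (κ / K) * J x) := by
      rw [hv, ← setLIntegral_const]
      exact setLIntegral_mono' hSm hpt
    rw [lintegral_add_left (hem.const_mul _), lintegral_const_mul _ hem,
      lintegral_const_mul' _ _ ENNReal.ofReal_ne_top] at h1
    refine h1.trans (add_le_add le_rfl ?_)
    calc ENNReal.ofReal (κ / K) * ∫⁻ x in S, J x ≤ ENNReal.ofReal (κ / K) * I := by gcongr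
      _ = ENNReal.ofReal κ * v := by
        have hIK : I = ENNReal.ofReal K * v := by rw [hKe, ENNReal.div_mul_cancel hv0 hvt]
        rw [hIK, ← mul_assoc, ← ENNReal.ofReal_mul (by positivity), div_mul_cancel₀ _ hKpos.ne']
  rw [ENNReal.ofReal_add zero_le_one hκ0.le, add_mul, ENNReal.ofReal_one, one_mul] at hsum
  have hfin := (ENNReal.add_le_add_iff_right (ENNReal.mul_ne_top ENNReal.ofReal_ne_top hvt)).1 hsum
  have hb' : eexp (g θ / α) * eexp (b - g θ / α) = eexp (κ * p) * (I / v) ^ κ := by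
    rw [← eexp_add, ← hKe, ENNReal.ofReal_rpow_of_pos hKpos, Real.rpow_def_of_pos hKpos,
      ← eexp, ← eexp_add]
    congr 1
    rw [hb]; ring
  calc eexp (g θ / α) * v ≤ eexp (g θ / α) * (eexp (b - g θ / α) * ∫⁻ x in S, eexp (g x / α)) := by
        gcongr
    _ = _ := by rw [← mul_assoc, hb']

/-- A linear functional is controlled by its values on the directions of a `1/4`-net. -/
theorem exists_direction {T : Finset (Param p)}
    (hT : ∀ x : Param p, ‖x‖ ≤ 1 → ∃ y ∈ T, ‖x - y‖ ≤ 1 / 4) (ℓ : Param p →L[ℝ] ℝ)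
    (B : Param p ≃L[ℝ] Param p) {w : Param p} {s : ℝ} (hw : ‖B w‖ ≤ s) :
    ∃ y ∈ T, ℓ w ≤ ℓ ((s / 0.968) • B.symm (‖y‖⁻¹ • y)) := by
  set ℓ' : Param p →L[ℝ] ℝ := ℓ.comp (B.symm : Param p →L[ℝ] Param p) with hℓ'
  set v : Param p := (InnerProductSpace.toDual ℝ (Param p)).symm ℓ' with hv
  have hinner : ∀ u, ℓ (B.symm u) = inner ℝ v u := fun u => by
    rw [hv, InnerProductSpace.toDual_symm_apply]; rfl
  have hs : 0 ≤ s := (norm_nonneg _).trans hw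
  have hℓw : ℓ w ≤ ‖v‖ * s := by
    have : ℓ w = inner ℝ v (B w) := by rw [← hinner, ContinuousLinearEquiv.symm_apply_apply]
    rw [this]
    exact (real_inner_le_norm _ _).trans (by gcongr)
  rcases eq_or_ne v 0 with h0 | h0
  · obtain ⟨y, hy, -⟩ := hT 0 (by simp)
    refine ⟨y, hy, ?_⟩
    rw [map_smul, hinner, h0, inner_zero_left, smul_zero]
    simpa [h0] using hℓw
  have hvpos : 0 < ‖v‖ := norm_pos_iff.2 h0
  obtain ⟨y, hy, hyv⟩ := hT (‖v‖⁻¹ • v) (by rw [norm_smul, norm_inv, norm_norm, inv_mul_cancel₀ hvpos.ne'])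
  refine ⟨y, hy, hℓw.trans ?_⟩
  have hn : ‖‖v‖⁻¹ • v‖ = 1 := by rw [norm_smul, norm_inv, norm_norm, inv_mul_cancel₀ hvpos.ne']
  have hsq := norm_sub_sq_real (‖v‖⁻¹ • v) y
  rw [hn, real_inner_smul_left] at hsq
  have hle : ‖‖v‖⁻¹ • v - y‖ ^ 2 ≤ (1 / 4) ^ 2 := by gcongr
  -- 0.968 lies just below √(1 - 1/16), the least cosine of the angle between a unit vector and a
  -- point within 1/4 of it.
  have h1 : 0.968 * ‖y‖ ≤ ‖v‖⁻¹ * inner ℝ v y := by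
    nlinarith [sq_nonneg (‖y‖ - 0.968)]
  have hy0 : 0 < ‖y‖ := by
    have h2 := norm_sub_norm_le (‖v‖⁻¹ • v) y
    rw [hn] at h2
    linarith
  rw [map_smul, hinner, real_inner_smul_right, smul_eq_mul]
  have h3 : 0.968 ≤ ‖v‖⁻¹ * (‖y‖⁻¹ * inner ℝ v y) := by
    have := (le_div_iff₀ hy0).2 h1
    rw [div_eq_mul_inv] at this
    linarith
  have h4 : 0.968 * ‖v‖ ≤ ‖y‖⁻¹ * inner ℝ v y := by
    calc 0.968 * ‖v‖ ≤ ‖v‖⁻¹ * (‖y‖⁻¹ * inner ℝ v y) * ‖v‖ := by gcongr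
      _ = ‖y‖⁻¹ * inner ℝ v y := by field_simp
  calc ‖v‖ * s = s / 0.968 * (0.968 * ‖v‖) := by ring
    _ ≤ s / 0.968 * (‖y‖⁻¹ * inner ℝ v y) := by gcongr

end

/-! ### Finite suprema for ρ away from one, and both regimes together -/

section


variable {p : ℕ} {Ω : Type*} [MeasurableSpace Ω]

/-- The mean of the `g k` over those cells `S k` that contain `x`. -/
def cellMean {ι X : Type*} [Fintype ι] (S : ι → Set X) (g : ι → ℝ≥0∞) (x : X) : ℝ≥0∞ :=
  (∑ k, (S k).indicator 1 x * g k) / ∑ k, (S k).indicator 1 x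

section cellMean

variable {ι X : Type*} [Fintype ι] {S : ι → Set X} {g : ι → ℝ≥0∞} {x : X} {b : ℝ≥0∞}

theorem sum_indicator_ne_top : ∑ k, (S k).indicator (1 : X → ℝ≥0∞) x ≠ ⊤ :=
  ENNReal.sum_ne_top.2 fun k _ => by simp only [Set.indicator]; split_ifs <;> simp

theorem sum_indicator_ne_zero {i : ι} (hi : x ∈ S i) :
    ∑ k, (S k).indicator (1 : X → ℝ≥0∞) x ≠ 0 := fun h0 => by
  have := (Finset.sum_eq_zero_iff.1 h0) i (Finset.mem_univ i)
  simp [hi] at this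

theorem le_cellMean {i : ι} (hi : x ∈ S i) (h : ∀ k, x ∈ S k → b ≤ g k) : b ≤ cellMean S g x := by
  rw [cellMean, ENNReal.le_div_iff_mul_le (Or.inl (sum_indicator_ne_zero hi))
    (Or.inl sum_indicator_ne_top), Finset.mul_sum]
  refine Finset.sum_le_sum fun k _ => ?_
  by_cases hk : x ∈ S k
  · simpa [hk] using h k hk
  · simp [hk]

theorem cellMean_le (h : ∀ k, x ∈ S k → g k ≤ b) : cellMean S g x ≤ b := by
  refine ENNReal.div_le_of_le_mul ?_
  rw [Finset.mul_sum]
  refine Finset.sum_le_sum fun k _ => ?_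
  by_cases hk : x ∈ S k
  · simpa [hk] using h k hk
  · simp [hk]

theorem lintegral_cellMean {P : Measure Ω} {g : ι → Ω → ℝ≥0∞} (hg : ∀ k, Measurable (g k)) :
    ∫⁻ ω, cellMean S (fun k => g k ω) x ∂P = cellMean S (fun k => ∫⁻ ω, g k ω ∂P) x := by
  simp only [cellMean, div_eq_mul_inv]
  rw [lintegral_mul_const _ (Finset.measurable_fun_sum _ fun k _ => (hg k).const_mul _),
    lintegral_finsetSum _ fun k _ => (hg k).const_mul _]
  simp only [lintegral_const_mul _ (hg _)]

theorem measurable_cellMean [MeasurableSpace X] (hS : ∀ k, MeasurableSet (S k))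
    {g : ι → X → Ω → ℝ≥0∞} (hg : ∀ k, Measurable fun q : X × Ω => g k q.1 q.2) :
    Measurable fun q : X × Ω => cellMean S (fun k => g k q.1 q.2) q.1 := by
  have hind : ∀ k, Measurable fun q : X × Ω => (S k).indicator (1 : X → ℝ≥0∞) q.1 := fun k =>
    (measurable_one.indicator (hS k)).comp measurable_fst
  unfold cellMean
  exact (Finset.measurable_fun_sum _ fun k _ => (hind k).mul (hg k)).div
    (Finset.measurable_fun_sum _ fun k _ => hind k)

theorem cellMean_ne_top {i : ι} (hi : x ∈ S i) (hg : ∀ k, g k ≠ ⊤) : cellMean S g x ≠ ⊤ :=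
  ENNReal.div_ne_top (ENNReal.sum_ne_top.2 fun k _ => ENNReal.mul_ne_top (by
    simp only [Set.indicator]; split_ifs <;> simp) (hg k)) (sum_indicator_ne_zero hi)

end cellMean

/-- Hölder's inequality and Tonelli's theorem for two weighted integrals. -/
theorem lintegral_rpow_mul_rpow_le {X : Type*} [MeasurableSpace X] {τ : Measure X} [SFinite τ]
    {P : Measure Ω} [SFinite P] {W : X → ℝ≥0∞} {H G : X → Ω → ℝ≥0∞} {α : ℝ} {CH CG : ℝ≥0∞}
    (hα0 : 0 ≤ α) (hα1 : α ≤ 1) (hW : Measurable W) (hH : Measurable fun q : X × Ω => H q.1 q.2)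
    (hG : Measurable fun q : X × Ω => G q.1 q.2) (hHC : ∀ x, ∫⁻ ω, H x ω ∂P ≤ CH)
    (hGC : ∀ x, ∫⁻ ω, G x ω ∂P ≤ CG) :
    ∫⁻ ω, (∫⁻ x, W x * H x ω ∂τ) ^ α * (∫⁻ x, W x * G x ω ∂τ) ^ (1 - α) ∂P ≤
      CH ^ α * CG ^ (1 - α) * ∫⁻ x, W x ∂τ := by
  have h1α : 0 ≤ 1 - α := by linarith
  have hswap : ∀ {F : X → Ω → ℝ≥0∞} {C : ℝ≥0∞}, (Measurable fun q : X × Ω => F q.1 q.2) →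
      (∀ x, ∫⁻ ω, F x ω ∂P ≤ C) → ∫⁻ ω, ∫⁻ x, W x * F x ω ∂τ ∂P ≤ C * ∫⁻ x, W x ∂τ := by
    intro F C hF hFC
    have hm : Measurable fun q : X × Ω => W q.1 * F q.1 q.2 := (hW.comp measurable_fst).mul hF
    rw [lintegral_lintegral_swap (f := fun ω x => W x * F x ω)
      (hm.comp measurable_swap).aemeasurable, ← lintegral_const_mul _ hW]
    refine lintegral_mono fun x => ?_
    have hFx : Measurable fun ω => F x ω := hF.comp measurable_prodMk_left
    rw [lintegral_const_mul _ hFx, mul_comm]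
    exact mul_le_mul' (hFC x) le_rfl
  have hm : ∀ {F : X → Ω → ℝ≥0∞}, (Measurable fun q : X × Ω => F q.1 q.2) →
      AEMeasurable (fun ω => ∫⁻ x, W x * F x ω ∂τ) P := by
    intro F hF
    have hm : Measurable fun q : X × Ω => W q.1 * F q.1 q.2 := (hW.comp measurable_fst).mul hF
    exact hm.lintegral_prod_left'.aemeasurable
  refine (ENNReal.lintegral_mul_norm_pow_le (hm hH) (hm hG) hα0 h1α (by ring)).trans ?_
  refine (mul_le_mul' (ENNReal.rpow_le_rpow (hswap hH hHC) hα0)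
    (ENNReal.rpow_le_rpow (hswap hG hGC) h1α)).trans (le_of_eq ?_)
  rw [ENNReal.mul_rpow_of_nonneg _ _ hα0, ENNReal.mul_rpow_of_nonneg _ _ h1α, mul_mul_mul_comm,
    ← ENNReal.rpow_add_of_nonneg _ _ hα0 h1α, add_sub_cancel, ENNReal.rpow_one]

namespace ExpField

variable {P : Measure Ω} {Θ : Set (Param p)} {A : Param p → Param p ≃L[ℝ] Param p}
    {ζ : Param p → Ω → ℝ} {lam ε σ β : ℝ}

/-- The exponential moments of the gradient along the directions of a net. -/
def gradSum (Θ : Set (Param p)) (ζ : Param p → Ω → ℝ) (T : Finset (Param p))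
    (B : Param p ≃L[ℝ] Param p) (s : ℝ) (z : Param p) (ω : Ω) : ℝ≥0∞ :=
  ∑ y ∈ T, eexp (Θ.indicator (fun z => fderiv ℝ (fun z => ζ z ω) z (s • B.symm (‖y‖⁻¹ • y))) z)

theorem measurable_gradSum (h : ExpField P Θ A ζ lam ε σ β) (T : Finset (Param p))
    (B : Param p ≃L[ℝ] Param p) (s : ℝ) :
    Measurable fun q : Param p × Ω => gradSum Θ ζ T B s q.1 q.2 :=
  Finset.measurable_fun_sum _ fun _ _ => measurable_eexp.comp (h.measurable_fderiv _)

omit [MeasurableSpace Ω] in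
theorem gradSum_ne_top (T : Finset (Param p)) (B : Param p ≃L[ℝ] Param p) (s : ℝ) (z : Param p)
    (ω : Ω) : gradSum Θ ζ T B s z ω ≠ ⊤ :=
  ENNReal.sum_ne_top.2 fun _ _ => eexp_ne_top _

theorem lintegral_gradSum_le (h : ExpField P Θ A ζ lam ε σ β) {T : Finset (Param p)} {ℓ : ℝ}
    (hT : (T.card : ℝ) ≤ Real.exp ℓ) {θ z : Param p} {s : ℝ} (hs0 : 0 ≤ s)
    (hs : σ * s ≤ 2 * lam) (hz : z ∈ Θ) (hc : ∀ v, ‖A z v‖ ≤ σ * ‖A θ v‖) :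
    ∫⁻ ω, gradSum Θ ζ T (A θ) s z ω ∂P ≤ eexp (ℓ + β) := by
  have hσ : 0 ≤ σ := by linarith [h.one_le]
  have hm : ∀ u, Measurable fun ω =>
      eexp (Θ.indicator (fun z => fderiv ℝ (fun z => ζ z ω) z u) z) := fun u =>
    measurable_eexp.comp ((h.measurable_fderiv u).comp (measurable_const.prodMk measurable_id))
  unfold gradSum
  rw [lintegral_finsetSum _ fun y _ => hm _, eexp_add]
  refine (Finset.sum_le_card_nsmul T _ (eexp β) fun y _ => ?_).trans ?_
  · simp only [Set.indicator_of_mem hz]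
    refine h.moment z hz _ ((hc _).trans ?_)
    rw [map_smul, ContinuousLinearEquiv.apply_symm_apply, norm_smul, norm_smul, norm_inv, norm_norm,
      Real.norm_of_nonneg hs0]
    have : ‖y‖⁻¹ * ‖y‖ ≤ 1 := inv_mul_le_one
    calc σ * (s * (‖y‖⁻¹ * ‖y‖)) ≤ σ * (s * 1) := by gcongr
      _ ≤ 2 * lam := by linarith
  · rw [nsmul_eq_mul]
    gcongr
    exact natCast_le_eexp hT

omit [MeasurableSpace Ω] in
theorem le_gradSum {T : Finset (Param p)} {B : Param p ≃L[ℝ] Param p} {s : ℝ} {y z : Param p}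
    (hy : y ∈ T) (hz : z ∈ Θ) (ω : Ω) :
    eexp (fderiv ℝ (fun z => ζ z ω) z (s • B.symm (‖y‖⁻¹ • y))) ≤ gradSum Θ ζ T B s z ω := by
  refine le_trans (le_of_eq ?_) (Finset.single_le_sum (f := fun y => eexp (Θ.indicator
    (fun z => fderiv ℝ (fun z => ζ z ω) z (s • B.symm (‖y‖⁻¹ • y))) z)) (fun _ _ => zero_le) hy)
  rw [Set.indicator_of_mem hz]

/-- With α = ρ + (1-ρ)w, split ζ x into ζ b and an increment and apply Hölder's inequality with
weights ρ/α and (1-ρ)w/α. The first factor is normalised by Λ, the second is covered by the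
increment bound. -/
theorem lintegral_tilted_le [IsProbabilityMeasure P] (h : ExpField P Θ A ζ lam ε σ β) {ρ w r : ℝ}
    (hρ0 : 0 ≤ ρ) (hρ1 : ρ < 1) (hw : 0 < w) {b x : Param p} (hb : b ∈ Θ)
    (hx : x ∈ frameBall (A b) b r) (hr : r ≤ ε) (hwr : ρ / (1 - ρ) / w * (σ * r) ≤ 2 * lam) {Λ : ℝ}
    (hΛ : ∫⁻ ω, eexp (ζ b ω - Λ) ∂P ≤ 1) :
    ∫⁻ ω, eexp (ρ * (ζ x ω - Λ) / (ρ + (1 - ρ) * w)) ∂P ≤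
      eexp ((1 - ρ) * w * β / (ρ + (1 - ρ) * w)) := by
  have h1ρ : 0 < 1 - ρ := by linarith
  have hσ : 0 ≤ σ := by linarith [h.one_le]
  set α := ρ + (1 - ρ) * w with hα
  have hα0 : 0 < α := by positivity
  have hxΘ : x ∈ Θ := h.mem b hb x (hx.trans hr)
  have hinc : ∫⁻ ω, eexp (ρ / (1 - ρ) / w * (ζ x ω - ζ b ω)) ∂P ≤ eexp β := by
    refine h.lintegral_increment_le hxΘ hb (by positivity) fun t ht => ?_
    have hz := add_smul_sub_mem_frameBall ht hx
    have hc := (h.comparable_center hb (hz.trans hr)).2.1 (x - b)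
    calc ρ / (1 - ρ) / w * ‖A (b + t • (x - b)) (x - b)‖
        ≤ ρ / (1 - ρ) / w * (σ * ‖A b (x - b)‖) := by gcongr
      _ ≤ ρ / (1 - ρ) / w * (σ * r) := by gcongr; exact hx
      _ ≤ 2 * lam := hwr
  have heq : ∀ ω, eexp (ρ * (ζ x ω - Λ) / α) = eexp (ζ b ω - Λ) ^ (ρ / α) *
      eexp (ρ / (1 - ρ) / w * (ζ x ω - ζ b ω)) ^ ((1 - ρ) * w / α) := by
    intro ω
    rw [eexp_rpow, eexp_rpow, ← eexp_add]
    congr 1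
    field_simp
    ring
  rw [lintegral_congr heq]
  refine (ENNReal.lintegral_mul_norm_pow_le
    (measurable_eexp.comp ((h.measurable_apply _).sub_const _)).aemeasurable
    (measurable_eexp.comp (((h.measurable_apply _).sub (h.measurable_apply _)).const_mul
      _)).aemeasurable (by positivity) (by positivity) (by rw [← add_div, ← hα, div_self hα0.ne'])).trans ?_
  calc _ ≤ (1 : ℝ≥0∞) ^ (ρ / α) * eexp β ^ ((1 - ρ) * w / α) := by
        gcongr
        · exact hΛ
        · exact hinc
    _ = eexp ((1 - ρ) * w * β / α) := by
      rw [ENNReal.one_rpow, one_mul, eexp_rpow]; congr 1; ring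

/-- The bound of `eexp_mul_volume_le`, with the averages replaced by integrals against the
envelope. -/
theorem eexp_le_of_envelope {ι : Type*} [Fintype ι] {θ : ι → Param p} {n Λ : ι → ℝ} {r α ρ : ℝ}
    (hr : 0 < r) (hα0 : 0 < α) (hα1 : α < 1) {i : ι} {g : Param p → ℝ} (hg : Measurable g)
    (hd : ∀ z ∈ frameBall (A (θ i)) (θ i) r, DifferentiableAt ℝ g z) {G : Param p → ℝ≥0∞}
    (hG : Measurable G) (hG0 : ∀ z ∈ frameBall (A (θ i)) (θ i) r, G z ≠ 0)
    (hGt : ∀ z ∈ frameBall (A (θ i)) (θ i) r, G z ≠ ⊤)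
    (hder : ∀ z ∈ frameBall (A (θ i)) (θ i) r, ∀ x ∈ frameBall (A (θ i)) (θ i) r,
      fderiv ℝ (fun z => ρ * g z) z (θ i - x) ≤ (1 - α) * Real.log (G z).toReal) :
    eexp (ρ * (g (θ i) - Λ i) - n i) ≤ eexp ((1 - α) * p) *
      ((∫⁻ x, envelope A r θ n x * (eexp (ρ * g x / α) * Finset.univ.sup fun k =>
        (frameBall (A (θ k)) (θ k) r).indicator (fun _ => eexp (-(ρ * Λ k / α))) x)) ^ α *
      (∫⁻ x, envelope A r θ n x * G x) ^ (1 - α)) := by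
  set S := frameBall (A (θ i)) (θ i) r with hS
  have hSm : MeasurableSet S := (isClosed_frameBall _ _ _).measurableSet
  set v := volume S with hv
  have hv0 : v ≠ 0 := volume_frameBall_ne_zero _ _ hr
  have hvt : v ≠ ⊤ := volume_frameBall_ne_top _ _ hr.le
  set κ := (1 - α) / α with hκ
  have hκ0 : 0 < κ := div_pos (by linarith) hα0
  set IH := ∫⁻ x, envelope A r θ n x * (eexp (ρ * g x / α) * Finset.univ.sup fun k =>
        (frameBall (A (θ k)) (θ k) r).indicator (fun _ => eexp (-(ρ * Λ k / α))) x) with hIH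
  set IG := ∫⁻ x, envelope A r θ n x * G x with hIG
  have hbase := eexp_mul_volume_le (B := A (θ i)) (θ := θ i) hr hα0 hα1 (g := fun z => ρ * g z)
    (hg.const_mul ρ) (fun z hz => (hd z hz).const_mul ρ) hG hG0 hGt hder
  -- On S the envelope is at least e^{-n i}/v, so averages over this ellipsoid are dominated by
  -- integrals that do not depend on i.
  have hGle : eexp (-n i) * ((∫⁻ x in S, G x) / v) ≤ IG := by
    rw [div_eq_mul_inv, mul_comm _ v⁻¹, ← mul_assoc, ← div_eq_mul_inv, ← lintegral_const_mul _ hG]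
    refine (setLIntegral_mono' hSm fun x hx => ?_).trans (setLIntegral_le_lintegral S _)
    gcongr
    exact le_envelope hx
  have hHle : eexp (-n i) * v⁻¹ * (eexp (-(ρ * Λ i / α)) * ∫⁻ x in S, eexp (ρ * g x / α)) ≤ IH := by
    have hm : Measurable fun x => eexp (ρ * g x / α) :=
      measurable_eexp.comp ((hg.const_mul ρ).div_const α)
    rw [← lintegral_const_mul _ hm, ← lintegral_const_mul _ (hm.const_mul _)]
    refine (setLIntegral_mono' hSm fun x hx => ?_).trans (setLIntegral_le_lintegral S _)
    refine mul_le_mul' (le_envelope hx) ?_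
    rw [mul_comm]
    refine mul_le_mul' le_rfl (le_trans (le_of_eq ?_) (Finset.le_sup (Finset.mem_univ i)))
    rw [Set.indicator_of_mem hx]
  have hmain : eexp ((ρ * (g (θ i) - Λ i) - n i) / α) ≤ eexp (κ * p) * IG ^ κ * IH := by
    calc eexp ((ρ * (g (θ i) - Λ i) - n i) / α)
        = (eexp (-n i) ^ κ * eexp (-n i) * eexp (-(ρ * Λ i / α))) * (eexp (ρ * g (θ i) / α) *
            (v * v⁻¹)) := by
          rw [ENNReal.mul_inv_cancel hv0 hvt, mul_one, eexp_rpow, ← eexp_add, ← eexp_add, ← eexp_add]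
          congr 1
          rw [hκ]; field_simp; ring
      _ = (eexp (-n i) ^ κ * eexp (-n i) * eexp (-(ρ * Λ i / α)) * v⁻¹) *
            (eexp (ρ * g (θ i) / α) * v) := by ring
      _ ≤ (eexp (-n i) ^ κ * eexp (-n i) * eexp (-(ρ * Λ i / α)) * v⁻¹) *
            (eexp (κ * p) * ((∫⁻ x in S, G x) / v) ^ κ * ∫⁻ x in S, eexp (ρ * g x / α)) := by gcongr
      _ = eexp (κ * p) * (eexp (-n i) * ((∫⁻ x in S, G x) / v)) ^ κ *
            (eexp (-n i) * v⁻¹ * (eexp (-(ρ * Λ i / α)) * ∫⁻ x in S, eexp (ρ * g x / α))) := by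
          rw [ENNReal.mul_rpow_of_nonneg _ _ hκ0.le]; ring
      _ ≤ eexp (κ * p) * IG ^ κ * IH := by gcongr
  have hpow := ENNReal.rpow_le_rpow hmain hα0.le
  rw [eexp_rpow, ENNReal.mul_rpow_of_nonneg _ _ hα0.le, ENNReal.mul_rpow_of_nonneg _ _ hα0.le,
    eexp_rpow, ← ENNReal.rpow_mul] at hpow
  rw [mul_div_cancel₀ _ hα0.ne', show κ * α = 1 - α by rw [hκ]; field_simp,
    show α * (κ * p) = (1 - α) * p by rw [hκ]; field_simp] at hpow
  rw [mul_comm (IH ^ α), ← mul_assoc]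
  exact hpow

/-- The mean of the gradient sums in the frames of those ellipsoids that contain `z`. -/
def gradMean {ι : Type*} [Fintype ι] (Θ : Set (Param p)) (A : Param p → Param p ≃L[ℝ] Param p)
    (ζ : Param p → Ω → ℝ) (θ : ι → Param p) (T : Finset (Param p)) (r s : ℝ) (z : Param p) (ω : Ω) :
    ℝ≥0∞ :=
  cellMean (fun k => frameBall (A (θ k)) (θ k) r) (fun k => gradSum Θ ζ T (A (θ k)) s z ω) z

theorem measurable_gradMean (h : ExpField P Θ A ζ lam ε σ β) {ι : Type*} [Fintype ι]
    (θ : ι → Param p) (T : Finset (Param p)) (r s : ℝ) :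
    Measurable fun q : Param p × Ω => gradMean Θ A ζ θ T r s q.1 q.2 :=
  measurable_cellMean (fun _ => (isClosed_frameBall _ _ _).measurableSet)
    fun _ => h.measurable_gradSum _ _ _

omit [MeasurableSpace Ω] in
theorem gradMean_ne_top {ι : Type*} [Fintype ι] {θ : ι → Param p} {T : Finset (Param p)} {r s : ℝ}
    {z : Param p} {i : ι} (hz : z ∈ frameBall (A (θ i)) (θ i) r) (ω : Ω) :
    gradMean Θ A ζ θ T r s z ω ≠ ⊤ :=
  cellMean_ne_top (S := fun k => frameBall (A (θ k)) (θ k) r) hz fun _ => gradSum_ne_top _ _ _ _ _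

theorem lintegral_gradMean_le (h : ExpField P Θ A ζ lam ε σ β) {ι : Type*} [Fintype ι]
    {θ : ι → Param p} (hθ : ∀ i, θ i ∈ Θ) {T : Finset (Param p)} {ℓ : ℝ}
    (hT : (T.card : ℝ) ≤ Real.exp ℓ) {r s : ℝ} (hr : r ≤ ε) (hs0 : 0 ≤ s) (hs : σ * s ≤ 2 * lam)
    (z : Param p) : ∫⁻ ω, gradMean Θ A ζ θ T r s z ω ∂P ≤ eexp (ℓ + β) := by
  have hm : ∀ k, Measurable (gradSum Θ ζ T (A (θ k)) s z) := fun k => by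
    have h1 := (h.measurable_gradSum T (A (θ k)) s).comp (measurable_prodMk_left (x := z))
    exact h1
  unfold gradMean
  rw [lintegral_cellMean hm]
  exact cellMean_le fun k hk => h.lintegral_gradSum_le hT hs0 hs
    (h.mem _ (hθ k) z (le_trans hk hr)) (h.comparable_center (hθ k) (le_trans hk hr)).2.1

/-- The averaged gradient sums dominate the exponentials of the radial derivatives. -/
theorem eexp_le_gradMean (h : ExpField P Θ A ζ lam ε σ β) {ι : Type*} [Fintype ι]
    {θ : ι → Param p} (hθ : ∀ i, θ i ∈ Θ) {T : Finset (Param p)}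
    (hT : ∀ x : Param p, ‖x‖ ≤ 1 → ∃ y ∈ T, ‖x - y‖ ≤ 1 / 4) {r τ s : ℝ} (hr : r ≤ ε / σ ^ 2)
    (hτ : 0 ≤ τ)
    (hs : s = τ * (σ * r / 0.968)) {i : ι} {z x : Param p} (hz : z ∈ frameBall (A (θ i)) (θ i) r)
    (hx : x ∈ frameBall (A (θ i)) (θ i) r) (ω : Ω) :
    eexp (τ * fderiv ℝ (fun z => ζ z ω) z (θ i - x)) ≤
      gradMean Θ A ζ θ T r s z ω := by
  have hσ : 0 ≤ σ := by linarith [h.one_le]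
  have hrε : r ≤ ε := hr.trans (div_le_self h.eps_pos.le (one_le_pow₀ h.one_le))
  have hzΘ : z ∈ Θ := h.mem _ (hθ i) z (le_trans hz hrε)
  -- Each ellipsoid containing z dominates the derivative in its own frame, hence so does their
  -- mean. A mean, unlike a sum, keeps the moment bound independent of the number of ellipsoids.
  refine le_cellMean hz fun k hk => ?_
  have hcmp : ‖A (θ k) (θ i - x)‖ ≤ σ * r := by
    refine (h.comparable_of_mem_inter (hθ i) (hθ k) (le_trans hz hr) (le_trans hk hr) _).trans ?_
    rw [← neg_sub, map_neg, norm_neg]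
    gcongr
    exact hx
  obtain ⟨y, hy, hyℓ⟩ := exists_direction hT (fderiv ℝ (fun z => ζ z ω) z) (A (θ k)) hcmp
  refine le_trans (eexp_le_eexp.2 ?_) (le_gradSum hy hzΘ ω)
  rw [hs, mul_smul, map_smul (fderiv ℝ (fun z => ζ z ω) z) τ, smul_eq_mul]
  exact mul_le_mul_of_nonneg_left hyℓ hτ

/-- Moments of the field tilted by the largest admissible weight. -/
theorem lintegral_tilted_sup_le [IsProbabilityMeasure P] (h : ExpField P Θ A ζ lam ε σ β)
    {ρ w r : ℝ} (hρ0 : 0 ≤ ρ) (hρ1 : ρ < 1) (hw : 0 < w) {ι : Type*} [Fintype ι] [Nonempty ι]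
    {θ : ι → Param p} (hθ : ∀ i, θ i ∈ Θ) (hr : r ≤ ε)
    (hwr : ρ / (1 - ρ) / w * (σ * r) ≤ 2 * lam) {Λ : ι → ℝ}
    (hΛ : ∀ i, ∫⁻ ω, eexp (ζ (θ i) ω - Λ i) ∂P ≤ 1) (x : Param p) :
    ∫⁻ ω, eexp (ρ * ζ x ω / (ρ + (1 - ρ) * w)) * Finset.univ.sup (fun k =>
      (frameBall (A (θ k)) (θ k) r).indicator
        (fun _ => eexp (-(ρ * Λ k / (ρ + (1 - ρ) * w)))) x) ∂P ≤
      eexp ((1 - ρ) * w * β / (ρ + (1 - ρ) * w)) := by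
  -- The largest weight at x is attained at an index b independent of ω; either x lies in its
  -- ellipsoid or all weights vanish.
  obtain ⟨b, -, hb⟩ := Finset.exists_mem_eq_sup Finset.univ Finset.univ_nonempty
    fun k => (frameBall (A (θ k)) (θ k) r).indicator
      (fun _ => eexp (-(ρ * Λ k / (ρ + (1 - ρ) * w)))) x
  rw [hb]
  by_cases hx : x ∈ frameBall (A (θ b)) (θ b) r
  · refine le_trans (le_of_eq (lintegral_congr fun ω => ?_))
      (h.lintegral_tilted_le hρ0 hρ1 hw (hθ b) hx hr hwr (hΛ b))
    rw [Set.indicator_of_mem hx, ← eexp_add]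
    congr 1; ring
  · simp [Set.indicator_of_notMem hx]

/-- The supremum is dominated by a product of two integrals against the envelope. -/
theorem sup_eexp_le_envelope (h : ExpField P Θ A ζ lam ε σ β) {ι : Type*} [Fintype ι]
    {θ : ι → Param p} (hθ : ∀ i, θ i ∈ Θ) {T : Finset (Param p)}
    (hT : ∀ x : Param p, ‖x‖ ≤ 1 → ∃ y ∈ T, ‖x - y‖ ≤ 1 / 4) {r α ρ s : ℝ} (hr0 : 0 < r)
    (hr : r ≤ ε / σ ^ 2) (hα0 : 0 < α) (hα1 : α < 1) (hρ0 : 0 ≤ ρ)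
    (hs : s = ρ / (1 - α) * (σ * r / 0.968)) (n Λ : ι → ℝ) (ω : Ω) :
    Finset.univ.sup (fun i => eexp (ρ * (ζ (θ i) ω - Λ i) - n i)) ≤ eexp ((1 - α) * p) *
      ((∫⁻ x, envelope A r θ n x * (eexp (ρ * ζ x ω / α) * Finset.univ.sup fun k =>
        (frameBall (A (θ k)) (θ k) r).indicator (fun _ => eexp (-(ρ * Λ k / α))) x)) ^ α *
      (∫⁻ x, envelope A r θ n x * gradMean Θ A ζ θ T r s x ω) ^ (1 - α)) := by
  have hrε : r ≤ ε := hr.trans (div_le_self h.eps_pos.le (one_le_pow₀ h.one_le))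
  have h1α : 0 < 1 - α := by linarith
  have hτ : 0 ≤ ρ / (1 - α) := by positivity
  refine Finset.sup_le fun i _ => ?_
  have hzΘ : ∀ z ∈ frameBall (A (θ i)) (θ i) r, z ∈ Θ := fun z hz =>
    h.mem _ (hθ i) z (le_trans hz hrε)
  have hlow : ∀ z ∈ frameBall (A (θ i)) (θ i) r, ∀ x ∈ frameBall (A (θ i)) (θ i) r,
      eexp (ρ / (1 - α) * fderiv ℝ (fun z => ζ z ω) z (θ i - x)) ≤ gradMean Θ A ζ θ T r s z ω :=
    fun z hz x hx => h.eexp_le_gradMean hθ hT hr hτ hs hz hx ω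
  have hG0 : ∀ z ∈ frameBall (A (θ i)) (θ i) r, gradMean Θ A ζ θ T r s z ω ≠ 0 := by
    intro z hz h0
    have := hlow z hz z hz
    rw [h0] at this
    exact eexp_ne_zero _ (le_antisymm this zero_le)
  have hder : ∀ z ∈ frameBall (A (θ i)) (θ i) r, ∀ x ∈ frameBall (A (θ i)) (θ i) r,
      fderiv ℝ (fun z => ρ * ζ z ω) z (θ i - x) ≤
        (1 - α) * Real.log (gradMean Θ A ζ θ T r s z ω).toReal := by
    intro z hz x hx
    have h1 := ENNReal.toReal_mono (gradMean_ne_top hz ω) (hlow z hz x hx)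
    rw [eexp_toReal] at h1
    have h2 := Real.log_le_log (Real.exp_pos _) h1
    rw [Real.log_exp, div_mul_eq_mul_div, div_le_iff₀ h1α] at h2
    rw [fderiv_const_mul (h.diff ω z (hzΘ z hz)), mul_comm (1 - α)]
    exact h2
  have hζm := h.measurable.comp (measurable_prodMk_right (y := ω))
  have hGm := (h.measurable_gradMean θ T r s).comp (measurable_prodMk_right (y := ω))
  exact eexp_le_of_envelope hr0 hα0 hα1 hζm (fun z hz => h.diff ω z (hzΘ z hz)) hGm hG0
    (fun z hz => gradMean_ne_top hz ω) hder

/-- The field receives the weight α = ρ + (1-ρ)59/120 and the gradient the weight 1-α = (1-ρ)61/120.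
With radius 59/60 · ε/σ² the tilt needs the factor (59/60)/(59/120) = 2, and the gradient 59/60 ·
120/61 / 0.968 < 2; both fit into the range 2λ of the moment condition. -/
theorem lintegral_sup_le_envelope [IsProbabilityMeasure P] (h : ExpField P Θ A ζ lam ε σ β) {ρ : ℝ}
    (hρ0 : 0 ≤ ρ) (hρ1 : ρ < 1) (hlam : ρ / (1 - ρ) * ε ≤ lam) {ι : Type*} [Fintype ι]
    {θ : ι → Param p} (hθ : ∀ i, θ i ∈ Θ) {Λ : ι → ℝ} (n : ι → ℝ)
    (hΛ : ∀ i, ∫⁻ ω, eexp (ζ (θ i) ω - Λ i) ∂P ≤ 1) :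
    ∫⁻ ω, Finset.univ.sup (fun i => eexp (ρ * (ζ (θ i) ω - Λ i) - n i)) ∂P ≤
      eexp ((1 - ρ) * (61 / 120 * (p + logCov p 2) + β)) *
        ∫⁻ x, envelope A (59 / 60 * (ε / σ ^ 2)) θ n x := by
  rcases isEmpty_or_nonempty ι with hι | hι
  · simp
  have hσ1 := h.one_le
  have hσ : 0 < σ := by linarith
  have hε := h.eps_pos
  have h1ρ : 0 < 1 - ρ := by linarith
  have hc0 : 0 ≤ ρ / (1 - ρ) := by positivity
  obtain ⟨r, hr⟩ : ∃ r : ℝ, r = 59 / 60 * (ε / σ ^ 2) := ⟨_, rfl⟩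
  have hr0 : 0 < r := by rw [hr]; positivity
  have hrr : r ≤ ε / σ ^ 2 := by
    have : 0 < ε / σ ^ 2 := by positivity
    rw [hr]; linarith
  have hrε : r ≤ ε := hrr.trans (div_le_self hε.le (one_le_pow₀ hσ1))
  have hσr : σ * r ≤ 59 / 60 * ε := by
    rw [hr]
    calc σ * (59 / 60 * (ε / σ ^ 2)) = 59 / 60 * (ε / σ) := by field_simp
      _ ≤ 59 / 60 * ε := by gcongr; exact div_le_self hε.le hσ1
  obtain ⟨α, hα⟩ : ∃ α : ℝ, α = ρ + (1 - ρ) * (59 / 120) := ⟨_, rfl⟩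
  have hα0 : 0 < α := by rw [hα]; positivity
  have h1α : 1 - α = (1 - ρ) * (61 / 120) := by rw [hα]; ring
  have h1α0 : 0 < 1 - α := by rw [h1α]; positivity
  have hα1 : α < 1 := by linarith
  obtain ⟨T, hTc, -, hTn⟩ := exists_net (p := p) (two_inv_pow_pos 2)
  have hTcard : (T.card : ℝ) ≤ Real.exp (logCov p 2) := by rw [exp_logCov]; exact_mod_cast hTc
  have hTn' : ∀ x : Param p, ‖x‖ ≤ 1 → ∃ y ∈ T, ‖x - y‖ ≤ 1 / 4 := fun x hx => by
    obtain ⟨y, hy, hxy⟩ := hTn x hx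
    exact ⟨y, hy, hxy.trans (by push_cast; norm_num)⟩
  have hSm : ∀ i, MeasurableSet (frameBall (A (θ i)) (θ i) r) := fun i =>
    (isClosed_frameBall _ _ _).measurableSet
  obtain ⟨s, hs⟩ : ∃ s : ℝ, s = ρ / (1 - α) * (σ * r / 0.968) := ⟨_, rfl⟩
  have hs0 : 0 ≤ s := by rw [hs]; positivity
  have hs2 : σ * s ≤ 2 * lam := by
    have e : σ * s = ρ / (1 - ρ) * (σ * (σ * r)) * (120 / 61 / 0.968) := by
      rw [hs, h1α]; field_simp
    have h2 : σ * (σ * r) = 59 / 60 * ε := by rw [hr]; field_simp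
    rw [e, h2]
    calc ρ / (1 - ρ) * (59 / 60 * ε) * (120 / 61 / 0.968)
        = ρ / (1 - ρ) * ε * (59 / 60 * (120 / 61 / 0.968)) := by ring
      _ ≤ lam * (59 / 60 * (120 / 61 / 0.968)) := by gcongr
      _ ≤ lam * 2 := by
        have := h.lam_nonneg
        gcongr
        norm_num
      _ = 2 * lam := by ring
  have hGE := h.lintegral_gradMean_le hθ hTcard hrε hs0 hs2
  have hHE := h.lintegral_tilted_sup_le hρ0 hρ1 (w := 59 / 120) (by norm_num) hθ hrε (by
      calc ρ / (1 - ρ) / (59 / 120) * (σ * r) ≤ ρ / (1 - ρ) / (59 / 120) * (59 / 60 * ε) := by gcongr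
        _ = 2 * (ρ / (1 - ρ) * ε) := by ring
        _ ≤ 2 * lam := by gcongr) hΛ
  rw [← hα] at hHE
  have hqm : Measurable fun x => Finset.univ.sup fun k => (frameBall (A (θ k)) (θ k) r).indicator
      (fun _ => eexp (-(ρ * Λ k / α))) x :=
    measurable_finsetSup _ fun k _ => measurable_const.indicator (hSm k)
  have hHm : Measurable fun z : Param p × Ω => eexp (ρ * ζ z.1 z.2 / α) *
      Finset.univ.sup fun k => (frameBall (A (θ k)) (θ k) r).indicator
        (fun _ => eexp (-(ρ * Λ k / α))) z.1 :=
    (measurable_eexp.comp ((h.measurable.const_mul ρ).div_const α)).mul (hqm.comp measurable_fst)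
  have hpt := h.sup_eexp_le_envelope hθ hTn' hr0 hrr hα0 hα1 hρ0 hs n Λ
  rw [← hr]
  refine (lintegral_mono hpt).trans ?_
  rw [lintegral_const_mul' _ _ (eexp_ne_top _)]
  refine (mul_le_mul' le_rfl (lintegral_rpow_mul_rpow_le hα0.le hα1.le (measurable_envelope _ _ _ _)
    hHm (h.measurable_gradMean θ T r s) hHE hGE)).trans (le_of_eq ?_)
  rw [eexp_rpow, eexp_rpow, ← mul_assoc, ← eexp_add, ← eexp_add]
  congr 2
  rw [mul_div_cancel₀ _ hα0.ne', h1α]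
  ring

/-- Here `lam` denotes a radius. Shrinking an ellipsoid by R raises its uniform density by R⁻ᵖ. -/
theorem envelope_mul_le (hr : 0 < lam) {ι : Type*} [Fintype ι] (θ : ι → Param p) (n : ι → ℝ) {R : ℝ}
    (hR0 : 0 < R) (hR1 : R ≤ 1) (x : Param p) :
    envelope A (R * lam) θ n x ≤ ENNReal.ofReal ((R⁻¹) ^ p) * envelope A lam θ n x := by
  refine Finset.sup_le fun i _ => ?_
  by_cases hx : x ∈ frameBall (A (θ i)) (θ i) (R * lam)
  · rw [Set.indicator_of_mem hx]
    have hx' : x ∈ frameBall (A (θ i)) (θ i) lam :=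
      le_trans (show ‖A (θ i) (x - θ i)‖ ≤ R * lam from hx) (mul_le_of_le_one_left hr.le hR1)
    refine le_trans (le_of_eq ?_) (mul_le_mul' le_rfl (le_envelope hx'))
    rw [volume_frameBall _ _ (by positivity), volume_frameBall _ _ hr.le, mul_pow,
      ENNReal.ofReal_mul (by positivity), inv_pow, ENNReal.ofReal_inv_of_pos (by positivity)]
    rw [show ∀ a b c d : ℝ≥0∞, a * (b * c * d) = b * (a * (c * d)) from fun a b c d => by ring,
      div_eq_mul_inv, div_eq_mul_inv, ENNReal.mul_inv (Or.inl (by simp [hR0]))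
        (Or.inl ENNReal.ofReal_ne_top)]
    ring
  · rw [Set.indicator_of_notMem hx]; exact zero_le

/-- Restoring the radius costs (60/59)ᵖ. As 1 ≤ 9(1-ρ), its logarithm is at most (1-ρ)9p/59, and for
p = 0 there is no loss. -/
theorem lintegral_sup_le_of_small [IsProbabilityMeasure P] (h : ExpField P Θ A ζ lam ε σ β) {ρ : ℝ}
    (hρ0 : 0 ≤ ρ) (hρ1 : ρ < 1) (h9 : p = 0 ∨ 1 ≤ 9 * (1 - ρ)) (hlam : ρ / (1 - ρ) * ε ≤ lam)
    {ι : Type*} [Fintype ι] {θ : ι → Param p} (hθ : ∀ i, θ i ∈ Θ) {Λ : ι → ℝ} (n : ι → ℝ)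
    (hΛ : ∀ i, ∫⁻ ω, eexp (ζ (θ i) ω - Λ i) ∂P ≤ 1) :
    ∫⁻ ω, Finset.univ.sup (fun i => eexp (ρ * (ζ (θ i) ω - Λ i) - n i)) ∂P ≤
      eexp ((1 - ρ) * (unitBallEntropy p + β)) * ENNReal.ofReal (σ ^ p) *
        ∫⁻ x, envelope A (ε / σ ^ 2) θ n x := by
  have hσ1 := h.one_le
  have hr : 0 < ε / σ ^ 2 := div_pos h.eps_pos (by positivity)
  refine (h.lintegral_sup_le_envelope hρ0 hρ1 hlam hθ n hΛ).trans ?_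
  have h1 : ∫⁻ x, envelope A (59 / 60 * (ε / σ ^ 2)) θ n x ≤
      ENNReal.ofReal ((59 / 60 : ℝ)⁻¹ ^ p) * ∫⁻ x, envelope A (ε / σ ^ 2) θ n x := by
    rw [← lintegral_const_mul _ (measurable_envelope _ _ _ _)]
    exact lintegral_mono fun x => envelope_mul_le hr θ n (by norm_num) (by norm_num) x
  have h2 : ENNReal.ofReal ((59 / 60 : ℝ)⁻¹ ^ p) = eexp (p * Real.log (60 / 59)) := by
    rw [eexp, mul_comm, Real.exp_mul, Real.exp_log (by norm_num), Real.rpow_natCast]; norm_num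
  have h3 : (1 : ℝ≥0∞) ≤ ENNReal.ofReal (σ ^ p) := by
    rw [← ENNReal.ofReal_one]; exact ENNReal.ofReal_le_ofReal (one_le_pow₀ hσ1)
  have hnum : (1 - ρ) * (61 / 120 * (p + logCov p 2) + β) + p * Real.log (60 / 59) ≤
      (1 - ρ) * (unitBallEntropy p + β) := by
    have hlog : Real.log (60 / 59) ≤ 1 / 59 := by
      have := Real.log_le_sub_one_of_pos (show (0 : ℝ) < 60 / 59 by norm_num)
      linarith
    have hQ := unitBallEntropy_ge (p := p) 2
    rw [Finset.sum_range_succ, Finset.sum_range_one] at hQ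
    have hL := logCov_two_le (p := p)
    have hL2 := logCov_le' (p := p) 2
    have hl1 := Real.log_two_gt_d9
    have hl2 := Real.log_two_lt_d9
    norm_num at hQ hL2
    have hp0 : (0 : ℝ) ≤ p := p.cast_nonneg
    have h5 : (p : ℝ) * (3 * Real.log 2 + 1 / 8) ≤ p * 2.2046 := by gcongr; linarith
    have h6 : (p : ℝ) * 0.6931 ≤ p * Real.log 2 := by gcongr; linarith
    have h7 : (p : ℝ) * Real.log (60 / 59) ≤ p * (1 / 59) := by gcongr
    have h8 : (p : ℝ) * (1 / 59) ≤ (1 - ρ) * (p * (9 / 59)) := by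
      rcases h9 with h9 | h9
      · simp [h9]
      · nlinarith
    -- By `hQ` and `hL` the entropy is at least logCov p 2 / 2 + p log 2. The excess logCov p 2 /
    -- 120 is bounded through `h5`, and p log 2 covers the rest.
    have h10 : 61 / 120 * (p + logCov p 2) + p * (9 / 59) ≤ unitBallEntropy p := by linarith
    have h11 := mul_le_mul_of_nonneg_left h10 (show 0 ≤ 1 - ρ by linarith)
    linarith
  calc _ ≤ eexp ((1 - ρ) * (61 / 120 * (p + logCov p 2) + β)) *
        (eexp (p * Real.log (60 / 59)) * ∫⁻ x, envelope A (ε / σ ^ 2) θ n x) := by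
        rw [← h2]; gcongr
    _ = eexp ((1 - ρ) * (61 / 120 * (p + logCov p 2) + β) + p * Real.log (60 / 59)) * 1 *
        ∫⁻ x, envelope A (ε / σ ^ 2) θ n x := by
        rw [eexp_add]; ring
    _ ≤ _ := by
        gcongr
        exact eexp_le_eexp.2 hnum

/-- The moment of a finite supremum is bounded by the integral of the envelope. -/
theorem lintegral_sup_le [IsProbabilityMeasure P] (h : ExpField P Θ A ζ lam ε σ β) {ρ : ℝ}
    (hρ0 : 0 ≤ ρ) (hρ1 : ρ < 1) (hlam : ρ / (1 - ρ) * ε ≤ lam)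
    {ι : Type*} [Fintype ι] {θ : ι → Param p} (hθ : ∀ i, θ i ∈ Θ) {Λ : ι → ℝ} (n : ι → ℝ)
    (hΛ : ∀ i, ∫⁻ ω, eexp (ζ (θ i) ω - Λ i) ∂P ≤ 1) :
    ∫⁻ ω, Finset.univ.sup (fun i => eexp (ρ * (ζ (θ i) ω - Λ i) - n i)) ∂P ≤
      eexp ((1 - ρ) * (unitBallEntropy p + β)) * ENNReal.ofReal (σ ^ p) *
        ∫⁻ x, envelope A (ε / σ ^ 2) θ n x := by
  by_cases h9 : p = 0 ∨ 1 ≤ 9 * (1 - ρ)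
  · exact h.lintegral_sup_le_of_small hρ0 hρ1 h9 hlam hθ n hΛ
  · push Not at h9
    exact h.lintegral_sup_le_of_large (Nat.one_le_iff_ne_zero.2 h9.1) hρ0 hρ1 h9.2.le hlam hθ n hΛ

end ExpField

end

/-! ### Linear frames for V and jointly measurable modifications -/

section


variable {p : ℕ} {Ω : Type*} [MeasurableSpace Ω]

open scoped MatrixOrder in
/-- A positive definite quadratic form is the square of the norm in a linear frame. -/
theorem exists_frame {V : Matrix (Fin p) (Fin p) ℝ} (hV : V.PosDef) :
    ∃ A : Param p ≃L[ℝ] Param p, (∀ v, quad V v = ‖A v‖ ^ 2) ∧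
      frameJac A * ENNReal.ofReal (√V.det) = 1 := by
  obtain ⟨B, rfl⟩ := CStarAlgebra.nonneg_iff_eq_star_mul_self.mp hV.posSemidef.nonneg
  have hdet : (star B * B).det = B.det ^ 2 := by
    rw [Matrix.det_mul, Matrix.star_eq_conjTranspose, Matrix.det_conjTranspose]
    simp [sq]
  have hB : B.det ≠ 0 := by
    intro h0
    have := hV.det_pos
    rw [hdet, h0] at this
    simp at this
  have hf : IsUnit (LinearMap.det (B.toLpLin 2 2)) := by
    rw [LinearMap.det_toLpLin]
    exact hB.isUnit
  refine ⟨(LinearMap.equivOfIsUnitDet hf).toContinuousLinearEquiv, fun v => ?_, ?_⟩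
  · have h1 : (LinearMap.equivOfIsUnitDet hf).toContinuousLinearEquiv v = B.toLpLin 2 2 v := by
      simp
    have h2 : quad (star B * B) v = v.ofLp ⬝ᵥ ((star B * B).mulVec v.ofLp) := by
      simp only [quad, dotProduct, Matrix.mulVec, Finset.mul_sum, mul_assoc]
    rw [h1, h2, EuclideanSpace.real_norm_sq_eq, ← Matrix.mulVec_mulVec, Matrix.dotProduct_mulVec,
      Matrix.star_eq_conjTranspose, Matrix.conjTranspose_eq_transpose_of_trivial,
      Matrix.vecMul_transpose]
    simp only [dotProduct, Matrix.ofLp_toLpLin, Matrix.toLin'_apply, sq]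
  · have h3 : LinearMap.det ((LinearMap.equivOfIsUnitDet hf : Param p →ₗ[ℝ] Param p)) = B.det := by
      rw [LinearMap.coe_equivOfIsUnitDet, LinearMap.det_toLpLin]
    have h4 := LinearEquiv.det_symm_mul_det (LinearMap.equivOfIsUnitDet hf)
    rw [h3] at h4
    have h5 : frameJac (LinearMap.equivOfIsUnitDet hf).toContinuousLinearEquiv =
        ENNReal.ofReal |LinearMap.det ((LinearMap.equivOfIsUnitDet hf).symm :
          Param p →ₗ[ℝ] Param p)| := rfl
    rw [h5, hdet, Real.sqrt_sq_eq_abs, ← ENNReal.ofReal_mul (abs_nonneg _), ← abs_mul, h4]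
    simp

/-- A random field which is almost surely continuous on a set agrees there, off a null set, with a
jointly measurable field. -/
theorem exists_measurable_modification {X : Type*} [TopologicalSpace X]
    [TopologicalSpace.MetrizableSpace X] [SecondCountableTopology X]
    [MeasurableSpace X] [BorelSpace X]
    {P : Measure Ω} {Θ : Set X} (hΘ : MeasurableSet Θ) {Z : X → Ω → ℝ}
    (hZ : ∀ θ ∈ Θ, AEMeasurable (Z θ) P) {good : Ω → Prop} (hgood : ∀ᵐ ω ∂P, good ω)
    (hcont : ∀ ω, good ω → ContinuousOn (fun θ => Z θ ω) Θ) :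
    ∃ N : Set Ω, P N = 0 ∧ (∀ ω ∉ N, good ω) ∧
      Measurable fun q : X × Ω => (Θ ×ˢ Nᶜ).indicator (fun q => Z q.1 q.2) q := by
  classical
  obtain ⟨D, hDΘ, hDc, hD⟩ :=
    (TopologicalSpace.IsSeparable.of_separableSpace Θ).exists_countable_dense_subset
  choose! m hm hme using fun θ (hθ : θ ∈ Θ) => hZ θ hθ
  have hae : ∀ᵐ ω ∂P, good ω ∧ ∀ q ∈ D, Z q ω = m q ω :=
    hgood.and ((ae_ball_iff hDc).2 fun q hq => hme q (hDΘ hq))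
  -- Off the measurable null set N the paths are good and agree on the countable dense set D with
  -- measurable versions. Continuity then makes every Z θ with θ in Θ measurable off N.
  obtain ⟨N, hN⟩ : ∃ N, N = toMeasurable P {ω | ¬ (good ω ∧ ∀ q ∈ D, Z q ω = m q ω)} := ⟨_, rfl⟩
  have hNm : MeasurableSet N := hN ▸ measurableSet_toMeasurable _ _
  have hNg : ∀ ω ∉ N, good ω ∧ ∀ q ∈ D, Z q ω = m q ω := by
    intro ω hω
    by_contra hc
    exact hω (hN ▸ subset_toMeasurable _ _ hc)
  refine ⟨N, ?_, fun ω hω => (hNg ω hω).1, ?_⟩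
  · rw [hN, measure_toMeasurable]
    exact hae
  have hu : ∀ θ : Θ, Measurable (Nᶜ.indicator (Z θ)) := by
    intro θ
    obtain ⟨q, hq, hqθ⟩ := mem_closure_iff_seq_limit.1 (hD θ.2)
    refine measurable_of_tendsto_metrizable (f := fun n => Nᶜ.indicator (m (q n)))
      (fun n => (hm _ (hDΘ (hq n))).indicator hNm.compl) ?_
    rw [tendsto_pi_nhds]
    intro ω
    by_cases hω : ω ∈ N
    · simp [hω]
    · have h1 : Nᶜ.indicator (Z θ) ω = Z θ ω := Set.indicator_of_mem hω _
      have h2 : (fun n => Nᶜ.indicator (m (q n)) ω) = fun n => Z (q n) ω := by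
        funext n
        rw [Set.indicator_of_mem (show ω ∈ Nᶜ from hω), (hNg ω hω).2 _ (hq n)]
      rw [h1, h2]
      exact ((hcont ω (hNg ω hω).1 θ θ.2).tendsto).comp
        (tendsto_nhdsWithin_iff.2 ⟨hqθ, Filter.Eventually.of_forall fun n => hDΘ (hq n)⟩)
  have hcu : ∀ ω, Continuous fun θ : Θ => Nᶜ.indicator (Z θ) ω := by
    intro ω
    by_cases hω : ω ∈ N
    · simp only [Set.indicator_of_notMem (show ω ∉ Nᶜ from fun h => h hω)]
      exact continuous_const
    · simp only [Set.indicator_of_mem (show ω ∈ Nᶜ from hω)]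
      exact continuousOn_iff_continuous_domRestrict.1 (hcont ω (hNg ω hω).1)
  have hjoint := measurable_uncurry_of_continuous_of_measurable hcu hu
  have hemb : MeasurableEmbedding (Prod.map ((↑) : Θ → X) (id : Ω → Ω)) :=
    (MeasurableEmbedding.subtype_coe hΘ).prodMap MeasurableEmbedding.id
  have := hemb.measurable_extend hjoint (measurable_const (a := (0 : ℝ)))
  convert this using 1
  funext q
  obtain ⟨x, ω⟩ := q
  by_cases hx : x ∈ Θ
  · have h3 := hemb.injective.extend_apply (Function.uncurry fun (θ : Θ) ω => Nᶜ.indicator (Z θ) ω)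
      (fun _ => (0 : ℝ)) (⟨x, hx⟩, ω)
    simp only [Prod.map_apply, id_eq] at h3
    rw [h3]
    by_cases hω : ω ∈ N <;> simp [hx, hω]
  · rw [Function.extend_apply', Set.indicator_of_notMem (fun h => hx h.1)]
    rintro ⟨⟨a, b⟩, hab⟩
    simp only [Prod.map_apply, Prod.mk.injEq] at hab
    exact hx (hab.1 ▸ a.2)

end

/-! ### From finite families to Θ, and the contrast as a field with exponential moments -/

section


variable {p : ℕ} {Ω : Type*} [MeasurableSpace Ω]

theorem eexp_eq (x : ℝ) : eexp x = ENNReal.ofReal (Real.exp x) := rfl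

theorem continuous_eexp : Continuous eexp :=
  ENNReal.continuous_ofReal.comp Real.continuous_exp

/-- A bound on the mean of all finite maxima of a random field bounds the mean of its supremum, if
the field is the sum of a continuous random field and of a nonrandom function. -/
theorem lintegral_iSup_le_of_finite {X : Type*} [TopologicalSpace X]
    [TopologicalSpace.MetrizableSpace X] [SecondCountableTopology X]
    {P : Measure Ω} {Θ : Set X} (hne : Θ.Nonempty) {φ : X → Ω → ℝ} {r : X → ℝ}
    (hφ : ∀ θ ∈ Θ, AEMeasurable (φ θ) P) (hcont : ∀ ω, ContinuousOn (fun θ => φ θ ω) Θ)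
    {C : ℝ≥0∞} (hC : ∀ (n : ℕ) (e : Fin n → X), (∀ i, e i ∈ Θ) →
      ∫⁻ ω, Finset.univ.sup (fun i => eexp (φ (e i) ω + r (e i))) ∂P ≤ C) :
    ∫⁻ ω, ⨆ θ ∈ Θ, eexp (φ θ ω + r θ) ∂P ≤ C := by
  -- Density is taken in the graph of r and not just in Θ: r need not be continuous, so
  -- approximating points must also approximate its value.
  obtain ⟨c, hcG, hcc, hcd⟩ := (TopologicalSpace.IsSeparable.of_separableSpace
    ((fun θ => (θ, r θ)) '' Θ)).exists_countable_dense_subset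
  have hcne : c.Nonempty := by
    obtain ⟨θ, hθ⟩ := hne
    exact closure_nonempty_iff.1 ⟨_, hcd ⟨θ, hθ, rfl⟩⟩
  obtain ⟨e, rfl⟩ := hcc.exists_eq_range hcne
  have he : ∀ k, (e k).1 ∈ Θ ∧ (e k).2 = r (e k).1 := by
    intro k
    obtain ⟨θ, hθ, h⟩ := hcG ⟨k, rfl⟩
    rw [← h]
    exact ⟨hθ, rfl⟩
  have hdense : ∀ ω, ⨆ θ ∈ Θ, eexp (φ θ ω + r θ) ≤
      ⨆ n : ℕ, Finset.univ.sup fun i : Fin n => eexp (φ (e i).1 ω + r (e i).1) := by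
    intro ω
    refine iSup₂_le fun θ hθ => ?_
    obtain ⟨q, hq, hqθ⟩ := mem_closure_iff_seq_limit.1 (hcd ⟨θ, hθ, rfl⟩)
    choose k hk using hq
    have h1 : Filter.Tendsto (fun n => (q n).1) Filter.atTop (nhds θ) :=
      (continuous_fst.tendsto _).comp hqθ
    have h2 : Filter.Tendsto (fun n => (q n).2) Filter.atTop (nhds (r θ)) :=
      (continuous_snd.tendsto _).comp hqθ
    have h3 : Filter.Tendsto (fun n => φ (q n).1 ω) Filter.atTop (nhds (φ θ ω)) :=
      (hcont ω θ hθ).tendsto.comp (tendsto_nhdsWithin_iff.2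
        ⟨h1, Filter.Eventually.of_forall fun n => hk n ▸ (he (k n)).1⟩)
    refine le_of_tendsto ((continuous_eexp.tendsto _).comp (h3.add h2))
      (Filter.Eventually.of_forall fun n => ?_)
    refine le_trans (le_of_eq ?_) (le_iSup_of_le (k n + 1)
      (Finset.le_sup (f := fun i : Fin (k n + 1) => eexp (φ (e i).1 ω + r (e i).1))
        (Finset.mem_univ (Fin.last (k n)))))
    simp only [Function.comp_apply, Fin.val_last]
    rw [← (he (k n)).2, hk n]
  calc _ ≤ ∫⁻ ω, ⨆ n : ℕ, Finset.univ.sup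
        (fun i : Fin n => eexp (φ (e i).1 ω + r (e i).1)) ∂P := lintegral_mono hdense
    _ = ⨆ n : ℕ, ∫⁻ ω, Finset.univ.sup
        (fun i : Fin n => eexp (φ (e i).1 ω + r (e i).1)) ∂P := by
      refine lintegral_iSup' (fun n => ?_) (Filter.Eventually.of_forall fun ω a b hab => ?_)
      · exact aemeasurable_finsetSup _ fun i _ =>
          measurable_eexp.comp_aemeasurable ((hφ _ (he i).1).add_const _)
      · refine Finset.sup_le fun i _ => ?_
        exact Finset.le_sup (f := fun i : Fin b => eexp (φ (e i).1 ω + r (e i).1))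
          (Finset.mem_univ (Fin.castLE hab i))
    _ ≤ C := iSup_le fun n => hC n _ fun i => (he i).1

/-- The ellipsoid ‖B v‖ ≤ 1 lies in the ellipsoid ‖A v‖ ≤ σ; compare volumes. -/
theorem frameJac_le_of_norm_le {A B : Param p ≃L[ℝ] Param p} {σ : ℝ} (hσ : 0 ≤ σ)
    (h : ∀ v, ‖A v‖ ≤ σ * ‖B v‖) :
    frameJac B ≤ ENNReal.ofReal (σ ^ p) * frameJac A := by
  have hsub : frameBall B 0 1 ⊆ frameBall A 0 σ := by
    intro v (hv : ‖B (v - 0)‖ ≤ 1)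
    have := h (v - 0)
    exact this.trans ((mul_le_mul_of_nonneg_left hv hσ).trans_eq (mul_one σ))
  have hle := measure_mono (μ := volume) hsub
  rw [volume_frameBall _ _ zero_le_one, volume_frameBall _ _ hσ, one_pow, ENNReal.ofReal_one, one_mul,
    ← mul_assoc, mul_comm (frameJac A)] at hle
  exact (ENNReal.mul_le_mul_iff_left volume_unitBall_ne_zero volume_unitBall_ne_top).1 hle

section

variable {P : Measure Ω} {L : Param p → Ω → ℝ} {μ : Param p → ℝ} {θ₀ : Param p}
  {Θ : Set (Param p)} {A : Param p → Param p ≃L[ℝ] Param p} {ε ρ s : ℝ}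

theorem eexp_neg_le_exp_mul_rateInf {c : ℝ} (hc : 0 ≤ c) {θ x : Param p}
    (hθ : θ ∈ localBall P L μ θ₀ Θ ε x) :
    eexp (-(c * rate P L μ θ₀ θ)) ≤
      EReal.exp (((-c : ℝ) : EReal) * rateInf P L μ θ₀ Θ ε x) := by
  rw [eexp_eq, ← EReal.exp_coe, EReal.exp_le_exp_iff, mul_comm ((-c : ℝ) : EReal),
    ← neg_mul, EReal.coe_mul, mul_comm]
  exact EReal.mul_le_mul_of_nonpos_right (iInf₂_le θ hθ) (by exact_mod_cast neg_nonpos.2 hc)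

/-- The segment from x to θ stays in the ellipsoid at θ, where the metric changes by a factor of at
most σ, so ε/σ² becomes ε/σ ≤ ε. -/
theorem ExpField.mem_localBall {ζ : Param p → Ω → ℝ} {lam σ β : ℝ}
    (h : ExpField P Θ A ζ lam ε σ β)
    (hA : ∀ θ ∈ Θ, ∀ v, quad (covMat P L μ θ₀ θ) v = ‖A θ v‖ ^ 2)
    {θ x : Param p} (hθ : θ ∈ Θ) (hx : x ∈ frameBall (A θ) θ (ε / σ ^ 2)) :
    θ ∈ localBall P L μ θ₀ Θ ε x := by
  have hσ := h.one_le
  have hx' : ‖A θ (x - θ)‖ ≤ ε / σ ^ 2 := hx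
  have hle : ε / σ ^ 2 ≤ ε := div_le_self h.eps_pos.le (one_le_pow₀ hσ)
  refine ⟨hθ, iSup₂_le fun t ht => ENNReal.ofReal_le_ofReal ?_⟩
  have hz : ‖A θ (((1 - t) • x + t • θ) - θ)‖ ≤ ε / σ ^ 2 := by
    have h1 : ((1 - t) • x + t • θ) - θ = (1 - t) • (x - θ) := by module
    rw [h1, map_smul, norm_smul, Real.norm_eq_abs, abs_of_nonneg (by linarith [ht.2])]
    exact (mul_le_of_le_one_left (norm_nonneg _) (by linarith [ht.1])).trans hx'
  obtain ⟨hzΘ, hz1, -⟩ := h.comparable_center hθ (hz.trans hle)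
  rw [hA _ hzΘ]
  refine pow_le_pow_left₀ (norm_nonneg _) ?_ 2
  refine (hz1 _).trans ?_
  rw [← neg_sub x θ, map_neg, norm_neg]
  calc σ * ‖A θ (x - θ)‖ ≤ σ * (ε / σ ^ 2) := by gcongr
    _ = ε / σ := by field_simp
    _ ≤ ε := div_le_self h.eps_pos.le hσ

/-- Of σ^{3p}, the part σ^{2p} comes from the radius ε/σ² and σ^p from exchanging det V(θ i) for det
V(x). As θ i lies in B(ε,x), the infimum M_ε(x,θ₀) does not exceed the rate at θ i. -/
theorem ExpField.envelope_le {ζ : Param p → Ω → ℝ} {lam σ β : ℝ}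
    (h : ExpField P Θ A ζ lam ε σ β)
    (hA : ∀ θ ∈ Θ, ∀ v, quad (covMat P L μ θ₀ θ) v = ‖A θ v‖ ^ 2)
    (hJ : ∀ θ ∈ Θ, frameJac (A θ) * ENNReal.ofReal (√(covMat P L μ θ₀ θ).det) = 1)
    (hρ : 0 ≤ ρ) (hs : s ≤ 1) {ι : Type*} [Fintype ι] {θ : ι → Param p} (hθ : ∀ i, θ i ∈ Θ)
    (x : Param p) :
    envelope A (ε / σ ^ 2) θ (fun i => ρ * (1 - s) * rate P L μ θ₀ (θ i)) x ≤
      Θ.indicator (fun x => ENNReal.ofReal (σ ^ (3 * p)) *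
        ((volume (Metric.closedBall (0 : Param p) 1))⁻¹ * ENNReal.ofReal ((ε ^ p)⁻¹)) *
        integrand P L μ θ₀ Θ ε ρ s x) x := by
  have hσ := h.one_le
  have hσ0 : 0 < σ := zero_lt_one.trans_le hσ
  have hε := h.eps_pos
  refine Finset.sup_le fun i _ => ?_
  by_cases hx : x ∈ frameBall (A (θ i)) (θ i) (ε / σ ^ 2)
  swap
  · rw [Set.indicator_of_notMem hx]
    exact zero_le
  have hx' : ‖A (θ i) (x - θ i)‖ ≤ ε :=
    le_trans (show ‖A (θ i) (x - θ i)‖ ≤ ε / σ ^ 2 from hx)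
      (div_le_self h.eps_pos.le (one_le_pow₀ hσ))
  obtain ⟨hxΘ, -, hx2⟩ := h.comparable_center (hθ i) hx'
  rw [Set.indicator_of_mem hx, Set.indicator_of_mem hxΘ]
  have hJle := frameJac_le_of_norm_le hσ0.le hx2
  have hexp := eexp_neg_le_exp_mul_rateInf (mul_nonneg hρ (sub_nonneg.2 hs))
    (h.mem_localBall hA (hθ i) hx)
  have hJx : (frameJac (A x))⁻¹ = ENNReal.ofReal (√(covMat P L μ θ₀ x).det) :=
    (ENNReal.eq_inv_of_mul_eq_one_left (by rw [mul_comm]; exact hJ x hxΘ)).symm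
  have hJinv : (frameJac (A (θ i)))⁻¹ ≤
      ENNReal.ofReal (σ ^ p) * ENNReal.ofReal (√(covMat P L μ θ₀ x).det) := by
    have hp : ENNReal.ofReal (σ ^ p) ≠ 0 := by
      rw [Ne, ENNReal.ofReal_eq_zero, not_le]
      positivity
    have h1 := ENNReal.inv_le_inv.2 hJle
    rw [ENNReal.mul_inv (Or.inl hp) (Or.inl ENNReal.ofReal_ne_top), hJx] at h1
    calc _ = ENNReal.ofReal (σ ^ p) * ((ENNReal.ofReal (σ ^ p))⁻¹ * (frameJac (A (θ i)))⁻¹) := by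
          rw [← mul_assoc, ENNReal.mul_inv_cancel hp ENNReal.ofReal_ne_top, one_mul]
      _ ≤ _ := by gcongr
  have hr : 0 < (ε / σ ^ 2) ^ p := by positivity
  rw [volume_frameBall _ _ (by positivity), ENNReal.div_eq_inv_mul,
    ENNReal.mul_inv (Or.inl (frameJac_ne_zero _)) (Or.inl (frameJac_ne_top _)),
    ENNReal.mul_inv (Or.inr volume_unitBall_ne_top) (Or.inl ENNReal.ofReal_ne_top),
    ← ENNReal.ofReal_inv_of_pos hr]
  have hpow : ((ε / σ ^ 2) ^ p)⁻¹ = σ ^ (2 * p) * (ε ^ p)⁻¹ := by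
    rw [div_pow, inv_div, pow_mul, div_eq_mul_inv]
  have hpow3 : ENNReal.ofReal (σ ^ (3 * p)) =
      ENNReal.ofReal (σ ^ p) * ENNReal.ofReal (σ ^ (2 * p)) := by
    rw [← ENNReal.ofReal_mul (by positivity), ← pow_add]
    congr 2
    ring
  rw [hpow, ENNReal.ofReal_mul (by positivity), hpow3, integrand]
  calc _ ≤ (ENNReal.ofReal (σ ^ p) * ENNReal.ofReal (√(covMat P L μ θ₀ x).det)) *
        (ENNReal.ofReal (σ ^ (2 * p)) * ENNReal.ofReal ((ε ^ p)⁻¹) *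
          (volume (Metric.closedBall (0 : Param p) 1))⁻¹) *
        EReal.exp (((-(ρ * (1 - s)) : ℝ) : EReal) * rateInf P L μ θ₀ Θ ε x) := by
        gcongr
    _ = _ := by ring

/-- The mean of L(z,θ₀) splits into a difference of means where L z is integrable, that is on Θ;
openness makes this enough near θ. -/
theorem differentiableAt_zeta [IsProbabilityMeasure P] (hΘ : IsOpen Θ) (hθ₀ : θ₀ ∈ Θ)
    (hL : ∀ θ ∈ Θ, Integrable (L θ) P)
    (hELdiff : ∀ θ ∈ Θ, DifferentiableAt ℝ (fun θ' => ∫ ω, L θ' ω ∂P) θ)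
    (hμdiff : ∀ θ ∈ Θ, DifferentiableAt ℝ μ θ) {ω : Ω}
    (hω : ∀ θ ∈ Θ, DifferentiableAt ℝ (fun θ' => L θ' ω) θ) {θ : Param p} (hθ : θ ∈ Θ) :
    DifferentiableAt ℝ (fun z => zeta P L μ θ₀ z ω) θ := by
  have h1 : (fun z => μ z * (L z ω - L θ₀ ω - ((∫ ω, L z ω ∂P) - ∫ ω, L θ₀ ω ∂P))) =ᶠ[nhds θ]
      fun z => zeta P L μ θ₀ z ω := by
    filter_upwards [hΘ.mem_nhds hθ] with z hz
    simp only [zeta, incr]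
    rw [integral_sub (hL z hz) (hL θ₀ hθ₀)]
  refine DifferentiableAt.congr_of_eventuallyEq ?_ h1.symm
  exact (hμdiff θ hθ).mul (((hω θ hθ).sub_const _).sub ((hELdiff θ hθ).sub_const _))

/-- The centred field, set to zero off `Θ` and on the exceptional set `N`. -/
def truncZeta (P : Measure Ω) (L : Param p → Ω → ℝ) (μ : Param p → ℝ) (θ₀ : Param p)
    (Θ : Set (Param p)) (N : Set Ω) (z : Param p) (ω : Ω) : ℝ :=
  (Θ ×ˢ Nᶜ).indicator (fun q : Param p × Ω => zeta P L μ θ₀ q.1 q.2) (z, ω)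

theorem truncZeta_apply {N : Set Ω} {z : Param p} {ω : Ω} (hz : z ∈ Θ) (hω : ω ∉ N) :
    truncZeta P L μ θ₀ Θ N z ω = zeta P L μ θ₀ z ω :=
  Set.indicator_of_mem (show (z, ω) ∈ Θ ×ˢ Nᶜ from ⟨hz, hω⟩) _

theorem truncZeta_eventuallyEq (hΘ : IsOpen Θ) {N : Set Ω} {θ : Param p} {ω : Ω} (hθ : θ ∈ Θ)
    (hω : ω ∉ N) :
    (fun z => truncZeta P L μ θ₀ Θ N z ω) =ᶠ[nhds θ] fun z => zeta P L μ θ₀ z ω := by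
  filter_upwards [hΘ.mem_nhds hθ] with z hz
  exact truncZeta_apply hz hω

theorem differentiableAt_truncZeta (hΘ : IsOpen Θ) {N : Set Ω}
    (hdiff : ∀ ω ∉ N, ∀ θ ∈ Θ, DifferentiableAt ℝ (fun z => zeta P L μ θ₀ z ω) θ)
    (ω : Ω) {θ : Param p} (hθ : θ ∈ Θ) :
    DifferentiableAt ℝ (fun z => truncZeta P L μ θ₀ Θ N z ω) θ := by
  by_cases hω : ω ∈ N
  · have : (fun z => truncZeta P L μ θ₀ Θ N z ω) = fun _ => (0 : ℝ) := by
      funext z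
      exact Set.indicator_of_notMem (fun h => h.2 hω) _
    rw [this]
    exact differentiableAt_const _
  · exact (hdiff ω hω θ hθ).congr_of_eventuallyEq (truncZeta_eventuallyEq hΘ hθ hω)

/-- For λ = ‖A θ v‖/2 and γ = v/‖v‖ the exponent in (ED) is exactly the derivative along v; hence
the range 2 `lam`. -/
theorem CondED.lintegral_eexp_fderiv_le [IsProbabilityMeasure P] {ν₀ lamBar lam : ℝ}
    (h : CondED P L μ θ₀ Θ ν₀ lamBar) (hlam : lam ≤ lamBar)
    (hA : ∀ θ ∈ Θ, ∀ v, quad (covMat P L μ θ₀ θ) v = ‖A θ v‖ ^ 2)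
    {θ : Param p} (hθ : θ ∈ Θ) {v : Param p} (hv : ‖A θ v‖ ≤ 2 * lam) :
    ∫⁻ ω, eexp (fderiv ℝ (fun z => zeta P L μ θ₀ z ω) θ v) ∂P ≤
      eexp (2 * ν₀ ^ 2 * lam ^ 2) := by
  rcases eq_or_ne v 0 with rfl | hv0
  · simp only [map_zero, eexp_zero, lintegral_const, measure_univ, mul_one]
    rw [← eexp_zero, eexp_le_eexp]
    positivity
  have hn : 0 < ‖v‖ := norm_pos_iff.2 hv0
  have hAv : 0 < ‖A θ v‖ := norm_pos_iff.2 fun h0 => hv0 ((A θ).map_eq_zero_iff.1 h0)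
  have hl : |‖A θ v‖ / 2| ≤ lamBar := by
    rw [abs_of_nonneg (by positivity)]
    linarith
  have hγ : ‖‖v‖⁻¹ • v‖ = 1 := by
    rw [norm_smul, norm_inv, norm_norm, inv_mul_cancel₀ hn.ne']
  have h1 := h.2.2 θ hθ _ hl _ hγ
  rw [logMoment, hA θ hθ, Real.sqrt_sq (norm_nonneg _), map_smul, norm_smul, norm_inv, norm_norm,
    ← log_eexp, ENNReal.log_le_log_iff] at h1
  have h2 : ∀ ω, 2 * (‖A θ v‖ / 2) *
      (inner ℝ (‖v‖⁻¹ • v) (gradZeta P L μ θ₀ θ ω) / (‖v‖⁻¹ * ‖A θ v‖)) =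
      fderiv ℝ (fun z => zeta P L μ θ₀ z ω) θ v := by
    intro ω
    rw [real_inner_comm, gradZeta, inner_gradient_left, map_smul, smul_eq_mul]
    field_simp
  simp only [h2] at h1
  refine h1.trans (eexp_le_eexp.2 ?_)
  gcongr
  linarith

/-- The magnitude compares quadratic forms, that is squared norms, so norms compare with the factor
√ν₁. -/
theorem expField_truncZeta [IsProbabilityMeasure P] (hΘ : Convex ℝ Θ)
    {N : Set Ω} (hN : P N = 0)
    (hdiff : ∀ ω ∉ N, ∀ θ ∈ Θ, DifferentiableAt ℝ (fun z => zeta P L μ θ₀ z ω) θ)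
    (hmeas : Measurable fun q : Param p × Ω => truncZeta P L μ θ₀ Θ N q.1 q.2)
    (hA : ∀ θ ∈ Θ, ∀ v, quad (covMat P L μ θ₀ θ) v = ‖A θ v‖ ^ 2)
    {ν₀ lamBar lam : ℝ} (hED : CondED P L μ θ₀ Θ ν₀ lamBar) (hlam0 : 0 ≤ lam)
    (hlam : lam ≤ lamBar) (hε : 0 < ε) (hopen : IsOpen Θ)
    (hell : ∀ θ ∈ Θ, ellipsoid P L μ θ₀ ε θ ⊆ Θ) {ν₁ : ℝ} (hν₁ : 1 ≤ ν₁)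
    (hmag : ∀ θ ∈ Θ, magnitude P L μ θ₀ ε θ ≤ ENNReal.ofReal ν₁) :
    ExpField P Θ A (truncZeta P L μ θ₀ Θ N) lam ε (√ν₁) (2 * ν₀ ^ 2 * lam ^ 2) := by
  have hmem : ∀ θ ∈ Θ, ∀ x, ‖A θ (x - θ)‖ ≤ ε → x ∈ ellipsoid P L μ θ₀ ε θ := by
    intro θ hθ x hx
    change quad (covMat P L μ θ₀ θ) (x - θ) ≤ ε ^ 2
    rw [hA θ hθ]
    gcongr
  refine ⟨hΘ, hopen, hmeas, fun ω θ hθ => differentiableAt_truncZeta hopen hdiff ω hθ, ?_,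
    fun θ hθ x hx => hell θ hθ (hmem θ hθ x hx), ?_, Real.one_le_sqrt.2 hν₁, hε, hlam0,
    by positivity⟩
  · intro θ hθ v hv
    refine le_trans (le_of_eq ?_) (hED.lintegral_eexp_fderiv_le hlam hA hθ hv)
    refine lintegral_congr_ae ?_
    have : ∀ᵐ ω ∂P, ω ∉ N := measure_eq_zero_iff_ae_notMem.1 hN
    filter_upwards [this] with ω hω
    rw [(truncZeta_eventuallyEq hopen hθ hω).fderiv_eq]
  · intro θ hθ x y hx hy v
    rcases eq_or_ne v 0 with rfl | hv0
    · simp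
    have hx' := hmem θ hθ x hx
    have hy' := hmem θ hθ y hy
    have hn : 0 < ‖v‖ := norm_pos_iff.2 hv0
    have hAv : 0 < ‖A y v‖ := norm_pos_iff.2 fun h0 => hv0 ((A y).map_eq_zero_iff.1 h0)
    have hγ : ‖v‖⁻¹ • v ∈ Metric.sphere (0 : Param p) 1 := by
      rw [mem_sphere_zero_iff_norm, norm_smul, norm_inv, norm_norm, inv_mul_cancel₀ hn.ne']
    have h1 : ENNReal.ofReal (quad (covMat P L μ θ₀ x) (‖v‖⁻¹ • v) /
        quad (covMat P L μ θ₀ y) (‖v‖⁻¹ • v)) ≤ ENNReal.ofReal ν₁ := by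
      refine le_trans ?_ (hmag θ hθ)
      exact le_iSup₂_of_le x hx' (le_iSup₂_of_le y hy' (le_iSup₂_of_le _ hγ le_rfl))
    rw [ENNReal.ofReal_le_ofReal_iff (by linarith), hA x (hell θ hθ hx'), hA y (hell θ hθ hy'),
      map_smul, map_smul, norm_smul, norm_smul, norm_inv, norm_norm, ← div_pow,
      mul_div_mul_left _ _ (inv_ne_zero hn.ne')] at h1
    have h2 := Real.le_sqrt_of_sq_le h1
    rwa [div_le_iff₀ hAv] at h2

theorem isOpen_of_ellipsoid_subset
    (hA : ∀ θ ∈ Θ, ∀ v, quad (covMat P L μ θ₀ θ) v = ‖A θ v‖ ^ 2) (hε : 0 < ε)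
    (hell : ∀ θ ∈ Θ, ellipsoid P L μ θ₀ ε θ ⊆ Θ) : IsOpen Θ := by
  rw [isOpen_iff_mem_nhds]
  intro θ hθ
  have hc : Continuous fun x => ‖A θ (x - θ)‖ := by fun_prop
  have : {x | ‖A θ (x - θ)‖ < ε} ∈ nhds θ :=
    (isOpen_lt hc continuous_const).mem_nhds (by simpa using hε)
  refine Filter.mem_of_superset this fun x (hx : ‖A θ (x - θ)‖ < ε) => hell θ hθ ?_
  change quad (covMat P L μ θ₀ θ) (x - θ) ≤ ε ^ 2
  rw [hA θ hθ]
  gcongr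

end

end

end MinContrast

end

/-! ### Assembly of the bound -/

open MinContrast in
theorem theorem2p8 {p : ℕ} {Ω : Type*} [MeasurableSpace Ω] (P : Measure Ω)
    [IsProbabilityMeasure P]
    -- the random field, the parameter set, the reference point and the scaling factor
    (L : MinContrast.Param p → Ω → ℝ) (Θ : Set (MinContrast.Param p))
    (θ₀ : MinContrast.Param p) (μ : MinContrast.Param p → ℝ)
    (hΘ : Convex ℝ Θ) (hθ₀ : θ₀ ∈ Θ)
    (hL : ∀ θ ∈ Θ, Integrable (L θ) P)
    -- smoothness of the contrast, of its mean and of the scaling factor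
    (hLdiff : ∀ᵐ ω ∂P, ∀ θ ∈ Θ, DifferentiableAt ℝ (fun θ' => L θ' ω) θ)
    (hELdiff : ∀ θ ∈ Θ, DifferentiableAt ℝ (fun θ' => ∫ ω, L θ' ω ∂P) θ)
    (hμdiff : ∀ θ ∈ Θ, DifferentiableAt ℝ μ θ)
    -- (EG), and `μ(θ)` is chosen in `Υ(θ)`
    (hEG : MinContrast.CondEG P L θ₀ Θ)
    (hμ : ∀ θ ∈ Θ, μ θ ∈ MinContrast.Upsilon P L θ₀ θ)
    -- every `V(θ)` is non-degenerate
    (hV : ∀ θ ∈ Θ, (MinContrast.covMat P L μ θ₀ θ).PosDef)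
    -- (ED)
    (ν₀ lamBar : ℝ) (hED : MinContrast.CondED P L μ θ₀ Θ ν₀ lamBar)
    (ρ s : ℝ) (hρ₀ : 0 ≤ ρ) (hρ₁ : ρ < 1) (hs₀ : 0 ≤ s) (hs₁ : s < 1)
    (ε : ℝ) (hε : 0 < ε) (hερ : ε * ρ / (1 - ρ) ≤ lamBar)
    -- the local ellipsoids lie in the set where `V` is defined,
    -- and `V` has magnitude at most `ν₁` over each of them
    (hell : ∀ θ ∈ Θ, MinContrast.ellipsoid P L μ θ₀ ε θ ⊆ Θ)
    (ν₁ : ℝ) (hν₁ : 1 ≤ ν₁)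
    (hmag : ∀ θ ∈ Θ, MinContrast.magnitude P L μ θ₀ ε θ ≤ ENNReal.ofReal ν₁)
    -- the integral in `H_ε(ρ, s)` makes sense and is finite
    (hmeas : AEMeasurable (MinContrast.integrand P L μ θ₀ Θ ε ρ s) (volume.restrict Θ))
    (hH : MinContrast.logIntegral P L μ θ₀ Θ ε ρ s < ⊤) :
    ENNReal.log (MinContrast.supMoment P L μ θ₀ Θ ρ s) ≤
      (((1 - ρ) * MinContrast.unitBallEntropy p + 2 * ν₀ ^ 2 * ε ^ 2 * ρ ^ 2 / (1 - ρ)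
          + 2 * p * Real.log ν₁ : ℝ) : EReal)
        + MinContrast.logIntegral P L μ θ₀ Θ ε ρ s := by
  choose! A hA hJ using fun θ (hθ : θ ∈ Θ) => exists_frame (hV θ hθ)
  have hopen := isOpen_of_ellipsoid_subset hA hε hell
  have hdiff : ∀ᵐ ω ∂P, ∀ θ ∈ Θ, DifferentiableAt ℝ (fun z => zeta P L μ θ₀ z ω) θ := by
    filter_upwards [hLdiff] with ω hω θ hθ
    exact differentiableAt_zeta hopen hθ₀ hL hELdiff hμdiff hω hθ
  have hincr : ∀ θ ∈ Θ, AEMeasurable (incr L θ θ₀) P := fun θ hθ =>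
    ((hL θ hθ).sub (hL θ₀ hθ₀)).aemeasurable
  have hzeta : ∀ θ ∈ Θ, AEMeasurable (zeta P L μ θ₀ θ) P := fun θ hθ =>
    ((hincr θ hθ).sub_const _).const_mul _
  obtain ⟨N, hN, hNd, hNm⟩ := exists_measurable_modification hopen.measurableSet hzeta hdiff
    fun ω hω θ hθ => (hω θ hθ).continuousAt.continuousWithinAt
  have hNae : ∀ᵐ ω ∂P, ω ∉ N := measure_eq_zero_iff_ae_notMem.1 hN
  have hκ : 0 < 1 - ρ := sub_pos.2 hρ₁
  -- Hölder's inequality raises increments over distance ε to the power ρ/(1-ρ); this is the range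
  -- of moments required.
  obtain ⟨lam, hlam⟩ : ∃ lam, lam = ρ / (1 - ρ) * ε := ⟨_, rfl⟩
  have hlam0 : 0 ≤ lam := by rw [hlam]; positivity
  have hlamBar : lam ≤ lamBar := by
    refine le_trans (le_of_eq ?_) hερ
    rw [hlam]
    ring
  have hF : ExpField P Θ A (truncZeta P L μ θ₀ Θ N) lam ε (√ν₁) (2 * ν₀ ^ 2 * lam ^ 2) :=
    expField_truncZeta hΘ hN hNd hNm hA hED hlam0 hlamBar hε hopen hell hν₁ hmag
  obtain ⟨m, hm⟩ : ∃ m : Param p → ℝ, m = fun θ => ∫ ω, incr L θ θ₀ ω ∂P := ⟨_, rfl⟩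
  have hzeq : ∀ θ ∈ Θ, ∀ ω ∉ N,
      truncZeta P L μ θ₀ Θ N θ ω + μ θ * m θ = μ θ * incr L θ θ₀ ω := by
    intro θ hθ ω hω
    rw [truncZeta_apply hθ hω, zeta, hm]
    ring
  -- With Λ(θ) = -M(θ,θ₀) - μ(θ)m(θ) the variable exp(ζ - Λ) is exp(μL) divided by its mean, almost
  -- surely.
  have hΛ : ∀ θ ∈ Θ, ∫⁻ ω, eexp (truncZeta P L μ θ₀ Θ N θ ω - (-rate P L μ θ₀ θ - μ θ * m θ)) ∂P
      ≤ 1 := by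
    intro θ hθ
    have hint := (hμ θ hθ).2
    have hpos : 0 < ∫ ω, Real.exp (μ θ * incr L θ θ₀ ω) ∂P := integral_exp_pos hint
    have h1 : ∫⁻ ω, eexp (truncZeta P L μ θ₀ Θ N θ ω - (-rate P L μ θ₀ θ - μ θ * m θ)) ∂P =
        ∫⁻ ω, eexp (rate P L μ θ₀ θ) * ENNReal.ofReal (Real.exp (μ θ * incr L θ θ₀ ω)) ∂P := by
      refine lintegral_congr_ae ?_
      filter_upwards [hNae] with ω hω
      rw [← eexp_eq, ← eexp_add, ← hzeq θ hθ ω hω]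
      congr 1
      ring
    rw [h1, lintegral_const_mul' _ _ (eexp_ne_top _), ← ofReal_integral_eq_lintegral_ofReal hint
      (Filter.Eventually.of_forall fun ω => (Real.exp_pos _).le), rate, eexp_eq,
      ← ENNReal.ofReal_mul (Real.exp_pos _).le, Real.exp_neg, Real.exp_log hpos,
      inv_mul_cancel₀ hpos.ne', ENNReal.ofReal_one]
  obtain ⟨I, hI⟩ : ∃ I, I = (volume (Metric.closedBall (0 : Param p) 1))⁻¹ *
    ENNReal.ofReal ((ε ^ p)⁻¹) * ∫⁻ θ in Θ, integrand P L μ θ₀ Θ ε ρ s θ := ⟨_, rfl⟩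
  have hσ0 : 0 < √ν₁ := Real.sqrt_pos.2 (by linarith)
  have henv : ∀ (n : ℕ) (e : Fin n → Param p), (∀ i, e i ∈ Θ) →
      ∫⁻ x, envelope A (ε / √ν₁ ^ 2) e (fun i => ρ * (1 - s) * rate P L μ θ₀ (e i)) x ≤
        ENNReal.ofReal (√ν₁ ^ (3 * p)) * I := by
    intro n e he
    refine (lintegral_mono (hF.envelope_le hA hJ hρ₀ hs₁.le he)).trans (le_of_eq ?_)
    rw [lintegral_indicator hopen.measurableSet, lintegral_const_mul'', hI, mul_assoc]
    · exact hmeas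
  have hsup : supMoment P L μ θ₀ Θ ρ s ≤
      eexp ((1 - ρ) * (unitBallEntropy p + 2 * ν₀ ^ 2 * lam ^ 2)) * ENNReal.ofReal (√ν₁ ^ p) *
        (ENNReal.ofReal (√ν₁ ^ (3 * p)) * I) := by
    have h1 : supMoment P L μ θ₀ Θ ρ s = ∫⁻ ω, ⨆ θ ∈ Θ,
        eexp (ρ * truncZeta P L μ θ₀ Θ N θ ω + ρ * (μ θ * m θ + s * rate P L μ θ₀ θ)) ∂P := by
      refine lintegral_congr_ae ?_
      filter_upwards [hNae] with ω hω
      refine iSup_congr fun θ => iSup_congr fun hθ => ?_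
      rw [← eexp_eq, ← hzeq θ hθ ω hω]
      congr 1
      ring
    rw [h1]
    refine lintegral_iSup_le_of_finite ⟨θ₀, hθ₀⟩
      (fun θ _ => ((hF.measurable_apply θ).const_mul ρ).aemeasurable)
      (fun ω θ hθ => (hF.diff ω θ hθ).continuousAt.continuousWithinAt.const_mul ρ)
      fun n e he => ?_
    -- The penalty is chosen so that ρ(ζ - Λ) - ρ(1-s)M = ρ(μL + sM).
    have h2 := hF.lintegral_sup_le hρ₀ hρ₁ hlam.ge he
      (fun i => ρ * (1 - s) * rate P L μ θ₀ (e i)) fun i => hΛ (e i) (he i)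
    refine le_trans (le_of_eq ?_) (h2.trans (by gcongr; exact henv n e he))
    refine lintegral_congr fun ω => Finset.sup_congr rfl fun i _ => ?_
    congr 1
    ring
  have hconst : eexp ((1 - ρ) * (unitBallEntropy p + 2 * ν₀ ^ 2 * lam ^ 2)) *
      ENNReal.ofReal (√ν₁ ^ p) * (ENNReal.ofReal (√ν₁ ^ (3 * p)) * I) =
      eexp ((1 - ρ) * unitBallEntropy p + 2 * ν₀ ^ 2 * ε ^ 2 * ρ ^ 2 / (1 - ρ)
        + 2 * p * Real.log ν₁) * I := by
    -- One σ^p comes from the finite-family bound and σ^{3p} from the envelope; together they are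
    -- ν₁^{2p}.
    have h1 : √ν₁ ^ p * √ν₁ ^ (3 * p) = Real.exp (2 * p * Real.log ν₁) := by
      rw [← pow_add, show p + 3 * p = 2 * (2 * p) by ring, pow_mul, Real.sq_sqrt (by linarith)]
      rw [show 2 * (p : ℝ) * Real.log ν₁ = ((2 * p : ℕ) : ℝ) * Real.log ν₁ by push_cast; ring,
        Real.exp_nat_mul, Real.exp_log (by linarith)]
    have h2 : (1 - ρ) * (unitBallEntropy p + 2 * ν₀ ^ 2 * lam ^ 2) =
        (1 - ρ) * unitBallEntropy p + 2 * ν₀ ^ 2 * ε ^ 2 * ρ ^ 2 / (1 - ρ) := by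
      rw [hlam]
      field_simp
    rw [← mul_assoc, mul_assoc (eexp _), ← ENNReal.ofReal_mul (by positivity), h1, h2, ← eexp_eq,
      ← eexp_add]
  have hlog := ENNReal.log_le_log_iff.2 (hsup.trans_eq hconst)
  rw [ENNReal.log_mul_add, log_eexp, hI] at hlog
  exact hlog
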